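/- **Setting.** Let $\sigma,\delta\in\{1,-1\}$, $q_-\in\mathbb{R}\setminus\{0\}$, $q_+=\delta q_-$, $q_0=|q_-|$, and let $q:\mathbb{R}^2\to\mathbb{R}$ be a $C^3$ solution of the nonlocal mKdV equation $$q_t(x,t)-6\sigma\,q(-x,-t)\,q(x,t)\,q_x(x,t)+q_{xxx}(x,t)=0,\qquad x,t\in\mathbb{R},$$ such that, as $x\to\pm\infty$, $q\to q_\pm$, $q_x\to0$ and $q_{xx}\to 0$ locally uniformly in $t$, and $(1+|x|)(q(x,t)-q_\pm)\in L^1(\mathbb{R}^\pm)$ for every $t$. Put $$k(z)=\tfrac12\Big(z+\delta\sigma\tfrac{q_0^2}{z}\Big),\quad \lambda(z)=\tfrac12\Big(z-\delta\sigma\tfrac{q_0^2}{z}\Big),\quad \theta(x,t;z)=\lambda(z)\big[x+(4k(z)^2+2\sigma\delta q_0^2)t\big],$$ $$X=ik(z)\begin{bmatrix}1&0\\0&-1\end{bmatrix}+\begin{bmatrix}0&q(x,t)\\ \sigma q(-x,-t)&0\end{bmatrix},\qquad E_\pm(z)=\begin{bmatrix}1&\frac{iq_\pm}{z}\\ -\delta\sigma\frac{iq_\pm}{z}&1\end{bmatrix}.$$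 Let $\Sigma=\mathbb{R}\setminus\{0\}$ and $D_\pm=\{\pm\mathrm{Im}\,z>0\}$ if $\delta\sigma=1$, and $\Sigma=(\mathbb{R}\setminus\{0\})\cup\{|z|=q_0\}$ and $D_\pm=\{\pm(|z|-q_0)\,\mathrm{Im}\,z>0\}$ if $\delta\sigma=-1$; let $\Sigma^0=\Sigma\setminus\{z: z^2=\delta\sigma q_0^2\}$. For $z\in\Sigma$ let $\Phi_\pm(x,t;z)=(\Phi_{\pm1},\Phi_{\pm2})$ be the Jost solutions, that is, the solutions of $\Phi_x=X\Phi$ with $\Phi_\pm e^{-i\theta\,\mathrm{diag}(1,-1)}\to E_\pm(z)$ as $x\to\pm\infty$; the columns $\Phi_{+1},\Phi_{-2}$ extend to $D_+$ and $\Phi_{-1},\Phi_{+2}$ to $D_-$, with the same normalization. The scattering coefficients, which do not depend on $(x,t)$, are $$s_{11}=\frac{\det(\Phi_{+1},\Phi_{-2})}{d},\quad s_{12}=\frac{\det(\Phi_{+2},\Phi_{-2})}{d},\quad s_{21}=\frac{\det(\Phi_{-1},\Phi_{+1})}{d},\quad s_{22}=\frac{\det(\Phi_{-1},\Phi_{+2})}{d},\qquad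 d=1-\delta\sigma\frac{q_0^2}{z^2}.$$ Assume that there are no spectral singularities ($s_{11}\ne0$ and $s_{22}\neq 0$ on $\Sigma^0$), and that the zeros of $s_{11}$ in $D_+$ with $\mathrm{Re}\,z>0$ are exactly the distinct points $z_1,\dots,z_{N_1}$, that those with $\mathrm{Re}\,z=0$ are exactly the distinct points $iw_1,\dots,iw_{N_2}$, and that all of these are simple. Let $$(\eta_1,\dots,\eta_{2N_1+N_2})=(z_1,\dots,z_{N_1},-z_1^*,\dots,-z_{N_1}^*,iw_1,\dots,iw_{N_2}),\qquad \widehat\eta_n=\delta\sigma\frac{q_0^2}{\eta_n}\in D_-,$$ and let $A[\widehat\eta_n]=b[\widehat\eta_n]/s_{22}'(\widehat\eta_n)$, where $b[\widehat\eta_n]$ is the constant, independent of $x$ and $t$, with $\Phi_{+2}(x,t;\widehat\eta_n)=b[\widehat\eta_n]\,\Phi_{-1}(x,t;\widehat\eta_n)$. Finally define the matrix $H=(h_{kn})$ and the column vectors $\alpha=(\alpha_n)$, $\beta=(\beta_k)$, $1\le k,n\le 2N_1+N_2$, by $$\alpha_n=A[\widehat\eta_n]\,e^{2i\theta(x,t;\widehat\eta_n)},\qquad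 \beta_k=-\frac{iq_-}{\eta_k},\qquad h_{kn}=\frac{A[\widehat\eta_n]\,e^{2i\theta(x,t;\widehat\eta_n)}}{\eta_k-\widehat\eta_n}-\frac{iq_-}{\eta_k}\,\delta_{k,n},$$ where $\delta_{k,n}$ is the Kronecker delta. **Theorem.** If the reflection coefficients $\varrho=s_{21}/s_{11}$ and $\tilde\varrho=s_{12}/s_{22}$ vanish identically on $\Sigma^0$, then for all $x,t\in\mathbb{R}$ one has $\det H\ne 0$ and $$q(x,t)=q_-+i\,\frac{\det\begin{bmatrix}H&\beta\\ \alpha^{T}&0\end{bmatrix}}{\det H}.$$ -/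

import Mathlib

open Complex Filter Topology MeasureTheory

noncomputable section

/-- The data of the problem: the signs `σ` (nonlinearity) and `δ` (phase difference), the left
boundary value `qm = q₋`, and the real function `q = q(x, t)`. -/
structure NMKdVData where
  σ : ℝ
  δ : ℝ
  qm : ℝ
  q : ℝ → ℝ → ℝ

namespace NMKdVData

/-- The amplitude `q₀ = |q₋| = |q₊|` of the background. -/
def q₀ (P : NMKdVData) : ℝ := |P.qm|

/-- The two ends `x → +∞` and `x → -∞` of the line. -/
inductive Side where
  | plus
  | minus

/-- The filter `x → ±∞`. -/
def Side.atEnd : Side → Filter ℝ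
  | .plus => atTop
  | .minus => atBot

/-- The boundary values `q₊ = δ q₋` and `q₋`. -/
def bdry (P : NMKdVData) : Side → ℝ
  | .plus => P.δ * P.qm
  | .minus => P.qm

/-- `q` is a classical solution of the nonlocal mKdV equation
`q_t - 6 σ q(-x,-t) q q_x + q_xxx = 0` on the plane, with the nonzero boundary conditions
`q → q_±`, `q_x → 0`, `q_xx → 0` as `x → ±∞` (locally uniformly in `t`), and with
`(1 + |x|) (q(x,t) - q_±) ∈ L¹(ℝ^±)` for every `t`. -/
structure IsSolution (P : NMKdVData) : Prop where
  sigma : P.σ = 1 ∨ P.σ = -1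
  delta : P.δ = 1 ∨ P.δ = -1
  qm_ne : P.qm ≠ 0
  smooth : ContDiff ℝ 3 (fun p : ℝ × ℝ => P.q p.1 p.2)
  pde : ∀ x t : ℝ,
    deriv (fun s => P.q x s) t
      - 6 * P.σ * P.q (-x) (-t) * P.q x t * deriv (fun y => P.q y t) x
      + iteratedDeriv 3 (fun y => P.q y t) x = 0
  lim : ∀ s : Side, TendstoLocallyUniformly P.q (fun _ => P.bdry s) s.atEnd
  lim_x : ∀ s : Side, TendstoLocallyUniformly
    (fun x t => deriv (fun y => P.q y t) x) (fun _ => 0) s.atEnd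
  lim_xx : ∀ s : Side, TendstoLocallyUniformly
    (fun x t => iteratedDeriv 2 (fun y => P.q y t) x) (fun _ => 0) s.atEnd
  integrable_plus : ∀ t : ℝ,
    IntegrableOn (fun x => (1 + |x|) * (P.q x t - P.bdry .plus)) (Set.Ioi 0)
  integrable_minus : ∀ t : ℝ,
    IntegrableOn (fun x => (1 + |x|) * (P.q x t - P.bdry .minus)) (Set.Iio 0)

/-! ### Uniformization variable -/

/-- `k(z) = (z + δσ q₀² / z) / 2`. -/
def k (P : NMKdVData) (z : ℂ) : ℂ := (z + P.δ * P.σ * (P.q₀ : ℂ) ^ 2 / z) / 2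

/-- `λ(z) = (z - δσ q₀² / z) / 2`. -/
def lam (P : NMKdVData) (z : ℂ) : ℂ := (z - P.δ * P.σ * (P.q₀ : ℂ) ^ 2 / z) / 2

/-- `θ(x, t; z) = λ(z) (x + (4 k(z)² + 2 σδ q₀²) t)`. -/
def theta (P : NMKdVData) (x t : ℝ) (z : ℂ) : ℂ :=
  P.lam z * (x + (4 * P.k z ^ 2 + 2 * P.σ * P.δ * (P.q₀ : ℂ) ^ 2) * t)

/-- The region `D₊`, where `Im λ(z) > 0`. -/
def Dplus (P : NMKdVData) : Set ℂ :=
  {z | (P.δ * P.σ = 1 ∧ 0 < z.im) ∨ (P.δ * P.σ = -1 ∧ 0 < (‖z‖ - P.q₀) * z.im)}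

/-- The continuous spectrum `Σ`. -/
def Sig (P : NMKdVData) : Set ℂ :=
  {z | (z.im = 0 ∧ z ≠ 0) ∨ (P.δ * P.σ = -1 ∧ ‖z‖ = P.q₀)}

/-- `Σ⁰`: the continuous spectrum without the branch points `z = ± √(δσ) q₀`. -/
def Sig₀ (P : NMKdVData) : Set ℂ :=
  {z | z ∈ P.Sig ∧ z ^ 2 ≠ P.δ * P.σ * (P.q₀ : ℂ) ^ 2}

/-! ### Lax operator and Jost solutions -/

/-- The Pauli matrix `σ₃`. -/
def sigma₃ : Matrix (Fin 2) (Fin 2) ℂ := !![1, 0; 0, -1]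

/-- The potential matrix `Q(x, t)`. -/
def Q (P : NMKdVData) (x t : ℝ) : Matrix (Fin 2) (Fin 2) ℂ :=
  !![0, (P.q x t : ℂ); P.σ * (P.q (-x) (-t) : ℂ), 0]

/-- `X(x, t; z) = i k(z) σ₃ + Q(x, t)`. -/
def X (P : NMKdVData) (x t : ℝ) (z : ℂ) : Matrix (Fin 2) (Fin 2) ℂ :=
  (I * P.k z) • sigma₃ + P.Q x t

/-- The background matrix `E_±(z)`. -/
def E (P : NMKdVData) (s : Side) (z : ℂ) : Matrix (Fin 2) (Fin 2) ℂ :=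
  !![1, I * P.bdry s / z; -(P.δ * P.σ) * (I * P.bdry s / z), 1]

/-- `φ` is the `j`-th column, at time `t`, of the Jost solution `Φ_±(·, t; z)`: it solves the
scattering problem `φ_x = X φ`, and the `j`-th column of `Φ_± e^{-iθσ₃}` tends to that of `E_±(z)`
at the corresponding end of the line. Such a `φ` is unique for `z ∈ Σ`; it is also unique
for `z ∈ D₊` for the columns `Φ₊₁`, `Φ₋₂`, and for `z ∈ D₋` for the columns `Φ₋₁`, `Φ₊₂`, where
it is the analytic continuation from `Σ`. -/
def IsJostColumn (P : NMKdVData) (s : Side) (j : Fin 2) (t : ℝ) (z : ℂ)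
    (φ : ℝ → Fin 2 → ℂ) : Prop :=
  (∀ x : ℝ, HasDerivAt φ ((P.X x t z).mulVec (φ x)) x) ∧
  Tendsto (fun x => cexp (-(I * P.theta x t z * sigma₃ j j)) • φ x) s.atEnd
    (𝓝 (fun i => P.E s z i j))

/-- The `j`-th column `Φ_{±j}(x, t; z)` of the Jost solution (columns are indexed by `0, 1`). -/
def jost (P : NMKdVData) (s : Side) (j : Fin 2) (x t : ℝ) (z : ℂ) : Fin 2 → ℂ :=
  Classical.epsilon (P.IsJostColumn s j t z) x

/-! ### Scattering coefficients -/

/-- The Wronskian determinant of two vectors. -/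
def Wr (u v : Fin 2 → ℂ) : ℂ := u 0 * v 1 - u 1 * v 0

/-- `det E_±(z) = 1 - δσ q₀² / z²`. -/
def detE (P : NMKdVData) (z : ℂ) : ℂ := 1 - P.δ * P.σ * (P.q₀ : ℂ) ^ 2 / z ^ 2

/-- The scattering coefficient `s₁₁`. This Wronskian and the three below do not depend on the point
`(x, t)` at which they are evaluated; the point `(0, 0)` is used. -/
def s₁₁ (P : NMKdVData) (z : ℂ) : ℂ :=
  Wr (P.jost .plus 0 0 0 z) (P.jost .minus 1 0 0 z) / P.detE z

/-- The scattering coefficient `s₁₂`. -/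
def s₁₂ (P : NMKdVData) (z : ℂ) : ℂ :=
  Wr (P.jost .plus 1 0 0 z) (P.jost .minus 1 0 0 z) / P.detE z

/-- The scattering coefficient `s₂₁`. -/
def s₂₁ (P : NMKdVData) (z : ℂ) : ℂ :=
  Wr (P.jost .minus 0 0 0 z) (P.jost .plus 0 0 0 z) / P.detE z

/-- The scattering coefficient `s₂₂`. -/
def s₂₂ (P : NMKdVData) (z : ℂ) : ℂ :=
  Wr (P.jost .minus 0 0 0 z) (P.jost .plus 1 0 0 z) / P.detE z

/-- The reflection coefficient `ϱ = s₂₁ / s₁₁`. -/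
def rho (P : NMKdVData) (z : ℂ) : ℂ := P.s₂₁ z / P.s₁₁ z

/-- The reflection coefficient `ϱ̃ = s₁₂ / s₂₂`. -/
def rhoTilde (P : NMKdVData) (z : ℂ) : ℂ := P.s₁₂ z / P.s₂₂ z

/-- There are no spectral singularities, and both reflection coefficients vanish identically. -/
structure IsReflectionless (P : NMKdVData) : Prop where
  s₁₁_ne : ∀ z ∈ P.Sig₀, P.s₁₁ z ≠ 0
  s₂₂_ne : ∀ z ∈ P.Sig₀, P.s₂₂ z ≠ 0
  rho_eq : ∀ z ∈ P.Sig₀, P.rho z = 0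
  rhoTilde_eq : ∀ z ∈ P.Sig₀, P.rhoTilde z = 0

/-! ### Discrete spectrum and norming constants -/

/-- The zeros of `s₁₁` in `D₊` with positive real part are exactly the `N₁` distinct points `z_n`,
those with zero real part are exactly the `N₂` distinct points `i w_n`, and all of them are
simple. -/
structure IsDiscreteSpectrum (P : NMKdVData) {N₁ N₂ : ℕ} (z : Fin N₁ → ℂ) (w : Fin N₂ → ℝ) :
    Prop where
  z_inj : Function.Injective z
  w_inj : Function.Injective w
  range_z : Set.range z = {ζ | ζ ∈ P.Dplus ∧ 0 < ζ.re ∧ P.s₁₁ ζ = 0}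
  range_w : Set.range (fun n => I * (w n : ℂ)) = {ζ | ζ ∈ P.Dplus ∧ ζ.re = 0 ∧ P.s₁₁ ζ = 0}
  simple_z : ∀ n, deriv P.s₁₁ (z n) ≠ 0
  simple_w : ∀ n, deriv P.s₁₁ (I * (w n : ℂ)) ≠ 0

open scoped Classical in
/-- `b[ζ]`, for `ζ` in the discrete spectrum: the proportionality coefficient, independent of
`x` and `t`, in `Φ₊₁ = b Φ₋₂` if `ζ ∈ D₊`, and in `Φ₊₂ = b Φ₋₁` if `ζ ∈ D₋`. -/
def b (P : NMKdVData) (ζ : ℂ) : ℂ :=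
  if ζ ∈ P.Dplus then
    Classical.epsilon fun c : ℂ => ∀ x t : ℝ, P.jost .plus 0 x t ζ = c • P.jost .minus 1 x t ζ
  else
    Classical.epsilon fun c : ℂ => ∀ x t : ℝ, P.jost .plus 1 x t ζ = c • P.jost .minus 0 x t ζ

open scoped Classical in
/-- The norming constant `A[ζ]`, for `ζ` in the discrete spectrum: `b[ζ] / s₁₁'(ζ)` if `ζ ∈ D₊`,
and `b[ζ] / s₂₂'(ζ)` if `ζ ∈ D₋`. -/
def A (P : NMKdVData) (ζ : ℂ) : ℂ :=
  if ζ ∈ P.Dplus then P.b ζ / deriv P.s₁₁ ζ else P.b ζ / deriv P.s₂₂ ζ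

/-- The index set of the `2 N₁ + N₂` discrete eigenvalues in `D₊`. -/
abbrev Idx (N₁ N₂ : ℕ) : Type := (Fin N₁ ⊕ Fin N₁) ⊕ Fin N₂

/-- The discrete eigenvalues `η_n`: the `z_n`, then the `-z_n*`, then the `i w_n`. -/
def eta {N₁ N₂ : ℕ} (z : Fin N₁ → ℂ) (w : Fin N₂ → ℝ) : Idx N₁ N₂ → ℂ :=
  Sum.elim (Sum.elim z (fun n => -(starRingEnd ℂ) (z n))) (fun n => I * (w n : ℂ))

/-- `η̂_n = δσ q₀² / η_n`. -/
def etaHat (P : NMKdVData) {N₁ N₂ : ℕ} (z : Fin N₁ → ℂ) (w : Fin N₂ → ℝ) (n : Idx N₁ N₂) : ℂ :=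
  P.δ * P.σ * (P.q₀ : ℂ) ^ 2 / eta z w n

/-! ### The determinants -/

/-- `α_n = A[η̂_n] e^{2iθ(x, t; η̂_n)}`. -/
def alpha (P : NMKdVData) {N₁ N₂ : ℕ} (z : Fin N₁ → ℂ) (w : Fin N₂ → ℝ) (x t : ℝ)
    (n : Idx N₁ N₂) : ℂ :=
  P.A (P.etaHat z w n) * cexp (2 * I * P.theta x t (P.etaHat z w n))

/-- `β_k = -i q₋ / η_k`. -/
def beta (P : NMKdVData) {N₁ N₂ : ℕ} (z : Fin N₁ → ℂ) (w : Fin N₂ → ℝ) (k : Idx N₁ N₂) : ℂ :=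
  -(I * P.qm / eta z w k)

/-- `Ĉ_n(ζ) = A[η̂_n] e^{2iθ(x, t; η̂_n)} / (ζ - η̂_n)`. -/
def CHat (P : NMKdVData) {N₁ N₂ : ℕ} (z : Fin N₁ → ℂ) (w : Fin N₂ → ℝ) (x t : ℝ)
    (n : Idx N₁ N₂) (ζ : ℂ) : ℂ :=
  P.A (P.etaHat z w n) * cexp (2 * I * P.theta x t (P.etaHat z w n)) / (ζ - P.etaHat z w n)

/-- `H = (h_{kn})`, `h_{kn} = Ĉ_n(η_k) - (i q₋ / η_k) δ_{kn}`. -/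
def H (P : NMKdVData) {N₁ N₂ : ℕ} (z : Fin N₁ → ℂ) (w : Fin N₂ → ℝ) (x t : ℝ) :
    Matrix (Idx N₁ N₂) (Idx N₁ N₂) ℂ :=
  Matrix.of fun k n => P.CHat z w x t n (eta z w k) - if k = n then I * P.qm / eta z w k else 0

/-- The bordered matrix `[[H, β], [αᵀ, 0]]`. -/
def bordered (P : NMKdVData) {N₁ N₂ : ℕ} (z : Fin N₁ → ℂ) (w : Fin N₂ → ℝ) (x t : ℝ) :
    Matrix (Idx N₁ N₂ ⊕ Unit) (Idx N₁ N₂ ⊕ Unit) ℂ :=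
  Matrix.fromBlocks (P.H z w x t) (Matrix.replicateCol Unit (P.beta z w))
    (Matrix.replicateRow Unit (P.alpha z w x t)) 0

end NMKdVData

end

/-!
The scattering problem is rewritten for the first Jost column at `-∞` with the plane wave divided
out, `m(x, t; z) = Φ₋₁ e^{-iθ}`. It solves a Volterra equation whose kernel is bounded, up to linear
growth, on `Im λ(z) ≤ 0`; Picard iteration gives existence, holomorphy in `z` where `Im λ < 0`, and
continuity up to the boundary, the branch points `z² = δσ q₀²` included (this is where the first
moment of `q - q_±` is used). Two symmetries reduce all other Jost columns to `m`: the map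
`z ↦ δσ q₀² / z` exchanges the two columns at one end (`IsJostColumn.hat`), and the nonlocal
reflection `(x, t) ↦ (-x, -t)` exchanges the two ends (`IsJostColumn.reflect`). Since the equation for
`q` is the zero curvature condition of a Lax pair, each Jost column, normalized by the phase `θ` that
contains the time, also solves the time equation (`IsSolution.isLaxSol_jost`); so relations between
Jost columns that hold at one point of the `(x, t)`-plane hold on all of it.

Consider the column that equals `Φ₋₂ e^{iθ}` on `Im λ ≥ 0` and `Φ₊₂ e^{iθ} / s₂₂` on `Im λ < 0`
(`rhSol`). Without reflection, `Φ₊₂ = s₂₂ Φ₋₂` on the continuous spectrum, so the column is continuous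
across it, and then holomorphic by a theorem of Painlevé, with `λ` as a local coordinate
(`differentiableAt_of_continuousAt_of_im_ne_zero`). The remaining singularities are isolated:

* the zeros of `λ'` on the continuous spectrum, where the column is continuous;
* the branch points, where `1 / s₂₂` might have a pole. There `s₂₂ det E` is a product of two factors
  `m₁ ± c m₂` with `c² = -σ`, of which at most one vanishes, and that one to first order only
  (`IsReflectionless.exists_tendsto_div_mFactor`), while `det E` vanishes too; so the singularity is
  removable (`IsReflectionless.tendsto_rhSol_branch`);
* simple poles at the origin (`IsSolution.tendsto_rhSol_zero`) and at the points `η̂_n`, where the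
  residue is `α_n m(η̂_n)` (`IsDiscreteSpectrum.tendsto_rhSol_etaHat`).

At infinity the column tends to `(0, 1)`. By Liouville's theorem it is the sum of this vector and of
its polar parts (`IsDiscreteSpectrum.m_hat_eq`). Evaluated at the points `η_k`, where the column is
`(i q₋ / η_k) m(η̂_k)`, the expansion becomes a linear system with matrix `H` for the numbers
`m(η̂_n)`, with right-hand side `β` for the first components and `-1` for the second
(`IsDiscreteSpectrum.H_mulVec`). Since `H` is a Cauchy matrix with scaled columns plus a diagonal
matrix, the mere solvability of these two systems forces `det H ≠ 0` (`det_ne_zero_of_solvable`).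
Finally, the behaviour of the column at infinity along the imaginary axis recovers `q` from the
residues (`IsDiscreteSpectrum.q_eq`), and Cramer's rule turns the result into a quotient of
determinants (`det_fromBlocks_replicate_zero`).
-/

noncomputable section

/-! ### Holomorphic functions: removable sets, a form of Liouville's theorem, parameter integrals -/

/-- Painlevé's theorem for the real line: a continuous function on a disc that is holomorphic off
the real axis is holomorphic. A rectangle that meets the axis is cut along it, and Morera's theorem
applies. -/
theorem differentiableOn_ball_of_continuousOn_of_im_ne_zero {f : ℂ → ℂ} {c : ℂ} {r : ℝ}
    (hc : ContinuousOn f (Metric.ball c r))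
    (hd : ∀ z ∈ Metric.ball c r, z.im ≠ 0 → DifferentiableAt ℂ f z) :
    DifferentiableOn ℂ f (Metric.ball c r) := by
  refine (isConservativeOn_and_continuousOn_iff_isDifferentiableOn Metric.isOpen_ball).1 ⟨?_, hc⟩
  intro z w hzw
  rw [← add_eq_zero_iff_eq_neg, wedgeIntegral_add_wedgeIntegral_eq]
  have hzw' : (Set.uIcc z.re w.re ×ℂ Set.uIcc z.im w.im) ⊆ Metric.ball c r := hzw
  have hcont : ContinuousOn f (Set.uIcc z.re w.re ×ℂ Set.uIcc z.im w.im) := hc.mono hzw'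
  by_cases h0 : (0 : ℝ) ∈ Set.uIcc z.im w.im
  · have hsub1 : Set.uIcc z.im 0 ⊆ Set.uIcc z.im w.im := Set.uIcc_subset_uIcc Set.left_mem_uIcc h0
    have hsub2 : Set.uIcc 0 w.im ⊆ Set.uIcc z.im w.im := Set.uIcc_subset_uIcc h0 Set.right_mem_uIcc
    have half : ∀ a b : ℝ, Set.uIcc a b ⊆ Set.uIcc z.im w.im →
        (∀ y ∈ Set.Ioo (min a b) (max a b), y ≠ 0) →
        (∫ x : ℝ in z.re..w.re, f (x + a * I)) - (∫ x : ℝ in z.re..w.re, f (x + b * I)) +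
          I • (∫ y : ℝ in a..b, f (w.re + y * I)) -
            I • (∫ y : ℝ in a..b, f (z.re + y * I)) = 0 := by
      intro a b hab hne
      have hsub : Set.uIcc z.re w.re ×ℂ Set.uIcc a b ⊆ (Set.uIcc z.re w.re ×ℂ Set.uIcc z.im w.im) :=
        fun p hp => ⟨hp.1, hab hp.2⟩
      have := integral_boundary_rect_eq_zero_of_continuousOn_of_differentiableOn f
        (⟨z.re, a⟩ : ℂ) (⟨w.re, b⟩ : ℂ) (hcont.mono hsub) (fun p hp => by
          refine (hd p (hzw' (hsub ⟨?_, ?_⟩)) (hne _ hp.2)).differentiableWithinAt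
          · exact Set.Ioo_subset_Icc_self hp.1
          · exact Set.Ioo_subset_Icc_self hp.2)
      simpa using this
    have e1 := half z.im 0 hsub1 (by
      intro y hy
      rcases le_total z.im 0 with h | h
      · rw [min_eq_left h, max_eq_right h] at hy; exact hy.2.ne
      · rw [min_eq_right h, max_eq_left h] at hy; exact hy.1.ne')
    have e2 := half 0 w.im hsub2 (by
      intro y hy
      rcases le_total 0 w.im with h | h
      · rw [min_eq_left h, max_eq_right h] at hy; exact hy.1.ne'
      · rw [min_eq_right h, max_eq_left h] at hy; exact hy.2.ne)
    have hint : ∀ (a : ℝ), a ∈ Set.uIcc z.re w.re → ∀ u v : ℝ, Set.uIcc u v ⊆ Set.uIcc z.im w.im →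
        IntervalIntegrable (fun y : ℝ => f (a + y * I)) volume u v := by
      intro a ha u v huv
      apply ContinuousOn.intervalIntegrable
      refine hcont.comp (by fun_prop) ?_
      intro y hy
      exact ⟨by simpa using ha, by simpa using huv hy⟩
    have s1 := intervalIntegral.integral_add_adjacent_intervals
      (hint w.re Set.right_mem_uIcc _ _ hsub1) (hint w.re Set.right_mem_uIcc _ _ hsub2)
    have s2 := intervalIntegral.integral_add_adjacent_intervals
      (hint z.re Set.left_mem_uIcc _ _ hsub1) (hint z.re Set.left_mem_uIcc _ _ hsub2)
    rw [← s1, ← s2]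
    simp only [smul_eq_mul] at e1 e2 ⊢
    linear_combination e1 + e2
  · refine integral_boundary_rect_eq_zero_of_continuousOn_of_differentiableOn f z w hcont ?_
    intro p hp
    have hp2 : p.im ∈ Set.uIcc z.im w.im := Set.Ioo_subset_Icc_self hp.2
    refine (hd p (hzw' ⟨Set.Ioo_subset_Icc_self hp.1, hp2⟩) ?_).differentiableWithinAt
    intro h
    exact h0 (h ▸ hp2)

/-- Painlevé's theorem for the level curve `Im l = 0` of a holomorphic function `l` that is a local
coordinate at `z₀`. -/
theorem differentiableAt_of_continuousAt_of_im_ne_zero {f l : ℂ → ℂ} {z₀ : ℂ}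
    (hl : AnalyticAt ℂ l z₀) (hl' : deriv l z₀ ≠ 0)
    (hc : ∀ᶠ z in 𝓝 z₀, ContinuousAt f z)
    (hd : ∀ᶠ z in 𝓝 z₀, (l z).im ≠ 0 → DifferentiableAt ℂ f z) :
    DifferentiableAt ℂ f z₀ := by
  have hs : HasStrictDerivAt l (deriv l z₀) z₀ := hl.hasStrictDerivAt
  have hse := hs.hasStrictFDerivAt_equiv hl'
  set g := hs.localInverse l _ z₀ hl' with hg
  have hgt : Tendsto g (𝓝 (l z₀)) (𝓝 z₀) := by
    exact hse.localInverse_tendsto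
  have hri : ∀ᶠ w in 𝓝 (l z₀), l (g w) = w := hs.eventually_right_inverse hl'
  have hli : ∀ᶠ z in 𝓝 z₀, g (l z) = z := hs.eventually_left_inverse hl'
  have hgd : ∀ᶠ w in 𝓝 (l z₀), DifferentiableAt ℂ g w := by
    have hne : ∀ᶠ z in 𝓝 z₀, AnalyticAt ℂ l z ∧ deriv l z ≠ 0 := by
      refine hl.eventually_analyticAt.and ?_
      exact hl.deriv.continuousAt.eventually_ne hl'
    have h2 : ∀ᶠ w in 𝓝 (l z₀), g (l (g w)) = g w := by
      filter_upwards [hri] with w hw; rw [hw]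
    filter_upwards [hgt.eventually hne, hri.eventually_nhds,
      hgt.eventually hli.eventually_nhds, hgt.eventually hli] with w h1 h2 h3 h4
    have hsw : HasStrictDerivAt l (deriv l (g w)) (g w) := h1.1.hasStrictDerivAt
    have := hsw.to_local_left_inverse h1.2 h3
    rw [h2.self_of_nhds] at this
    exact this.hasDerivAt.differentiableAt
  have hcomp : ∀ᶠ w in 𝓝 (l z₀), ContinuousAt (f ∘ g) w ∧
      (w.im ≠ 0 → DifferentiableAt ℂ (f ∘ g) w) := by
    filter_upwards [hgd, hgt.eventually hc, hgt.eventually hd, hri] with w h1 h2 h3 h4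
    refine ⟨ContinuousAt.comp h2 h1.continuousAt, fun h => ?_⟩
    refine DifferentiableAt.comp w (h3 ?_) h1
    rwa [h4]
  obtain ⟨r, hr, hball⟩ := Metric.eventually_nhds_iff_ball.1 hcomp
  have hdiff := differentiableOn_ball_of_continuousOn_of_im_ne_zero
    (f := f ∘ g) (c := l z₀) (r := r)
    (fun w hw => (hball w hw).1.continuousWithinAt) (fun w hw => (hball w hw).2)
  have h5 : DifferentiableAt ℂ (f ∘ g) (l z₀) :=
    hdiff.differentiableAt (Metric.ball_mem_nhds _ hr)
  have h6 : DifferentiableAt ℂ ((f ∘ g) ∘ l) z₀ := h5.comp z₀ hl.differentiableAt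
  refine h6.congr_of_eventuallyEq ?_
  filter_upwards [hli] with z hz
  simp [hz]

/-- A function that is holomorphic off a finite set, with `(z - s) F z → 0` at each exceptional
point `s`, and that tends to `0` at infinity, vanishes off the exceptional set. -/
theorem eq_zero_of_removable_of_tendsto_zero {F : ℂ → ℂ} {S : Set ℂ} (hS : S.Finite)
    (hd : ∀ z ∉ S, DifferentiableAt ℂ F z)
    (hs : ∀ s ∈ S, Tendsto (fun z => (z - s) * F z) (𝓝[≠] s) (𝓝 0))
    (hF : Tendsto F (cocompact ℂ) (𝓝 0)) {z : ℂ} (hz : z ∉ S) : F z = 0 := by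
  classical
  set G : ℂ → ℂ := fun w => if w ∈ S then limUnder (𝓝[≠] w) F else F w with hG
  have hGF : ∀ w ∉ S, G w = F w := fun w hw => by simp [hG, hw]
  have hnhds : ∀ w, ∀ᶠ u in 𝓝[≠] w, u ∉ S := by
    intro w
    have h1 : (S \ {w})ᶜ ∈ 𝓝 w :=
      (hS.subset Set.sdiff_subset).isClosed.isOpen_compl.mem_nhds (by simp)
    filter_upwards [nhdsWithin_le_nhds h1, self_mem_nhdsWithin] with u hu hne hS'
    exact hu ⟨hS', hne⟩
  have hGd : Differentiable ℂ G := by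
    intro w
    by_cases hw : w ∈ S
    · set s : Set ℂ := insert w {u | u ∉ S} with hsdef
      have hsn : {u | u ∉ S} ∈ 𝓝[≠] w := hnhds w
      have ho : (fun u => F u - F w) =o[𝓝[≠] w] fun u => (u - w)⁻¹ := by
        have h1 : F =o[𝓝[≠] w] fun u => (u - w)⁻¹ := by
          refine (Asymptotics.isLittleO_iff_tendsto' ?_).2 ?_
          · filter_upwards [self_mem_nhdsWithin] with u hu h
            exact absurd (inv_eq_zero.1 h) (sub_ne_zero.2 hu)
          · refine (hs w hw).congr fun u => ?_
            rw [div_inv_eq_mul, mul_comm]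
        refine h1.sub ?_
        refine (Asymptotics.isLittleO_iff_tendsto' ?_).2 ?_
        · filter_upwards [self_mem_nhdsWithin] with u hu h
          exact absurd (inv_eq_zero.1 h) (sub_ne_zero.2 hu)
        · have : Tendsto (fun u : ℂ => F w * (u - w)) (𝓝 w) (𝓝 (F w * (w - w))) :=
            (tendsto_const_nhds.mul (tendsto_id.sub tendsto_const_nhds))
          rw [sub_self, mul_zero] at this
          refine (this.mono_left nhdsWithin_le_nhds).congr fun u => ?_
          rw [div_inv_eq_mul]
      have := differentiableOn_update_limUnder_insert_of_isLittleO hsn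
        (fun u hu => (hd u hu).differentiableWithinAt) ho
      have h2 : DifferentiableAt ℂ (Function.update F w (limUnder (𝓝[≠] w) F)) w :=
        this.differentiableAt (insert_mem_nhds_iff.2 hsn)
      refine h2.congr_of_eventuallyEq ?_
      have h3 : ∀ᶠ u in 𝓝[≠] w, G u = Function.update F w (limUnder (𝓝[≠] w) F) u := by
        filter_upwards [hnhds w, self_mem_nhdsWithin] with u hu hne
        rw [hGF u hu, Function.update_of_ne hne]
      rw [eventually_nhdsWithin_iff] at h3
      filter_upwards [h3] with u hu
      by_cases h : u = w
      · subst h; simp [hG, hw]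
      · exact hu h
    · refine (hd w hw).congr_of_eventuallyEq ?_
      filter_upwards [hS.isClosed.isOpen_compl.mem_nhds hw] with u hu using hGF u hu
  have hGt : Tendsto G (cocompact ℂ) (𝓝 0) := by
    refine hF.congr' ?_
    filter_upwards [hS.isCompact.compl_mem_cocompact] with u hu using (hGF u hu).symm
  rw [← hGF z hz]
  exact hGd.apply_eq_of_tendsto_cocompact z hGt

/-- A function with finitely many simple poles, other singularities of which are removable, and
with a limit at infinity, is the sum of its limit and of its polar parts. -/
theorem eq_add_sum_poles {ι : Type*} [Fintype ι] {f : ℂ → ℂ} {p a : ι → ℂ}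
    (hp : Function.Injective p) {S : Set ℂ} (hS : S.Finite)
    (hd : ∀ z ∉ S, DifferentiableAt ℂ f z) (hpS : ∀ i, p i ∈ S)
    (hr : ∀ i, Tendsto (fun z => (z - p i) * f z) (𝓝[≠] p i) (𝓝 (a i)))
    (hs : ∀ s ∈ S, s ∉ Set.range p → Tendsto (fun z => (z - s) * f z) (𝓝[≠] s) (𝓝 0)) {c : ℂ}
    (hf : Tendsto f (cocompact ℂ) (𝓝 c)) {z : ℂ} (hz : z ∉ S) :
    f z = c + ∑ i, a i / (z - p i) := by
  classical
  have hne : ∀ z ∉ S, ∀ i, z - p i ≠ 0 := fun z hz i h => hz (sub_eq_zero.1 h ▸ hpS i)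
  have hdiv : ∀ i, Tendsto (fun z => a i / (z - p i)) (cocompact ℂ) (𝓝 0) := fun i => by
    rw [← Metric.cobounded_eq_cocompact]
    have h1 : Tendsto (fun z : ℂ => z - p i) (Bornology.cobounded ℂ) (Bornology.cobounded ℂ) := by
      simp
    have h2 := (tendsto_inv₀_cobounded.comp h1).const_mul (a i)
    rw [mul_zero] at h2
    exact h2.congr fun z => (div_eq_mul_inv _ _).symm
  have hpole : ∀ s i, Tendsto (fun z => (z - s) * (a i / (z - p i))) (𝓝[≠] s)
      (𝓝 (if p i = s then a i else 0)) := by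
    intro s i
    split_ifs with h
    · subst h
      refine tendsto_const_nhds.congr' ?_
      filter_upwards [self_mem_nhdsWithin] with z hz
      have : z - p i ≠ 0 := sub_ne_zero.2 hz
      field_simp
    · have h1 : ContinuousAt (fun z => (z - s) * (a i / (z - p i))) s := by
        have : s - p i ≠ 0 := sub_ne_zero.2 (Ne.symm h)
        fun_prop (disch := assumption)
      have h2 := h1.tendsto.mono_left (nhdsWithin_le_nhds (s := {s}ᶜ))
      simpa using h2
  have key := eq_zero_of_removable_of_tendsto_zero
    (F := fun z => f z - c - ∑ i, a i / (z - p i)) hS ?_ ?_ ?_ hz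
  · linear_combination key
  · intro z hz
    have h1 := hd z hz
    refine (h1.sub_const c).sub (DifferentiableAt.fun_sum fun i _ => ?_)
    have := hne z hz i
    fun_prop (disch := assumption)
  · intro s hsS
    have h0 : Tendsto (fun z => (z - s) * c) (𝓝[≠] s) (𝓝 0) := by
      have h1 : Continuous fun z => (z - s) * c := by fun_prop
      have h2 := (h1.tendsto s).mono_left (nhdsWithin_le_nhds (s := {s}ᶜ))
      simpa using h2
    have h1 : Tendsto (fun z => (z - s) * f z) (𝓝[≠] s)
        (𝓝 (∑ i, if p i = s then a i else 0)) := by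
      by_cases h : s ∈ Set.range p
      · obtain ⟨j, rfl⟩ := h
        simpa [hp.eq_iff] using hr j
      · have h2 : ∀ i, p i ≠ s := fun i hi => h ⟨i, hi⟩
        simpa [h2] using hs s hsS h
    have h2 := (h1.sub h0).sub (tendsto_finsetSum Finset.univ fun i _ => hpole s i)
    rw [sub_zero, sub_self] at h2
    refine h2.congr fun z => ?_
    rw [mul_sub, mul_sub, Finset.mul_sum]
  · have h1 := (hf.sub_const c).sub (tendsto_finsetSum Finset.univ fun i _ => hdiv i)
    simpa using h1

/-- A dominated integral of functions that are holomorphic in a parameter is holomorphic. -/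
theorem differentiableOn_integral_of_dominated {α E : Type*} [MeasurableSpace α]
    [NormedAddCommGroup E] [NormedSpace ℂ E] [CompleteSpace E] {μ : Measure α} {U : Set ℂ}
    (hU : IsOpen U) {F : ℂ → α → E} {bound : α → ℝ}
    (hmeas : ∀ z ∈ U, AEStronglyMeasurable (F z) μ)
    (hdiff : ∀ᵐ a ∂μ, DifferentiableOn ℂ (fun z => F z a) U)
    (hbound : ∀ᵐ a ∂μ, ∀ z ∈ U, ‖F z a‖ ≤ bound a) (hint : Integrable bound μ) :
    DifferentiableOn ℂ (fun z => ∫ a, F z a ∂μ) U := by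
  intro z₀ hz₀
  obtain ⟨r, hr, hball⟩ := Metric.isOpen_iff.1 hU z₀ hz₀
  have hr2 : 0 < r / 2 := by positivity
  have hsub : ∀ z ∈ Metric.ball z₀ (r / 2), Metric.closedBall z (r / 4) ⊆ U := by
    intro z hz w hw
    apply hball
    rw [Metric.mem_ball] at hz ⊢
    rw [Metric.mem_closedBall] at hw
    have := dist_triangle w z z₀
    linarith
  have key := hasDerivAt_integral_of_dominated_loc_of_deriv_le (μ := μ) (F := F) (x₀ := z₀)
    (s := Metric.ball z₀ (r / 2)) (F' := fun z a => deriv (fun w => F w a) z)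
    (bound := fun a => bound a / (r / 4)) (Metric.ball_mem_nhds _ hr2)
    (by filter_upwards [hU.mem_nhds hz₀] with z hz using hmeas z hz)
    (hint.mono' (hmeas z₀ hz₀) (hbound.mono fun a ha => ha z₀ hz₀))
    (by
      -- The derivative is a pointwise limit of difference quotients, hence measurable
      set u : ℕ → ℂ := fun n => ((r / 2 : ℝ) : ℂ) / (n + 2) with hu
      have hu0 : Tendsto u atTop (𝓝 0) := by
        have h1 : Tendsto (fun n : ℕ => ((n : ℂ) + 2)⁻¹) atTop (𝓝 0) := by
          have := (tendsto_inv_atTop_nhds_zero_nat (𝕜 := ℂ)).comp (tendsto_add_atTop_nat 2)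
          refine this.congr fun n => ?_
          simp
        have h2 := h1.const_mul (((r / 2 : ℝ) : ℂ))
        rw [mul_zero] at h2
        exact h2.congr fun n => (div_eq_mul_inv _ _).symm
      have hune : ∀ n, u n ≠ 0 := by
        intro n
        have : ((n : ℂ) + 2) ≠ 0 := by
          have : ((n + 2 : ℕ) : ℂ) ≠ 0 := Nat.cast_ne_zero.2 (by omega)
          simpa using this
        exact div_ne_zero (ofReal_ne_zero.2 hr2.ne') this
      have hmem : ∀ n, z₀ + u n ∈ U := by
        intro n
        apply hball
        rw [Metric.mem_ball, dist_eq_norm, add_sub_cancel_left, hu]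
        have h3 : ‖((n : ℂ) + 2)‖ = n + 2 := by
          have : ((n : ℂ) + 2) = ((n + 2 : ℕ) : ℂ) := by push_cast; ring
          rw [this, Complex.norm_natCast]; push_cast; ring
        rw [norm_div, h3, Complex.norm_real, Real.norm_of_nonneg hr2.le,
          div_lt_iff₀ (by positivity)]
        have : (0 : ℝ) ≤ n := Nat.cast_nonneg n
        nlinarith
      refine aestronglyMeasurable_of_tendsto_ae atTop
        (f := fun n a => (u n)⁻¹ • (F (z₀ + u n) a - F z₀ a)) ?_ ?_
      · intro n
        exact ((hmeas _ (hmem n)).sub (hmeas _ hz₀)).const_smul _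
      · filter_upwards [hdiff] with a ha
        have hda : HasDerivAt (fun w => F w a) (deriv (fun w => F w a) z₀) z₀ :=
          (ha.differentiableAt (hU.mem_nhds hz₀)).hasDerivAt
        have := hda.tendsto_slope_zero
        refine this.comp (tendsto_nhdsWithin_iff.2 ⟨hu0, Eventually.of_forall fun n => hune n⟩))
    (by
      filter_upwards [hbound, hdiff] with a ha hda z hz
      refine norm_deriv_le_of_forall_mem_sphere_norm_le (by positivity) ?_ ?_
      · apply DifferentiableOn.diffContOnCl
        rw [closure_ball _ (by positivity : r / 4 ≠ 0)]
        exact hda.mono (hsub z hz)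
      · intro w hw
        exact ha w (hsub z hz (Metric.sphere_subset_closedBall hw)))
    (hint.div_const _)
    (by
      filter_upwards [hdiff] with a ha z hz
      exact (ha.differentiableAt (hU.mem_nhds (hsub z hz (Metric.mem_closedBall_self
        (by positivity))))).hasDerivAt)
  exact key.2.differentiableAt.differentiableWithinAt

/-! ### Volterra integral equations on a left half-line -/

/-- The scalar kernel `∫₀ˢ e^{-2iμτ} dτ = (1 - e^{-2iμs}) / (2iμ)`, in a form without division. -/
def expKernel (μ : ℂ) (s : ℝ) : ℂ := ∫ τ in (0 : ℝ)..s, cexp (-(2 * I * μ * τ))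

theorem expKernel_zero (μ : ℂ) : expKernel μ 0 = 0 := by simp [expKernel]

theorem hasDerivAt_expKernel (μ : ℂ) (s : ℝ) :
    HasDerivAt (expKernel μ) (cexp (-(2 * I * μ * s))) s := by
  have hc : Continuous fun τ : ℝ => cexp (-(2 * I * μ * τ)) := by fun_prop
  exact (hc.integral_hasStrictDerivAt 0 s).hasDerivAt

theorem continuous_expKernel (μ : ℂ) : Continuous (expKernel μ) :=
  continuous_iff_continuousAt.2 fun s => (hasDerivAt_expKernel μ s).continuousAt

theorem two_mul_I_mul_expKernel (μ : ℂ) (s : ℝ) :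
    2 * I * μ * expKernel μ s = 1 - cexp (-(2 * I * μ * s)) := by
  by_cases h : μ = 0
  · simp [h]
  have h2 : -(2 * I * μ) ≠ 0 := by simp [h, I_ne_zero]
  have h3 : expKernel μ s = ∫ τ in (0 : ℝ)..s, cexp (-(2 * I * μ) * τ) := by
    simp only [expKernel, neg_mul]
  rw [h3, integral_exp_mul_complex h2]
  field_simp
  simp

theorem expKernel_eq_dslope (μ : ℂ) (s : ℝ) :
    expKernel μ s = s * dslope cexp 0 (-(2 * I * μ * s)) := by
  by_cases hs : s = 0
  · simp [hs, expKernel_zero]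
  by_cases h : μ = 0
  · simp [h, expKernel, dslope_same]
  have h2 : 2 * I * μ ≠ 0 := by simp [h, I_ne_zero]
  apply mul_left_cancel₀ h2
  rw [two_mul_I_mul_expKernel]
  have h6 := sub_smul_dslope cexp 0 (-(2 * I * μ * s))
  simp only [sub_zero, smul_eq_mul, Complex.exp_zero] at h6
  linear_combination h6

theorem differentiable_expKernel (s : ℝ) : Differentiable ℂ fun μ => expKernel μ s := by
  have h1 : Differentiable ℂ (dslope cexp 0) := by
    rw [← differentiableOn_univ, differentiableOn_dslope (by simp)]
    exact Complex.differentiable_exp.differentiableOn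
  simp only [expKernel_eq_dslope]
  fun_prop

theorem norm_cexp_le_one {μ : ℂ} (hμ : μ.im ≤ 0) {s : ℝ} (hs : 0 ≤ s) :
    ‖cexp (-(2 * I * μ * s))‖ ≤ 1 := by
  rw [Complex.norm_exp]
  apply Real.exp_le_one_iff.2
  have : (-(2 * I * μ * s)).re = 2 * μ.im * s := by simp
  rw [this]
  exact mul_nonpos_of_nonpos_of_nonneg (by linarith) hs

theorem norm_expKernel_sub_le {μ : ℂ} (hμ : μ.im ≤ 0) {s t : ℝ} (hs : 0 ≤ s) (ht : 0 ≤ t) :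
    ‖expKernel μ t - expKernel μ s‖ ≤ |t - s| := by
  have := (convex_Ici (0 : ℝ)).norm_image_sub_le_of_norm_hasDerivWithin_le
    (f := expKernel μ) (C := 1) (fun x _ => (hasDerivAt_expKernel μ x).hasDerivWithinAt)
    (fun x hx => norm_cexp_le_one hμ hx) hs ht
  simpa using this

theorem norm_expKernel_le {μ : ℂ} (hμ : μ.im ≤ 0) {s : ℝ} (hs : 0 ≤ s) : ‖expKernel μ s‖ ≤ s := by
  have := norm_expKernel_sub_le hμ le_rfl hs
  rwa [expKernel_zero, sub_zero, sub_zero, abs_of_nonneg hs] at this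

theorem norm_expKernel_mul_norm_le {μ : ℂ} (hμ : μ.im ≤ 0) {s : ℝ} (hs : 0 ≤ s) :
    ‖expKernel μ s‖ * ‖μ‖ ≤ 1 := by
  have h1 := congrArg norm (two_mul_I_mul_expKernel μ s)
  have h2 : ‖1 - cexp (-(2 * I * μ * s))‖ ≤ 2 := by
    refine (norm_sub_le _ _).trans ?_
    have := norm_cexp_le_one hμ hs
    simp only [norm_one]
    linarith
  rw [← h1] at h2
  simp only [norm_mul, Complex.norm_ofNat, Complex.norm_I] at h2
  linarith

section Iic

variable {E : Type*} [NormedAddCommGroup E] [NormedSpace ℂ E]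

theorem hasDerivAt_integral_Iic {F : Type*} [NormedAddCommGroup F] [NormedSpace ℝ F]
    [CompleteSpace F] {g : ℝ → F} (hg : Continuous g)
    (hi : ∀ x, IntegrableOn g (Set.Iic x)) (x : ℝ) :
    HasDerivAt (fun x => ∫ y in Set.Iic x, g y) (g x) x := by
  have h1 : ∀ u, ∫ y in Set.Iic u, g y = (∫ y in Set.Iic x, g y) + ∫ y in x..u, g y := by
    intro u
    rw [← intervalIntegral.integral_Iic_sub_Iic (hi x) (hi u)]
    abel
  rw [funext h1]
  exact ((hg.integral_hasStrictDerivAt x x).hasDerivAt).const_add _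

/-- The derivative of `∫_{-∞}^x h(x - y) g(y) dy` when `h(0) = 0`. -/
theorem hasDerivAt_integral_Iic_expKernel {μ : ℂ} (hμ : μ.im ≤ 0) {g : ℝ → E} (hg : Continuous g)
    (hi : ∀ x, IntegrableOn g (Set.Iic x)) (x : ℝ)
    (hi2 : IntegrableOn (fun y => expKernel μ (x - y) • g y) (Set.Iic x)) :
    HasDerivAt (fun x => ∫ y in Set.Iic x, expKernel μ (x - y) • g y)
      (∫ y in Set.Iic x, cexp (-(2 * I * μ * (x - y : ℝ))) • g y) x := by
  -- the kernel extended by zero to negative arguments is Lipschitz, which makes the domain of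
  -- integration independent of the point
  set F : ℝ → ℝ → E := fun u y => expKernel μ (max (u - y) 0) • g y with hF
  have hFc : ∀ u, Continuous (F u) := fun u =>
    ((continuous_expKernel μ).comp (by fun_prop)).smul hg
  set F' : ℝ → E :=
    Set.indicator (Set.Iic x) (fun y => cexp (-(2 * I * μ * (x - y : ℝ))) • g y) with hF'
  have hF'c : Continuous (fun y => cexp (-(2 * I * μ * (x - y : ℝ))) • g y) :=
    Continuous.smul (by fun_prop) hg
  have hlip : ∀ u v y, ‖F u y - F v y‖ ≤ ‖g y‖ * |u - v| := by
    intro u v y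
    rw [hF, ← sub_smul, norm_smul, mul_comm]
    refine mul_le_mul_of_nonneg_left ?_ (norm_nonneg _)
    refine (norm_expKernel_sub_le hμ (le_max_right _ _) (le_max_right _ _)).trans ?_
    refine (abs_max_sub_max_le_abs _ _ _).trans (le_of_eq ?_)
    congr 1; ring
  have hzero : ∀ u y, u ≤ y → F u y = 0 := by
    intro u y h
    simp [hF, max_eq_right (sub_nonpos.2 h), expKernel_zero]
  have hpos : ∀ u y, y ≤ u → F u y = expKernel μ (u - y) • g y := by
    intro u y h
    simp [hF, max_eq_left (sub_nonneg.2 h)]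
  have hind : ∀ u, F u = Set.indicator (Set.Iic u) (fun y => expKernel μ (u - y) • g y) := by
    intro u
    funext y
    by_cases h : y ≤ u
    · rw [Set.indicator_of_mem (Set.mem_Iic.2 h), hpos u y h]
    · rw [Set.indicator_of_notMem (show y ∉ Set.Iic u from h), hzero u y (not_le.1 h).le]
  have hmain := hasDerivAt_integral_of_dominated_loc_of_lip (μ := volume.restrict (Set.Iic (x + 1)))
    (F := F) (x₀ := x) (s := Set.univ) (F' := F') (bound := fun y => ‖g y‖) univ_mem
    (Eventually.of_forall fun u => (hFc u).aestronglyMeasurable)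
    (by
      rw [hind x]
      exact ((integrable_indicator_iff measurableSet_Iic).2 hi2).restrict)
    ((hF'c.aestronglyMeasurable).indicator measurableSet_Iic)
    (Eventually.of_forall fun y => by
      refine LipschitzOnWith.of_dist_le_mul fun u _ v _ => ?_
      rw [dist_eq_norm, Real.dist_eq, Real.coe_nnabs, abs_of_nonneg (norm_nonneg _)]
      exact hlip u v y)
    (hi (x + 1)).norm
    (by
      have hae : ∀ᵐ y ∂(volume.restrict (Set.Iic (x + 1))), y ≠ x :=
        ae_restrict_of_ae (Measure.ae_ne volume x)
      filter_upwards [hae] with y hy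
      rcases lt_or_gt_of_ne hy with h | h
      · have h1 : HasDerivAt (fun u : ℝ => expKernel μ (u - y) • g y)
            (cexp (-(2 * I * μ * (x - y : ℝ))) • g y) x := by
          have := (hasDerivAt_expKernel μ (x - y)).comp_sub_const x y
          exact this.smul_const (g y)
        rw [hF', Set.indicator_of_mem (Set.mem_Iic.2 h.le)]
        refine h1.congr_of_eventuallyEq ?_
        filter_upwards [lt_mem_nhds h] with u hu using hpos u y hu.le
      · rw [hF', Set.indicator_of_notMem (show y ∉ Set.Iic x from not_le.2 h)]
        refine (hasDerivAt_const x (0 : E)).congr_of_eventuallyEq ?_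
        filter_upwards [gt_mem_nhds h] with u hu using hzero u y hu.le)
  have h2 := hmain.2
  have e2 : ∫ y in Set.Iic (x + 1), F' y
      = ∫ y in Set.Iic x, cexp (-(2 * I * μ * (x - y : ℝ))) • g y := by
    rw [hF', setIntegral_indicator measurableSet_Iic, Set.inter_eq_right.2
      (Set.Iic_subset_Iic.2 (by linarith))]
  rw [e2] at h2
  refine h2.congr_of_eventuallyEq ?_
  filter_upwards [gt_mem_nhds (show x < x + 1 by linarith)] with u hu
  rw [hind u, setIntegral_indicator measurableSet_Iic, Set.inter_eq_right.2
      (Set.Iic_subset_Iic.2 hu.le)]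

/-- The primitive of `ρ` that vanishes at `-∞`. -/
def cumul (ρ : ℝ → ℝ) (x : ℝ) : ℝ := ∫ y in Set.Iic x, ρ y

/-- Hypotheses under which Picard iteration solves the Volterra equation
`v(x) = v₀ + ∫_{-∞}^x (1 + h(x - y) N) D(y) v(y) dy`, where `h` is `expKernel μ`. The weight `ω`
allows for the linear growth of `h` when `μ` vanishes. -/
structure VolterraBound (μ : ℂ) (N : E →L[ℂ] E) (D : ℝ → E →L[ℂ] E) (ρ ω : ℝ → ℝ) : Prop where
  im_le : μ.im ≤ 0
  cont_D : Continuous D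
  cont_ρ : Continuous ρ
  int_ρ : ∀ x, IntegrableOn ρ (Set.Iic x)
  one_le : ∀ x, 1 ≤ ω x
  mono : Monotone ω
  bound : ∀ x y, y ≤ x → (1 + ‖expKernel μ (x - y)‖ * ‖N‖) * ‖D y‖ * ω y ≤ ω x * ρ y

/-- The integral operator of the Volterra equation. -/
def volterraOp (μ : ℂ) (N : E →L[ℂ] E) (D : ℝ → E →L[ℂ] E) (v : ℝ → E) (x : ℝ) : E :=
  ∫ y in Set.Iic x, (D y (v y) + expKernel μ (x - y) • N (D y (v y)))

/-- The Picard iterates, whose sum solves the Volterra equation. -/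
def picardIter (μ : ℂ) (N : E →L[ℂ] E) (D : ℝ → E →L[ℂ] E) (e : E) : ℕ → ℝ → E
  | 0 => fun _ => e
  | n + 1 => volterraOp μ N D (picardIter μ N D e n)

/-- The solution of the Volterra equation, as the sum of the Picard iterates. -/
def volterraSol (μ : ℂ) (N : E →L[ℂ] E) (D : ℝ → E →L[ℂ] E) (e : E) (x : ℝ) : E :=
  ∑' n, picardIter μ N D e n x

namespace VolterraBound

variable {μ : ℂ} {N : E →L[ℂ] E} {D : ℝ → E →L[ℂ] E} {ρ ω : ℝ → ℝ}

theorem norm_D_le (h : VolterraBound μ N D ρ ω) (y : ℝ) : ‖D y‖ ≤ ρ y := by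
  have h1 := h.bound y y le_rfl
  rw [sub_self, expKernel_zero, norm_zero, zero_mul, add_zero, one_mul, mul_comm] at h1
  exact le_of_mul_le_mul_left h1 (by linarith [h.one_le y])

theorem ρ_nonneg (h : VolterraBound μ N D ρ ω) (y : ℝ) : 0 ≤ ρ y :=
  (norm_nonneg _).trans (h.norm_D_le y)

theorem cumul_nonneg (h : VolterraBound μ N D ρ ω) (x : ℝ) : 0 ≤ cumul ρ x :=
  setIntegral_nonneg measurableSet_Iic fun y _ => h.ρ_nonneg y

theorem hasDerivAt_cumul (h : VolterraBound μ N D ρ ω) (x : ℝ) : HasDerivAt (cumul ρ) (ρ x) x :=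
  hasDerivAt_integral_Iic h.cont_ρ h.int_ρ x

theorem continuous_cumul (h : VolterraBound μ N D ρ ω) : Continuous (cumul ρ) :=
  continuous_iff_continuousAt.2 fun x => (h.hasDerivAt_cumul x).continuousAt

theorem monotone_cumul (h : VolterraBound μ N D ρ ω) : Monotone (cumul ρ) := fun _ y hxy =>
  setIntegral_mono_set (h.int_ρ y) (Eventually.of_forall fun u => h.ρ_nonneg u)
    (LE.le.eventuallyLE (Set.Iic_subset_Iic.2 hxy))

theorem tendsto_cumul (h : VolterraBound μ N D ρ ω) : Tendsto (cumul ρ) atBot (𝓝 0) := by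
  have h1 := intervalIntegral_tendsto_integral_Iic 0 (h.int_ρ 0) tendsto_id
  have h2 : ∀ x, cumul ρ x = cumul ρ 0 - ∫ y in x..0, ρ y := by
    intro x
    rw [← intervalIntegral.integral_Iic_sub_Iic (h.int_ρ x) (h.int_ρ 0)]
    simp [cumul]
  rw [funext h2]
  have h3 := h1.const_sub (cumul ρ 0)
  simpa [cumul] using h3

theorem integral_exp_cumul (h : VolterraBound μ N D ρ ω) (x : ℝ) :
    IntegrableOn (fun y => ρ y * Real.exp (2 * cumul ρ y)) (Set.Iic x) ∧
    ∫ y in Set.Iic x, ρ y * Real.exp (2 * cumul ρ y) = (Real.exp (2 * cumul ρ x) - 1) / 2 := by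
  have hi : IntegrableOn (fun y => ρ y * Real.exp (2 * cumul ρ y)) (Set.Iic x) := by
    refine Integrable.mono' ((h.int_ρ x).mul_const (Real.exp (2 * cumul ρ x))) ?_ ?_
    · exact (h.cont_ρ.mul (Real.continuous_exp.comp
        (continuous_const.mul h.continuous_cumul))).aestronglyMeasurable
    · filter_upwards [ae_restrict_mem measurableSet_Iic] with y hy
      rw [norm_mul, Real.norm_of_nonneg (h.ρ_nonneg y), Real.norm_of_nonneg (Real.exp_nonneg _)]
      refine mul_le_mul_of_nonneg_left (Real.exp_le_exp.2 ?_) (h.ρ_nonneg y)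
      linarith [h.monotone_cumul hy]
  refine ⟨hi, ?_⟩
  have hd : ∀ y ∈ Set.Iic x, HasDerivAt (fun y => Real.exp (2 * cumul ρ y) / 2)
      (ρ y * Real.exp (2 * cumul ρ y)) y := by
    intro y _
    have := (((h.hasDerivAt_cumul y).const_mul 2).exp).div_const 2
    refine this.congr_deriv ?_
    ring
  have ht : Tendsto (fun y => Real.exp (2 * cumul ρ y) / 2) atBot (𝓝 (1 / 2)) := by
    have := ((Real.continuous_exp.tendsto _).comp (h.tendsto_cumul.const_mul 2)).div_const 2
    simpa using this
  rw [integral_Iic_of_hasDerivAt_of_tendsto' hd hi ht]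
  ring

variable {v : ℝ → E} {M : ℝ}

theorem norm_integrand_le (h : VolterraBound μ N D ρ ω)
    (hv : ∀ y, ‖v y‖ ≤ M * ω y * Real.exp (2 * cumul ρ y)) {x y : ℝ} (hxy : y ≤ x) :
    ‖D y (v y)‖ + ‖expKernel μ (x - y) • N (D y (v y))‖
      ≤ M * ω x * (ρ y * Real.exp (2 * cumul ρ y)) := by
  have hM : 0 ≤ M := by
    have h1 := (norm_nonneg _).trans (hv y)
    have h2 : 0 < ω y * Real.exp (2 * cumul ρ y) :=
      mul_pos (by linarith [h.one_le y]) (Real.exp_pos _)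
    rw [mul_assoc] at h1
    exact nonneg_of_mul_nonneg_left h1 h2
  have h1 : ‖D y (v y)‖ ≤ ‖D y‖ * ‖v y‖ := (D y).le_opNorm _
  have h2 : ‖N (D y (v y))‖ ≤ ‖N‖ * ‖D y (v y)‖ := N.le_opNorm _
  have h3 : ‖D y (v y)‖ + ‖expKernel μ (x - y) • N (D y (v y))‖
      ≤ (1 + ‖expKernel μ (x - y)‖ * ‖N‖) * ‖D y‖ * ‖v y‖ := by
    rw [norm_smul]
    calc _ ≤ ‖D y (v y)‖ + ‖expKernel μ (x - y)‖ * (‖N‖ * ‖D y (v y)‖) := by gcongr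
      _ = (1 + ‖expKernel μ (x - y)‖ * ‖N‖) * ‖D y (v y)‖ := by ring
      _ ≤ (1 + ‖expKernel μ (x - y)‖ * ‖N‖) * (‖D y‖ * ‖v y‖) := by gcongr
      _ = _ := by ring
  calc _ ≤ (1 + ‖expKernel μ (x - y)‖ * ‖N‖) * ‖D y‖ * (M * ω y * Real.exp (2 * cumul ρ y)) := by
        refine h3.trans ?_
        gcongr
        exact hv y
    _ = ((1 + ‖expKernel μ (x - y)‖ * ‖N‖) * ‖D y‖ * ω y) * (M * Real.exp (2 * cumul ρ y)) := by
        ring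
    _ ≤ (ω x * ρ y) * (M * Real.exp (2 * cumul ρ y)) :=
        mul_le_mul_of_nonneg_right (h.bound x y hxy) (by positivity)
    _ = _ := by ring

theorem integrableOn_parts (h : VolterraBound μ N D ρ ω) (hc : Continuous v)
    (hv : ∀ y, ‖v y‖ ≤ M * ω y * Real.exp (2 * cumul ρ y)) (x : ℝ) :
    IntegrableOn (fun y => D y (v y)) (Set.Iic x) ∧
    IntegrableOn (fun y => expKernel μ (x - y) • N (D y (v y))) (Set.Iic x) := by
  have hDv : Continuous fun y => D y (v y) := h.cont_D.clm_apply hc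
  have hb := (h.integral_exp_cumul x).1.const_mul (M * ω x)
  refine ⟨Integrable.mono' hb hDv.aestronglyMeasurable ?_, Integrable.mono' hb ?_ ?_⟩
  · filter_upwards [ae_restrict_mem measurableSet_Iic] with y hy
    exact (le_add_of_nonneg_right (norm_nonneg _)).trans (h.norm_integrand_le hv hy)
  · exact (Continuous.smul ((continuous_expKernel μ).comp (by fun_prop))
      (N.continuous.comp hDv)).aestronglyMeasurable
  · filter_upwards [ae_restrict_mem measurableSet_Iic] with y hy
    exact (le_add_of_nonneg_left (norm_nonneg _)).trans (h.norm_integrand_le hv hy)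

theorem integrableOn_integrand (h : VolterraBound μ N D ρ ω) (hc : Continuous v)
    (hv : ∀ y, ‖v y‖ ≤ M * ω y * Real.exp (2 * cumul ρ y)) (x : ℝ) :
    IntegrableOn (fun y => D y (v y) + expKernel μ (x - y) • N (D y (v y))) (Set.Iic x) :=
  (h.integrableOn_parts hc hv x).1.add (h.integrableOn_parts hc hv x).2

theorem integral_norm_integrand_le (h : VolterraBound μ N D ρ ω) (hc : Continuous v)
    (hv : ∀ y, ‖v y‖ ≤ M * ω y * Real.exp (2 * cumul ρ y)) (x : ℝ) :
    ∫ y in Set.Iic x, ‖D y (v y) + expKernel μ (x - y) • N (D y (v y))‖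
      ≤ M * ω x * ((Real.exp (2 * cumul ρ x) - 1) / 2) := by
  rw [← (h.integral_exp_cumul x).2, ← integral_const_mul]
  refine setIntegral_mono_on (h.integrableOn_integrand hc hv x).norm
    ((h.integral_exp_cumul x).1.const_mul _) measurableSet_Iic fun y hy => ?_
  exact (norm_add_le _ _).trans (h.norm_integrand_le hv hy)

theorem norm_volterraOp_le (h : VolterraBound μ N D ρ ω) (hc : Continuous v)
    (hv : ∀ y, ‖v y‖ ≤ M * ω y * Real.exp (2 * cumul ρ y)) (x : ℝ) :
    ‖volterraOp μ N D v x‖ ≤ M * ω x * ((Real.exp (2 * cumul ρ x) - 1) / 2) :=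
  (norm_integral_le_integral_norm _).trans (h.integral_norm_integrand_le hc hv x)

variable [CompleteSpace E]

/-- The image of the Volterra operator solves the inhomogeneous differential equation, because
`N² = -2iμN` turns the derivative of the kernel into multiplication by `N`. -/
theorem hasDerivAt_volterraOp (h : VolterraBound μ N D ρ ω) (hN : ∀ w, N (N w) = -(2 * I * μ) • N w)
    (hc : Continuous v) (hv : ∀ y, ‖v y‖ ≤ M * ω y * Real.exp (2 * cumul ρ y)) (x : ℝ) :
    HasDerivAt (volterraOp μ N D v) (D x (v x) + N (volterraOp μ N D v x)) x := by
  have hDv : Continuous fun y => D y (v y) := h.cont_D.clm_apply hc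
  have hNDv : Continuous fun y => N (D y (v y)) := N.continuous.comp hDv
  have hi1 := fun x => (h.integrableOn_parts hc hv x).1
  have hi2 := fun x => (h.integrableOn_parts hc hv x).2
  have hi3 : ∀ x, IntegrableOn (fun y => N (D y (v y))) (Set.Iic x) := fun x =>
    N.integrable_comp (hi1 x)
  have e1 : volterraOp μ N D v = fun x => (∫ y in Set.Iic x, D y (v y)) +
      ∫ y in Set.Iic x, expKernel μ (x - y) • N (D y (v y)) := by
    funext u
    exact integral_add (hi1 u) (hi2 u)
  have d1 := (hasDerivAt_integral_Iic hDv hi1 x).add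
    (hasDerivAt_integral_Iic_expKernel h.im_le hNDv hi3 x (hi2 x))
  rw [e1]
  refine d1.congr_deriv ?_
  congr 1
  have e2 := congrFun e1 x
  simp only at e2 ⊢
  rw [← e2, volterraOp, ← N.integral_comp_comm (h.integrableOn_integrand hc hv x)]
  refine integral_congr_ae (Eventually.of_forall fun y => ?_)
  simp only [map_add, map_smul, hN]
  have h1 := two_mul_I_mul_expKernel μ (x - y)
  rw [smul_smul, ← one_smul ℂ (N (D y (v y))), smul_smul, smul_smul, ← add_smul]
  congr 1
  linear_combination h1

theorem continuous_volterraOp (h : VolterraBound μ N D ρ ω)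
    (hN : ∀ w, N (N w) = -(2 * I * μ) • N w)
    (hc : Continuous v) (hv : ∀ y, ‖v y‖ ≤ M * ω y * Real.exp (2 * cumul ρ y)) :
    Continuous (volterraOp μ N D v) :=
  continuous_iff_continuousAt.2 fun x => (h.hasDerivAt_volterraOp hN hc hv x).continuousAt

/-- Against the weight `ω e^{2R}`, where `R` is the primitive `cumul ρ`, the Volterra operator has
norm at most `1/2`; so the Picard iterates decay geometrically. -/
theorem picardIter_bound (h : VolterraBound μ N D ρ ω) (hN : ∀ w, N (N w) = -(2 * I * μ) • N w)
    (e : E) (n : ℕ) : Continuous (picardIter μ N D e n) ∧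
      ∀ x, ‖picardIter μ N D e n x‖ ≤ (‖e‖ * (1 / 2) ^ n) * ω x * Real.exp (2 * cumul ρ x) := by
  induction n with
  | zero =>
    refine ⟨continuous_const, fun x => ?_⟩
    have h1 := h.one_le x
    have h2 : 1 ≤ Real.exp (2 * cumul ρ x) := Real.one_le_exp (by linarith [h.cumul_nonneg x])
    have h3 : 1 ≤ ω x * Real.exp (2 * cumul ρ x) := one_le_mul_of_one_le_of_one_le h1 h2
    simp only [picardIter, pow_zero, mul_one, mul_assoc]
    exact le_mul_of_one_le_right (norm_nonneg _) h3
  | succ n ih =>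
    refine ⟨h.continuous_volterraOp hN ih.1 ih.2, fun x => ?_⟩
    refine (h.norm_volterraOp_le ih.1 ih.2 x).trans ?_
    have h1 := h.one_le x
    have h2 : 0 ≤ ‖e‖ * (1 / 2) ^ n * ω x := by positivity
    rw [pow_succ]
    nlinarith [h2]

theorem picardIter_le (h : VolterraBound μ N D ρ ω) (hN : ∀ w, N (N w) = -(2 * I * μ) • N w)
    (e : E) (n : ℕ) {x X : ℝ} (hx : x ≤ X) :
    ‖picardIter μ N D e n x‖ ≤ (‖e‖ * ω X * Real.exp (2 * cumul ρ X)) * (1 / 2) ^ n := by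
  refine ((h.picardIter_bound hN e n).2 x).trans ?_
  have h1 := h.mono hx
  have h2 : Real.exp (2 * cumul ρ x) ≤ Real.exp (2 * cumul ρ X) :=
    Real.exp_le_exp.2 (by linarith [h.monotone_cumul hx])
  have h3 : 0 ≤ ω x := by linarith [h.one_le x]
  calc _ = (‖e‖ * (1 / 2) ^ n) * (ω x * Real.exp (2 * cumul ρ x)) := by ring
    _ ≤ (‖e‖ * (1 / 2) ^ n) * (ω X * Real.exp (2 * cumul ρ X)) := by
        gcongr
        exact h3.trans h1
    _ = _ := by ring

theorem summable_picardIter (h : VolterraBound μ N D ρ ω)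
    (hN : ∀ w, N (N w) = -(2 * I * μ) • N w) (e : E) (x : ℝ) :
    Summable fun n => picardIter μ N D e n x :=
  Summable.of_norm_bounded (summable_geometric_two.mul_left _)
    (fun n => h.picardIter_le hN e n le_rfl)

theorem continuous_volterraSol (h : VolterraBound μ N D ρ ω)
    (hN : ∀ w, N (N w) = -(2 * I * μ) • N w) (e : E) : Continuous (volterraSol μ N D e) := by
  refine continuous_iff_continuousAt.2 fun x => ?_
  have : ContinuousOn (volterraSol μ N D e) (Set.Iic (x + 1)) :=
    continuousOn_tsum (fun n => (h.picardIter_bound hN e n).1.continuousOn)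
      (summable_geometric_two.mul_left _) (fun n y hy => h.picardIter_le hN e n hy)
  exact this.continuousAt (Iic_mem_nhds (by linarith))

theorem norm_volterraSol_le (h : VolterraBound μ N D ρ ω)
    (hN : ∀ w, N (N w) = -(2 * I * μ) • N w) (e : E) (x : ℝ) :
    ‖volterraSol μ N D e x‖ ≤ (2 * ‖e‖) * ω x * Real.exp (2 * cumul ρ x) := by
  have h1 : HasSum (fun n : ℕ => (‖e‖ * ω x * Real.exp (2 * cumul ρ x)) * (1 / 2 : ℝ) ^ n)
      ((‖e‖ * ω x * Real.exp (2 * cumul ρ x)) * 2) := hasSum_geometric_two.mul_left _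
  refine (tsum_of_norm_bounded h1 (fun n => h.picardIter_le hN e n le_rfl)).trans (le_of_eq ?_)
  ring

theorem volterraSol_eq (h : VolterraBound μ N D ρ ω)
    (hN : ∀ w, N (N w) = -(2 * I * μ) • N w) (e : E) (x : ℝ) :
    volterraSol μ N D e x = e + volterraOp μ N D (volterraSol μ N D e) x := by
  have h1 : volterraSol μ N D e x = e + ∑' n, picardIter μ N D e (n + 1) x :=
    (h.summable_picardIter hN e x).tsum_eq_zero_add
  rw [h1]
  congr 1
  have h2 := hasSum_integral_of_summable_integral_norm (μ := volume.restrict (Set.Iic x))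
    (F := fun n y => D y (picardIter μ N D e n y) +
      expKernel μ (x - y) • N (D y (picardIter μ N D e n y)))
    (fun n => h.integrableOn_integrand (h.picardIter_bound hN e n).1
      (h.picardIter_bound hN e n).2 x)
    (Summable.of_nonneg_of_le (fun n => integral_nonneg fun y => norm_nonneg _)
      (fun n => h.integral_norm_integrand_le (h.picardIter_bound hN e n).1
        (h.picardIter_bound hN e n).2 x)
      (((summable_geometric_two.mul_left ‖e‖).mul_right (ω x)).mul_right _))
  rw [show (∑' n, picardIter μ N D e (n + 1) x) = _ from h2.tsum_eq, volterraOp]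
  refine integral_congr_ae (Eventually.of_forall fun y => ?_)
  have hs := h.summable_picardIter hN e y
  have h3 : HasSum (fun n => D y (picardIter μ N D e n y)) (D y (volterraSol μ N D e y)) :=
    (D y).hasSum hs.hasSum
  exact (h3.add ((N.hasSum h3).const_smul _)).tsum_eq

/-- The solution of the Volterra equation solves the differential equation `v' = (N + D) v`
whenever `N` annihilates the inhomogeneity. -/
theorem hasDerivAt_volterraSol (h : VolterraBound μ N D ρ ω)
    (hN : ∀ w, N (N w) = -(2 * I * μ) • N w) {e : E} (he : N e = 0) (x : ℝ) :
    HasDerivAt (volterraSol μ N D e)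
      (N (volterraSol μ N D e x) + D x (volterraSol μ N D e x)) x := by
  have h1 := h.hasDerivAt_volterraOp hN (h.continuous_volterraSol hN e)
    (h.norm_volterraSol_le hN e) x
  have h2 : volterraSol μ N D e = fun x => e + volterraOp μ N D (volterraSol μ N D e) x :=
    funext fun x => h.volterraSol_eq hN e x
  have h3 : N (volterraSol μ N D e x) = N (volterraOp μ N D (volterraSol μ N D e) x) := by
    conv_lhs => rw [h.volterraSol_eq hN e x]
    rw [map_add, he, zero_add]
  rw [h3, add_comm]
  conv => arg 1; rw [h2]
  exact h1.const_add e

theorem norm_volterraSol_sub_le (h : VolterraBound μ N D ρ ω)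
    (hN : ∀ w, N (N w) = -(2 * I * μ) • N w) (e : E) (x : ℝ) :
    ‖volterraSol μ N D e x - e‖ ≤ 2 * ‖e‖ * ω x * ((Real.exp (2 * cumul ρ x) - 1) / 2) := by
  rw [h.volterraSol_eq hN e x, add_sub_cancel_left]
  exact h.norm_volterraOp_le (h.continuous_volterraSol hN e) (h.norm_volterraSol_le hN e) x

theorem tendsto_volterraSol (h : VolterraBound μ N D ρ ω)
    (hN : ∀ w, N (N w) = -(2 * I * μ) • N w) (e : E) :
    Tendsto (volterraSol μ N D e) atBot (𝓝 e) := by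
  rw [tendsto_iff_norm_sub_tendsto_zero]
  have h1 : Tendsto (fun x => 2 * ‖e‖ * ω 0 * ((Real.exp (2 * cumul ρ x) - 1) / 2)) atBot
      (𝓝 0) := by
    have h2 := ((Real.continuous_exp.tendsto _).comp (h.tendsto_cumul.const_mul 2))
    have h3 := ((h2.sub_const 1).div_const 2).const_mul (2 * ‖e‖ * ω 0)
    simpa using h3
  refine squeeze_zero' (Eventually.of_forall fun x => norm_nonneg _) ?_ h1
  filter_upwards [eventually_le_atBot (0 : ℝ)] with x hx
  refine (h.norm_volterraSol_sub_le hN e x).trans ?_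
  have h4 : 0 ≤ (Real.exp (2 * cumul ρ x) - 1) / 2 := by
    have := Real.one_le_exp (x := 2 * cumul ρ x) (by linarith [h.cumul_nonneg x])
    linarith
  have := h.mono hx
  gcongr

end VolterraBound

/-! #### Dependence on a parameter -/

variable [CompleteSpace E] {D : ℝ → E →L[ℂ] E} {ρ ω : ℝ → ℝ} {mu : ℂ → ℂ}
  {N : ℂ → E →L[ℂ] E} {e : ℂ → E} {Z : Set ℂ}

/-- The Picard series converges uniformly in the parameter as long as the Volterra bound does not
depend on it. -/
theorem continuousOn_volterraSol (h : ∀ ζ ∈ Z, VolterraBound (mu ζ) (N ζ) D ρ ω)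
    (hN : ∀ ζ ∈ Z, ∀ w, N ζ (N ζ w) = -(2 * I * mu ζ) • N ζ w) {C : ℝ} (hC : ∀ ζ ∈ Z, ‖e ζ‖ ≤ C)
    (hmu : ContinuousOn mu Z) (hNc : ContinuousOn N Z) (he : ContinuousOn e Z) (x : ℝ) :
    ContinuousOn (fun ζ => volterraSol (mu ζ) (N ζ) D (e ζ) x) Z := by
  rcases Z.eq_empty_or_nonempty with rfl | ⟨ζ₀, hζ₀⟩
  · exact continuousOn_empty _
  have hb : ∀ n, ∀ ζ ∈ Z, ∀ y, ‖picardIter (mu ζ) (N ζ) D (e ζ) n y‖ ≤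
      (C * (1 / 2) ^ n) * ω y * Real.exp (2 * cumul ρ y) := by
    intro n ζ hζ y
    refine (((h ζ hζ).picardIter_bound (hN ζ hζ) (e ζ) n).2 y).trans ?_
    have := hC ζ hζ
    have := (h ζ hζ).one_le y
    gcongr
  have hit : ∀ n x, ContinuousOn (fun ζ => picardIter (mu ζ) (N ζ) D (e ζ) n x) Z := by
    intro n
    induction n with
    | zero => intro x; exact he
    | succ n ih =>
      intro x
      refine continuousOn_of_dominated
        (bound := fun y => C * (1 / 2) ^ n * ω x * (ρ y * Real.exp (2 * cumul ρ y))) ?_ ?_ ?_ ?_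
      · intro ζ hζ
        have hp := (h ζ hζ).picardIter_bound (hN ζ hζ) (e ζ) n
        exact ((h ζ hζ).integrableOn_integrand hp.1 hp.2 x).1
      · intro ζ hζ
        filter_upwards [ae_restrict_mem measurableSet_Iic] with y hy
        exact (norm_add_le _ _).trans ((h ζ hζ).norm_integrand_le (hb n ζ hζ) hy)
      · exact ((h ζ₀ hζ₀).integral_exp_cumul x).1.const_mul _
      · refine Eventually.of_forall fun y => ?_
        have h1 : ContinuousOn (fun ζ => D y (picardIter (mu ζ) (N ζ) D (e ζ) n y)) Z :=
          (D y).continuous.comp_continuousOn (ih y)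
        have h2 : ContinuousOn (fun ζ => expKernel (mu ζ) (x - y)) Z :=
          (differentiable_expKernel (x - y)).continuous.comp_continuousOn hmu
        exact h1.add (h2.smul (hNc.clm_apply h1))
  exact continuousOn_tsum (fun n => hit n x)
    ((summable_geometric_two.mul_left (C * ω x * Real.exp (2 * cumul ρ x))))
    (fun n ζ hζ => (hb n ζ hζ x).trans (le_of_eq (by ring)))

theorem differentiableOn_volterraSol (hZ : IsOpen Z)
    (h : ∀ ζ ∈ Z, VolterraBound (mu ζ) (N ζ) D ρ ω)
    (hN : ∀ ζ ∈ Z, ∀ w, N ζ (N ζ w) = -(2 * I * mu ζ) • N ζ w) {C : ℝ} (hC : ∀ ζ ∈ Z, ‖e ζ‖ ≤ C)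
    (hmu : DifferentiableOn ℂ mu Z) (hNc : DifferentiableOn ℂ N Z) (he : DifferentiableOn ℂ e Z)
    (x : ℝ) :
    DifferentiableOn ℂ (fun ζ => volterraSol (mu ζ) (N ζ) D (e ζ) x) Z := by
  rcases Z.eq_empty_or_nonempty with rfl | ⟨ζ₀, hζ₀⟩
  · exact differentiableOn_empty
  have hb : ∀ n, ∀ ζ ∈ Z, ∀ y, ‖picardIter (mu ζ) (N ζ) D (e ζ) n y‖ ≤
      (C * (1 / 2) ^ n) * ω y * Real.exp (2 * cumul ρ y) := by
    intro n ζ hζ y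
    refine (((h ζ hζ).picardIter_bound (hN ζ hζ) (e ζ) n).2 y).trans ?_
    have := hC ζ hζ
    have := (h ζ hζ).one_le y
    gcongr
  have hit : ∀ n x, DifferentiableOn ℂ (fun ζ => picardIter (mu ζ) (N ζ) D (e ζ) n x) Z := by
    intro n
    induction n with
    | zero => intro x; exact he
    | succ n ih =>
      intro x
      refine differentiableOn_integral_of_dominated hZ
        (bound := fun y => C * (1 / 2) ^ n * ω x * (ρ y * Real.exp (2 * cumul ρ y))) ?_ ?_ ?_ ?_
      · intro ζ hζ
        have hp := (h ζ hζ).picardIter_bound (hN ζ hζ) (e ζ) n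
        exact ((h ζ hζ).integrableOn_integrand hp.1 hp.2 x).1
      · refine Eventually.of_forall fun y => ?_
        have h1 : DifferentiableOn ℂ (fun ζ => D y (picardIter (mu ζ) (N ζ) D (e ζ) n y)) Z :=
          (D y).differentiable.comp_differentiableOn (ih y)
        have h2 : DifferentiableOn ℂ (fun ζ => expKernel (mu ζ) (x - y)) Z :=
          (differentiable_expKernel (x - y)).comp_differentiableOn hmu
        exact h1.add (h2.smul (hNc.clm_apply h1))
      · filter_upwards [ae_restrict_mem measurableSet_Iic] with y hy ζ hζ
        exact (norm_add_le _ _).trans ((h ζ hζ).norm_integrand_le (hb n ζ hζ) hy)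
      · exact ((h ζ₀ hζ₀).integral_exp_cumul x).1.const_mul _
  exact differentiableOn_tsum_of_summable_norm
    ((summable_geometric_two.mul_left (C * ω x * Real.exp (2 * cumul ρ x))))
    (fun n => hit n x) hZ
    (fun n ζ hζ => (hb n ζ hζ x).trans (le_of_eq (by ring)))

end Iic

/-! ### Linear ordinary differential equations: uniqueness, and matrices as operators -/

/-- A solution of a homogeneous linear equation with continuous coefficients that vanishes at one
point vanishes identically. -/
theorem eq_zero_of_hasDerivAt_linear {E : Type*} [NormedAddCommGroup E] [NormedSpace ℂ E]
    {A : ℝ → E →L[ℂ] E} (hA : Continuous A) {u : ℝ → E} (hu : ∀ x, HasDerivAt u (A x (u x)) x)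
    {x₀ : ℝ} (h0 : u x₀ = 0) (x : ℝ) : u x = 0 := by
  set R := |x₀| + |x| + 1 with hR
  have hx₀ : x₀ ∈ Set.Ioo (-R) R := by
    have := abs_le.1 (le_refl |x₀|); have := abs_nonneg x
    constructor <;> linarith
  have hx : x ∈ Set.Ioo (-R) R := by
    have := abs_le.1 (le_refl |x|); have := abs_nonneg x₀
    constructor <;> linarith
  obtain ⟨C, hC⟩ := isCompact_Icc.exists_bound_of_continuousOn
    (s := Set.Icc (-R) R) (f := A) hA.continuousOn
  have hlip : ∀ t ∈ Set.Ioo (-R) R,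
      LipschitzOnWith (Real.toNNReal C) (fun v => A t v) Set.univ := by
    intro t ht
    refine ((A t).lipschitz.weaken ?_).lipschitzOnWith
    rw [← NNReal.coe_le_coe, coe_nnnorm]
    exact (hC t (Set.Ioo_subset_Icc_self ht)).trans (Real.le_coe_toNNReal C)
  exact ODE_solution_unique_of_mem_Ioo (f := u) (g := fun _ => 0) hlip hx₀
    (fun t _ => ⟨hu t, trivial⟩) (fun t _ => ⟨by simpa using hasDerivAt_const t (0 : E), trivial⟩)
    h0 hx

/-- The operator on `ℂ²` of a matrix. -/
def matCLM : Matrix (Fin 2) (Fin 2) ℂ →ₗ[ℂ] ((Fin 2 → ℂ) →L[ℂ] (Fin 2 → ℂ)) :=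
  (LinearMap.toContinuousLinearMap (𝕜 := ℂ) (E := Fin 2 → ℂ) (F' := Fin 2 → ℂ)).toLinearMap ∘ₗ
    (Matrix.toLin' (R := ℂ) (m := Fin 2) (n := Fin 2)).toLinearMap

@[simp] theorem matCLM_apply (A : Matrix (Fin 2) (Fin 2) ℂ) (v : Fin 2 → ℂ) :
    matCLM A v = A.mulVec v := by
  simp [matCLM]

theorem continuous_matCLM : Continuous matCLM := matCLM.continuous_of_finiteDimensional

/-! ### The scattering problem on a left half-line -/

/-- The spectral parameter `λ` as a function of the uniformizing variable `ζ`, with `c` the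
product of the two boundary values. -/
def coreLam (c ζ : ℂ) : ℂ := (ζ - c / ζ) / 2

/-- The set of `ζ` for which the first Jost column at `-∞` exists. -/
def coreDom (c : ℂ) : Set ℂ := {ζ | ζ ≠ 0 ∧ (coreLam c ζ).im ≤ 0}

/-- The constant part `X_- - iλ` of the coefficient matrix. -/
def coreN (a₀ b₀ ζ : ℂ) : Matrix (Fin 2) (Fin 2) ℂ := !![I * (a₀ * b₀) / ζ, a₀; b₀, -(I * ζ)]

/-- The decaying part of the coefficient matrix. -/
def coreD (a b : ℝ → ℂ) (a₀ b₀ : ℂ) (y : ℝ) : Matrix (Fin 2) (Fin 2) ℂ :=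
  !![0, a y - a₀; b y - b₀, 0]

/-- The boundary value at `-∞`. -/
def coreE (b₀ ζ : ℂ) : Fin 2 → ℂ := ![1, -(I * b₀ / ζ)]

/-- `m` solves `m' = (X - iλ) m` and tends to the boundary value at `-∞`: this is the first Jost
column at `-∞` with the plane wave divided out. -/
structure IsCoreSol (a b : ℝ → ℂ) (a₀ b₀ ζ : ℂ) (m : ℝ → Fin 2 → ℂ) : Prop where
  deriv0 : ∀ x, HasDerivAt (fun y => m y 0) (I * (a₀ * b₀) / ζ * m x 0 + a x * m x 1) x
  deriv1 : ∀ x, HasDerivAt (fun y => m y 1) (b x * m x 0 - I * ζ * m x 1) x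
  lim : Tendsto m atBot (𝓝 (coreE b₀ ζ))

/-- Potentials of class `C¹` that approach their boundary values integrably, with first moment, at
`-∞`. -/
structure IsCorePot (a b : ℝ → ℂ) (a₀ b₀ : ℂ) : Prop where
  diff_a : ContDiff ℝ 1 a
  diff_b : ContDiff ℝ 1 b
  int_a : ∀ x, IntegrableOn (fun y => (1 + |y|) * ‖a y - a₀‖) (Set.Iic x)
  int_b : ∀ x, IntegrableOn (fun y => (1 + |y|) * ‖b y - b₀‖) (Set.Iic x)

theorem matCLM_coreN (a₀ b₀ ζ : ℂ) : matCLM (coreN a₀ b₀ ζ) =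
    (I * (a₀ * b₀) / ζ) • matCLM !![1, 0; 0, 0] + matCLM !![0, a₀; b₀, 0]
      - (I * ζ) • matCLM !![0, 0; 0, 1] := by
  refine ContinuousLinearMap.ext fun v => funext fun i => ?_
  fin_cases i <;> simp [coreN, Matrix.vecHead, Matrix.vecTail, sub_eq_add_neg]

theorem matCLM_coreD (a b : ℝ → ℂ) (a₀ b₀ : ℂ) (y : ℝ) : matCLM (coreD a b a₀ b₀ y) =
    (a y - a₀) • matCLM !![0, 1; 0, 0] + (b y - b₀) • matCLM !![0, 0; 1, 0] := by
  refine ContinuousLinearMap.ext fun v => funext fun i => ?_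
  fin_cases i <;> simp [coreD, Matrix.vecHead, Matrix.vecTail]

theorem coreN_sq {a₀ b₀ ζ : ℂ} (hζ : ζ ≠ 0) (w : Fin 2 → ℂ) :
    matCLM (coreN a₀ b₀ ζ) (matCLM (coreN a₀ b₀ ζ) w)
      = -(2 * I * coreLam (a₀ * b₀) ζ) • matCLM (coreN a₀ b₀ ζ) w := by
  have hI := I_sq
  ext i
  fin_cases i
  · simp [coreN, coreLam, Matrix.vecHead, Matrix.vecTail]
    field_simp
    linear_combination a₀ * b₀ * ζ ^ 2 * w 0 * hI
  · simp [coreN, coreLam, Matrix.vecHead, Matrix.vecTail]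
    field_simp
    linear_combination a₀ * b₀ * ζ * w 1 * hI

theorem coreN_coreE {a₀ b₀ ζ : ℂ} (hζ : ζ ≠ 0) : matCLM (coreN a₀ b₀ ζ) (coreE b₀ ζ) = 0 := by
  ext i
  fin_cases i
  · simp [coreN, coreE]
    ring
  · simp [coreN, coreE]
    field_simp
    rw [I_sq]
    ring

section

variable {a b : ℝ → ℂ} {a₀ b₀ : ℂ}

theorem IsCorePot.continuous_coreD (h : IsCorePot a b a₀ b₀) :
    Continuous fun y => matCLM (coreD a b a₀ b₀ y) := by
  simp only [matCLM_coreD]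
  exact ((h.diff_a.continuous.sub continuous_const).smul continuous_const).add
    ((h.diff_b.continuous.sub continuous_const).smul continuous_const)

theorem IsCorePot.integrable_coreD (h : IsCorePot a b a₀ b₀) (x : ℝ) :
    IntegrableOn (fun y => (1 + |y|) * ‖matCLM (coreD a b a₀ b₀ y)‖) (Set.Iic x) := by
  set K₁ := ‖matCLM !![0, 1; 0, 0]‖
  set K₂ := ‖matCLM !![0, 0; 1, 0]‖
  refine Integrable.mono' (((h.int_a x).const_mul K₁).add ((h.int_b x).const_mul K₂)) ?_ ?_
  · exact (Continuous.mul (by fun_prop) h.continuous_coreD.norm).aestronglyMeasurable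
  · refine Eventually.of_forall fun y => ?_
    have h1 : 0 ≤ 1 + |y| := by positivity
    rw [norm_mul, norm_norm, Real.norm_of_nonneg h1, matCLM_coreD]
    have h2 := norm_add_le ((a y - a₀) • matCLM !![0, 1; 0, 0]) ((b y - b₀) • matCLM !![0, 0; 1, 0])
    rw [norm_smul, norm_smul] at h2
    simp only [Pi.add_apply]
    nlinarith

/-- The Volterra bound that is valid locally uniformly on `coreDom`, branch points included. -/
theorem IsCorePot.volterraBound (h : IsCorePot a b a₀ b₀) {ζ : ℂ} (hζ : ζ ∈ coreDom (a₀ * b₀))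
    {C : ℝ} (hC : 1 + ‖matCLM (coreN a₀ b₀ ζ)‖ ≤ C) :
    VolterraBound (coreLam (a₀ * b₀) ζ) (matCLM (coreN a₀ b₀ ζ))
      (fun y => matCLM (coreD a b a₀ b₀ y))
      (fun y => C * ((1 + |y|) * ‖matCLM (coreD a b a₀ b₀ y)‖)) (fun x => 1 + max x 0) where
  im_le := hζ.2
  cont_D := h.continuous_coreD
  cont_ρ := continuous_const.mul (Continuous.mul (by fun_prop) h.continuous_coreD.norm)
  int_ρ x := (h.integrable_coreD x).const_mul C
  one_le x := by simp
  mono x y hxy := by dsimp only; gcongr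
  bound x y hxy := by
    have h1 := norm_expKernel_le hζ.2 (sub_nonneg.2 hxy)
    have h2 : (1 + ‖expKernel (coreLam (a₀ * b₀) ζ) (x - y)‖ * ‖matCLM (coreN a₀ b₀ ζ)‖)
        ≤ C * (1 + (x - y)) := by
      have h3 := norm_nonneg (matCLM (coreN a₀ b₀ ζ))
      nlinarith [norm_nonneg (expKernel (coreLam (a₀ * b₀) ζ) (x - y))]
    have h4 : (1 + (x - y)) * (1 + max y 0) ≤ (1 + max x 0) * (1 + |y|) := by
      rcases le_total 0 y with hy | hy
      · rw [max_eq_left hy, max_eq_left (hy.trans hxy), abs_of_nonneg hy]; nlinarith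
      · rw [max_eq_right hy, abs_of_nonpos hy]
        rcases le_total 0 x with hx | hx
        · rw [max_eq_left hx]; nlinarith
        · rw [max_eq_right hx]; nlinarith
    have hC0 : 0 ≤ C := by linarith [norm_nonneg (matCLM (coreN a₀ b₀ ζ))]
    calc _ ≤ (C * (1 + (x - y))) * ‖matCLM (coreD a b a₀ b₀ y)‖ * (1 + max y 0) := by gcongr
      _ = C * ‖matCLM (coreD a b a₀ b₀ y)‖ * ((1 + (x - y)) * (1 + max y 0)) := by ring
      _ ≤ C * ‖matCLM (coreD a b a₀ b₀ y)‖ * ((1 + max x 0) * (1 + |y|)) := by gcongr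
      _ = _ := by ring

/-- The solution constructed by Picard iteration. -/
def coreSol (a b : ℝ → ℂ) (a₀ b₀ ζ : ℂ) : ℝ → Fin 2 → ℂ :=
  volterraSol (coreLam (a₀ * b₀) ζ) (matCLM (coreN a₀ b₀ ζ)) (fun y => matCLM (coreD a b a₀ b₀ y))
    (coreE b₀ ζ)

theorem IsCorePot.isCoreSol (h : IsCorePot a b a₀ b₀) {ζ : ℂ} (hζ : ζ ∈ coreDom (a₀ * b₀)) :
    IsCoreSol a b a₀ b₀ ζ (coreSol a b a₀ b₀ ζ) := by
  have hb := h.volterraBound hζ le_rfl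
  have hd := fun x => hasDerivAt_pi.1
    (hb.hasDerivAt_volterraSol (fun w => coreN_sq hζ.1 w) (coreN_coreE hζ.1) x)
  refine ⟨fun x => ?_, fun x => ?_, hb.tendsto_volterraSol (fun w => coreN_sq hζ.1 w) _⟩
  · refine (hd x 0).congr_deriv ?_
    simp [coreN, coreD, Matrix.vecHead, Matrix.vecTail, coreSol]
    ring
  · refine (hd x 1).congr_deriv ?_
    simp [coreN, coreD, Matrix.vecHead, Matrix.vecTail, coreSol]
    ring

theorem IsCoreSol.hasDerivAt {ζ : ℂ} {m : ℝ → Fin 2 → ℂ} (hm : IsCoreSol a b a₀ b₀ ζ m) (x : ℝ) :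
    HasDerivAt m ((!![I * (a₀ * b₀) / ζ, a x; b x, -(I * ζ)] : Matrix _ _ ℂ).mulVec (m x)) x := by
  refine hasDerivAt_pi.2 fun i => ?_
  fin_cases i
  · refine (hm.deriv0 x).congr_deriv ?_
    simp [Matrix.vecHead, Matrix.vecTail]
  · refine (hm.deriv1 x).congr_deriv ?_
    simp [Matrix.vecHead, Matrix.vecTail, sub_eq_add_neg]

/-- The Wronskian of two solutions vanishes because its limit at `-∞` does; so the solutions are
proportional, and equal boundary values make them equal. -/
theorem IsCoreSol.unique (h : IsCorePot a b a₀ b₀) {ζ : ℂ} (hζ : ζ ∈ coreDom (a₀ * b₀))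
    {m m' : ℝ → Fin 2 → ℂ} (hm : IsCoreSol a b a₀ b₀ ζ m) (hm' : IsCoreSol a b a₀ b₀ ζ m') :
    m = m' := by
  have hζ0 := hζ.1
  set μ := coreLam (a₀ * b₀) ζ with hμ
  have l0 : Tendsto (fun x => m x 0) atBot (𝓝 1) := (tendsto_pi_nhds.1 hm.lim) 0
  have l1 : Tendsto (fun x => m x 1) atBot (𝓝 (-(I * b₀ / ζ))) := (tendsto_pi_nhds.1 hm.lim) 1
  have l0' : Tendsto (fun x => m' x 0) atBot (𝓝 1) := (tendsto_pi_nhds.1 hm'.lim) 0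
  have l1' : Tendsto (fun x => m' x 1) atBot (𝓝 (-(I * b₀ / ζ))) := (tendsto_pi_nhds.1 hm'.lim) 1
  set W : ℝ → ℂ := fun x => m x 0 * m' x 1 - m x 1 * m' x 0 with hW
  have hWd : ∀ x, HasDerivAt W (-(2 * I * μ) * W x) x := by
    intro x
    have := ((hm.deriv0 x).mul (hm'.deriv1 x)).sub ((hm.deriv1 x).mul (hm'.deriv0 x))
    refine this.congr_deriv ?_
    simp only [hW, hμ, coreLam]
    field_simp
    ring
  set g : ℝ → ℂ := fun x => cexp (2 * I * μ * x) * W x with hg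
  have hgd : ∀ x, HasDerivAt g 0 x := by
    intro x
    have h1 : HasDerivAt (fun x : ℝ => cexp (2 * I * μ * x))
        (cexp (2 * I * μ * x) * (2 * I * μ)) x := by
      have := ((hasDerivAt_id (x : ℂ)).const_mul (2 * I * μ)).cexp.comp_ofReal
      simpa using this
    refine (h1.mul (hWd x)).congr_deriv ?_
    ring
  have hgc : ∀ x, g x = g 0 := fun x =>
    is_const_of_deriv_eq_zero (fun x => (hgd x).differentiableAt) (fun x => (hgd x).deriv) x 0
  have hWlim : Tendsto W atBot (𝓝 0) := by
    have := (l0.mul l1').sub (l1.mul l0')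
    simpa using this
  have hglim : Tendsto g atBot (𝓝 0) := by
    have hWn : Tendsto (fun x => ‖W x‖) atBot (𝓝 0) := by simpa using hWlim.norm
    refine squeeze_zero_norm' ?_ hWn
    · filter_upwards [eventually_le_atBot (0 : ℝ)] with x hx
      rw [hg, norm_mul]
      have h1 := norm_cexp_le_one hζ.2 (s := -x) (by linarith)
      have h2 : -(2 * I * coreLam (a₀ * b₀) ζ * ((-x : ℝ) : ℂ)) = 2 * I * μ * x := by
        push_cast; ring
      rw [h2] at h1
      exact mul_le_of_le_one_left (norm_nonneg _) h1
  have hg0 : g 0 = 0 := tendsto_nhds_unique (tendsto_const_nhds.congr fun x => (hgc x).symm) hglim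
  have hW0 : ∀ x, W x = 0 := by
    intro x
    have := hgc x
    rw [hg0] at this
    exact (mul_eq_zero.1 this).resolve_left (exp_ne_zero _)
  obtain ⟨x₁, hx₁⟩ := (l0.eventually_ne one_ne_zero).exists
  have hA : Continuous fun x : ℝ => matCLM !![I * (a₀ * b₀) / ζ, a x; b x, -(I * ζ)] := by
    refine continuous_matCLM.comp ?_
    have := h.diff_a.continuous
    have := h.diff_b.continuous
    refine continuous_matrix fun i j => ?_
    fin_cases i <;> fin_cases j <;> simp <;> fun_prop
  have hprop : ∀ x, m' x₁ 0 • m x - m x₁ 0 • m' x = 0 := by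
    refine eq_zero_of_hasDerivAt_linear hA (x₀ := x₁) (fun x => ?_) ?_
    · refine (((hm.hasDerivAt x).const_smul (m' x₁ 0)).sub
        ((hm'.hasDerivAt x).const_smul (m x₁ 0))).congr_deriv ?_
      rw [map_sub, map_smul, map_smul, matCLM_apply, matCLM_apply]
    · have := hW0 x₁
      ext i
      fin_cases i
      · simp; ring
      · simp [hW] at this ⊢; linear_combination -this
  have hlim : m' x₁ 0 = m x₁ 0 := by
    have e1 := (l0.const_mul (m' x₁ 0)).sub (l0'.const_mul (m x₁ 0))
    have e2 : ∀ x, m' x₁ 0 * m x 0 - m x₁ 0 * m' x 0 = 0 := fun x => by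
      simpa using congrFun (hprop x) 0
    have := tendsto_nhds_unique (tendsto_const_nhds.congr fun x => (e2 x).symm) e1
    linear_combination -this
  funext x
  have := hprop x
  rw [hlim, ← smul_sub, smul_eq_zero] at this
  exact sub_eq_zero.1 (this.resolve_left hx₁)

theorem differentiableOn_coreLam (c : ℂ) {s : Set ℂ} (hs : ∀ ζ ∈ s, ζ ≠ 0) :
    DifferentiableOn ℂ (coreLam c) s := by
  intro ζ hζ
  have := hs ζ hζ
  unfold coreLam
  simp only [div_eq_mul_inv]
  fun_prop (disch := assumption)

theorem differentiableOn_matCLM_coreN (a₀ b₀ : ℂ) {s : Set ℂ} (hs : ∀ ζ ∈ s, ζ ≠ 0) :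
    DifferentiableOn ℂ (fun ζ => matCLM (coreN a₀ b₀ ζ)) s := by
  intro ζ hζ
  have := hs ζ hζ
  simp only [matCLM_coreN, div_eq_mul_inv]
  fun_prop (disch := assumption)

theorem differentiableOn_coreE (b₀ : ℂ) {s : Set ℂ} (hs : ∀ ζ ∈ s, ζ ≠ 0) :
    DifferentiableOn ℂ (coreE b₀) s := by
  intro ζ hζ
  have := hs ζ hζ
  refine differentiableWithinAt_pi.2 fun i => ?_
  fin_cases i <;> simp [coreE, div_eq_mul_inv] <;> fun_prop (disch := assumption)

theorem exists_local_bound (a₀ b₀ : ℂ) {ζ₀ : ℂ} (hζ₀ : ζ₀ ≠ 0) : ∃ C > 0, ∀ᶠ ζ in 𝓝 ζ₀,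
    1 + ‖matCLM (coreN a₀ b₀ ζ)‖ ≤ C ∧ ‖coreE b₀ ζ‖ ≤ C := by
  have h1 : ContinuousAt (fun ζ => matCLM (coreN a₀ b₀ ζ)) ζ₀ :=
    ((differentiableOn_matCLM_coreN a₀ b₀ (s := {0}ᶜ) fun _ h => h).differentiableAt
      (isOpen_compl_singleton.mem_nhds hζ₀)).continuousAt
  have h2 : ContinuousAt (coreE b₀) ζ₀ :=
    ((differentiableOn_coreE b₀ (s := {0}ᶜ) fun _ h => h).differentiableAt
      (isOpen_compl_singleton.mem_nhds hζ₀)).continuousAt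
  refine ⟨2 + ‖matCLM (coreN a₀ b₀ ζ₀)‖ + ‖coreE b₀ ζ₀‖, by positivity, ?_⟩
  have e1 := h1.norm.eventually (gt_mem_nhds (show ‖matCLM (coreN a₀ b₀ ζ₀)‖ <
    ‖matCLM (coreN a₀ b₀ ζ₀)‖ + 1 by linarith))
  have e2 := h2.norm.eventually (gt_mem_nhds (show ‖coreE b₀ ζ₀‖ < ‖coreE b₀ ζ₀‖ + 1 by linarith))
  filter_upwards [e1, e2] with ζ h3 h4
  have := norm_nonneg (matCLM (coreN a₀ b₀ ζ₀))
  have := norm_nonneg (coreE b₀ ζ₀)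
  constructor <;> linarith

theorem IsCorePot.continuousOn_coreSol (h : IsCorePot a b a₀ b₀) (x : ℝ) :
    ContinuousOn (fun ζ => coreSol a b a₀ b₀ ζ x) (coreDom (a₀ * b₀)) := by
  intro ζ₀ hζ₀
  obtain ⟨C, -, hC⟩ := exists_local_bound a₀ b₀ hζ₀.1
  set Z := coreDom (a₀ * b₀) ∩ {ζ | 1 + ‖matCLM (coreN a₀ b₀ ζ)‖ ≤ C ∧ ‖coreE b₀ ζ‖ ≤ C} with hZ
  have hne : ∀ ζ ∈ Z, ζ ≠ 0 := fun ζ hζ => hζ.1.1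
  have hcont := continuousOn_volterraSol (Z := Z) (fun ζ hζ => h.volterraBound hζ.1 hζ.2.1)
    (fun ζ hζ w => coreN_sq (hne ζ hζ) w) (fun ζ hζ => hζ.2.2)
    (differentiableOn_coreLam _ hne).continuousOn
    (differentiableOn_matCLM_coreN a₀ b₀ hne).continuousOn
    (differentiableOn_coreE b₀ hne).continuousOn x
  have hmem : ζ₀ ∈ Z := ⟨hζ₀, hC.self_of_nhds⟩
  exact (hcont ζ₀ hmem).mono_of_mem_nhdsWithin (inter_mem_nhdsWithin _ hC)

theorem IsCorePot.differentiableAt_coreSol (h : IsCorePot a b a₀ b₀) (x : ℝ) {ζ₀ : ℂ}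
    (hζ₀ : ζ₀ ≠ 0) (him : (coreLam (a₀ * b₀) ζ₀).im < 0) :
    DifferentiableAt ℂ (fun ζ => coreSol a b a₀ b₀ ζ x) ζ₀ := by
  obtain ⟨C, -, hC⟩ := exists_local_bound a₀ b₀ hζ₀
  have hlc : ContinuousAt (coreLam (a₀ * b₀)) ζ₀ :=
    ((differentiableOn_coreLam _ (s := {0}ᶜ) fun _ h => h).differentiableAt
      (isOpen_compl_singleton.mem_nhds hζ₀)).continuousAt
  have hev : ∀ᶠ ζ in 𝓝 ζ₀, (ζ ≠ 0 ∧ (coreLam (a₀ * b₀) ζ).im < 0) ∧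
      (1 + ‖matCLM (coreN a₀ b₀ ζ)‖ ≤ C ∧ ‖coreE b₀ ζ‖ ≤ C) :=
    ((eventually_ne_nhds hζ₀).and
      ((Complex.continuous_im.continuousAt.comp hlc).eventually (gt_mem_nhds him))).and hC
  obtain ⟨r, hr, hball⟩ := Metric.eventually_nhds_iff_ball.1 hev
  have hne : ∀ ζ ∈ Metric.ball ζ₀ r, ζ ≠ 0 := fun ζ hζ => (hball ζ hζ).1.1
  exact (differentiableOn_volterraSol (Z := Metric.ball ζ₀ r) Metric.isOpen_ball
    (fun ζ hζ => h.volterraBound ⟨hne ζ hζ, (hball ζ hζ).1.2.le⟩ (hball ζ hζ).2.1)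
    (fun ζ hζ w => coreN_sq (hne ζ hζ) w) (fun ζ hζ => (hball ζ hζ).2.2)
    (differentiableOn_coreLam _ hne) (differentiableOn_matCLM_coreN a₀ b₀ hne)
    (differentiableOn_coreE b₀ hne) x).differentiableAt (Metric.ball_mem_nhds _ hr)

end

/-! ### Large values of the spectral variable -/

section

variable {a b : ℝ → ℂ} {a₀ b₀ : ℂ}

theorem norm_div_four_le_norm_coreLam {c ζ : ℂ} (h1 : 1 ≤ ‖ζ‖) (h2 : 2 * ‖c‖ ≤ ‖ζ‖) :
    ‖ζ‖ / 4 ≤ ‖coreLam c ζ‖ := by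
  have h3 : ‖c / ζ‖ ≤ ‖ζ‖ / 2 := by
    rw [norm_div, div_le_iff₀ (by linarith)]
    nlinarith
  have h4 := norm_sub_norm_le ζ (c / ζ)
  rw [coreLam, norm_div, Complex.norm_ofNat]
  linarith

/-- For large `ζ` the kernel is bounded, because `λ` is comparable to `ζ`; so the solution is
bounded, and close to its boundary value near `-∞`, uniformly in `ζ`. -/
theorem IsCorePot.exists_uniform_bound (h : IsCorePot a b a₀ b₀) :
    ∃ (B δ : ℝ → ℝ) (R : ℝ), Monotone B ∧ (∀ x, 0 ≤ B x) ∧ Tendsto δ atBot (𝓝 0) ∧ 1 ≤ R ∧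
      2 * ‖a₀ * b₀‖ ≤ R ∧
      ∀ ζ ∈ coreDom (a₀ * b₀), R ≤ ‖ζ‖ → ∀ x, ‖coreSol a b a₀ b₀ ζ x‖ ≤ B x ∧
        ‖coreSol a b a₀ b₀ ζ x - coreE b₀ ζ‖ ≤ δ x := by
  set K := ‖a₀ * b₀‖ * ‖matCLM !![1, 0; 0, 0]‖ + ‖matCLM !![0, a₀; b₀, 0]‖ +
    ‖matCLM !![0, 0; 0, 1]‖ with hK
  have hK0 : 0 ≤ K := by positivity
  set ρ : ℝ → ℝ := fun y => (1 + 4 * K) * ‖matCLM (coreD a b a₀ b₀ y)‖ with hρ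
  have hR1 : ∀ ζ : ℂ, 1 + 2 * ‖a₀ * b₀‖ ≤ ‖ζ‖ → 1 ≤ ‖ζ‖ ∧ 2 * ‖a₀ * b₀‖ ≤ ‖ζ‖ := fun ζ hζ =>
    ⟨by linarith [norm_nonneg (a₀ * b₀)], by linarith⟩
  have hint : ∀ x, IntegrableOn ρ (Set.Iic x) := by
    intro x
    refine Integrable.mono' ((h.integrable_coreD x).const_mul (1 + 4 * K)) ?_ ?_
    · exact (continuous_const.mul h.continuous_coreD.norm).aestronglyMeasurable
    · refine Eventually.of_forall fun y => ?_
      rw [hρ, norm_mul, norm_norm, Real.norm_of_nonneg (by positivity)]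
      have h1 : 1 ≤ 1 + |y| := by linarith [abs_nonneg y]
      have h2 := norm_nonneg (matCLM (coreD a b a₀ b₀ y))
      gcongr
      nlinarith
  have hV : ∀ ζ ∈ coreDom (a₀ * b₀), 1 + 2 * ‖a₀ * b₀‖ ≤ ‖ζ‖ →
      VolterraBound (coreLam (a₀ * b₀) ζ) (matCLM (coreN a₀ b₀ ζ))
      (fun y => matCLM (coreD a b a₀ b₀ y)) ρ (fun _ => 1) := by
    intro ζ hζ hζR
    obtain ⟨h1, h2⟩ := hR1 ζ hζR
    refine ⟨hζ.2, h.continuous_coreD, continuous_const.mul h.continuous_coreD.norm, hint,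
      fun _ => le_rfl, monotone_const, fun x y hxy => ?_⟩
    have hN : ‖matCLM (coreN a₀ b₀ ζ)‖ ≤ K * ‖ζ‖ := by
      rw [matCLM_coreN]
      refine (norm_sub_le _ _).trans ?_
      refine (add_le_add_left (norm_add_le _ _) _).trans ?_
      rw [norm_smul, norm_smul, norm_div, norm_mul I (a₀ * b₀), norm_mul I ζ, Complex.norm_I,
        one_mul, one_mul]
      have h3 : ‖a₀ * b₀‖ / ‖ζ‖ ≤ ‖a₀ * b₀‖ * ‖ζ‖ := by
        rw [div_le_iff₀ (by linarith)]
        have := norm_nonneg (a₀ * b₀)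
        nlinarith [mul_nonneg this (by nlinarith : 0 ≤ ‖ζ‖ * ‖ζ‖ - 1)]
      have h4 := norm_nonneg (matCLM !![1, 0; 0, 0])
      have h5 := norm_nonneg (matCLM !![0, a₀; b₀, 0])
      have h6 : ‖a₀ * b₀‖ / ‖ζ‖ * ‖matCLM !![1, 0; 0, 0]‖ ≤
        ‖a₀ * b₀‖ * ‖ζ‖ * ‖matCLM !![1, 0; 0, 0]‖ := by gcongr
      rw [hK]
      nlinarith
    have h5 := norm_div_four_le_norm_coreLam h1 h2
    have h6 := norm_expKernel_mul_norm_le hζ.2 (sub_nonneg.2 hxy)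
    have h7 : ‖expKernel (coreLam (a₀ * b₀) ζ) (x - y)‖ * ‖matCLM (coreN a₀ b₀ ζ)‖ ≤ 4 * K := by
      have h8 := norm_nonneg (expKernel (coreLam (a₀ * b₀) ζ) (x - y))
      calc _ ≤ ‖expKernel (coreLam (a₀ * b₀) ζ) (x - y)‖ * (K * ‖ζ‖) := by gcongr
        _ ≤ ‖expKernel (coreLam (a₀ * b₀) ζ) (x - y)‖ * (K * (4 * ‖coreLam (a₀ * b₀) ζ‖)) := by
            gcongr; linarith
        _ = 4 * K * (‖expKernel (coreLam (a₀ * b₀) ζ) (x - y)‖ * ‖coreLam (a₀ * b₀) ζ‖) := by ring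
        _ ≤ 4 * K * 1 := by gcongr
        _ = _ := mul_one _
    simp only [mul_one, one_mul, hρ]
    gcongr
  have hE : ∀ ζ : ℂ, 1 ≤ ‖ζ‖ → ‖coreE b₀ ζ‖ ≤ 1 + ‖b₀‖ := by
    intro ζ hζ
    refine (pi_norm_le_iff_of_nonneg (by positivity)).2 fun i => ?_
    fin_cases i
    · simp [coreE]
    · simp only [coreE, Fin.mk_one, Matrix.cons_val_one, Matrix.cons_val_fin_one, norm_neg,
        norm_div, norm_mul, Complex.norm_I, one_mul]
      have : ‖b₀‖ / ‖ζ‖ ≤ ‖b₀‖ := div_le_self (norm_nonneg _) hζ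
      linarith
  by_cases hne : ∃ ζ ∈ coreDom (a₀ * b₀), 1 + 2 * ‖a₀ * b₀‖ ≤ ‖ζ‖
  swap
  · exact ⟨fun _ => 0, fun _ => 0, 1 + 2 * ‖a₀ * b₀‖, monotone_const, fun _ => le_rfl,
      tendsto_const_nhds, by linarith [norm_nonneg (a₀ * b₀)], by linarith,
      fun ζ hζ h2 => absurd ⟨ζ, hζ, h2⟩ hne⟩
  obtain ⟨ζ₀, hζ₀, hζ₀R⟩ := hne
  have hV0 := hV ζ₀ hζ₀ hζ₀R
  refine ⟨fun x => 2 * (1 + ‖b₀‖) * Real.exp (2 * cumul ρ x),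
    fun x => 2 * (1 + ‖b₀‖) * ((Real.exp (2 * cumul ρ x) - 1) / 2), 1 + 2 * ‖a₀ * b₀‖, ?_, ?_, ?_,
    by linarith [norm_nonneg (a₀ * b₀)], by linarith, fun ζ hζ hζR x => ⟨?_, ?_⟩⟩
  · intro x y hxy
    have := hV0.monotone_cumul hxy
    exact mul_le_mul_of_nonneg_left (Real.exp_le_exp.2 (by linarith)) (by positivity)
  · intro x; positivity
  · have h2 := ((Real.continuous_exp.tendsto _).comp (hV0.tendsto_cumul.const_mul 2))
    have h3 := ((h2.sub_const 1).div_const 2).const_mul (2 * (1 + ‖b₀‖))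
    simpa using h3
  · refine ((hV ζ hζ hζR).norm_volterraSol_le (fun w => coreN_sq hζ.1 w) _ x).trans ?_
    have := hE ζ (hR1 ζ hζR).1
    exact mul_le_mul_of_nonneg_right (by linarith) (Real.exp_pos _).le
  · refine ((hV ζ hζ hζR).norm_volterraSol_sub_le (fun w => coreN_sq hζ.1 w) _ x).trans ?_
    have := hE ζ (hR1 ζ hζR).1
    have h4 : 0 ≤ (Real.exp (2 * cumul ρ x) - 1) / 2 := by
      have := Real.one_le_exp (x := 2 * cumul ρ x) (by linarith [hV0.cumul_nonneg x])
      linarith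
    exact mul_le_mul_of_nonneg_right (by linarith) h4

/-- A bound for the second component, in the eigenbasis of the constant part, at the right end of
an interval: one integration by parts against the oscillating exponential gains a factor `1/λ`. -/
theorem IsCoreSol.norm_snd_le (h : IsCorePot a b a₀ b₀) {ζ : ℂ} (hζ : ζ ∈ coreDom (a₀ * b₀))
    (hζ1 : 1 ≤ ‖ζ‖) (hζ2 : 2 * ‖a₀ * b₀‖ ≤ ‖ζ‖) {m : ℝ → Fin 2 → ℂ}
    (hm : IsCoreSol a b a₀ b₀ ζ m) {X x A B : ℝ} (hX : X ≤ x)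
    (ha₀ : ‖a₀‖ ≤ A) (hb₀ : ‖b₀‖ ≤ A) (hc : ‖a₀ * b₀‖ ≤ A)
    (ha : ∀ y ∈ Set.Icc X x, ‖a y‖ ≤ A) (hb : ∀ y ∈ Set.Icc X x, ‖b y‖ ≤ A)
    (ha' : ∀ y ∈ Set.Icc X x, ‖deriv a y‖ ≤ A) (hb' : ∀ y ∈ Set.Icc X x, ‖deriv b y‖ ≤ A)
    (hB : ∀ y ∈ Set.Icc X x, ‖m y‖ ≤ B) :
    ‖m x 1 + I * b₀ / ζ * m x 0‖ ≤ ‖m X 1 + I * b₀ / ζ * m X 0‖ +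
      (2 * (2 * A * B + A * (2 * A * B)) + (A * B + 2 * A * (A * B + A * B) +
        A * (A * B + 2 * A * (A * B + B))) * (x - X)) / ‖ζ‖ * 2 := by
  have hζ0 := hζ.1
  have hA0 : 0 ≤ A := (norm_nonneg _).trans ha₀
  set μ := coreLam (a₀ * b₀) ζ with hμ
  have hμn := norm_div_four_le_norm_coreLam hζ1 hζ2
  have hμ0 : μ ≠ 0 := by
    intro h0
    rw [← hμ, h0, norm_zero] at hμn
    linarith
  have hda : ∀ y, HasDerivAt a (deriv a y) y := fun y =>
    (h.diff_a.differentiable (by norm_num)).differentiableAt.hasDerivAt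
  have hdb : ∀ y, HasDerivAt b (deriv b y) y := fun y =>
    (h.diff_b.differentiable (by norm_num)).differentiableAt.hasDerivAt
  -- With `f = m₁ + (i b₀ / ζ) m₀`, the equation reads `f' = -2iμ f + κ`. Subtracting `κ / (2iμ)`
  -- from `f` replaces the source `κ` by `-κ' / (2iμ)`, which is of size `1/ζ`.
  set κ : ℝ → ℂ := fun y => (b y - b₀) * m y 0 + I * b₀ / ζ * ((a y - a₀) * m y 1) with hκ
  set κ' : ℝ → ℂ := fun y => (deriv b y * m y 0 + (b y - b₀) *
      (I * (a₀ * b₀) / ζ * m y 0 + a y * m y 1)) + I * b₀ / ζ * (deriv a y * m y 1 +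
      (a y - a₀) * (b y * m y 0 - I * ζ * m y 1)) with hκ'
  have hκd : ∀ y, HasDerivAt κ (κ' y) y := fun y =>
    (((hdb y).sub_const b₀).mul (hm.deriv0 y)).add
      ((((hda y).sub_const a₀).mul (hm.deriv1 y)).const_mul _)
  set w : ℝ → ℂ := fun y => (m y 1 + I * b₀ / ζ * m y 0) - κ y / (2 * I * μ) with hw
  set g : ℝ → ℂ := fun y => cexp (2 * I * μ * ((y : ℂ) - (x : ℂ))) * w y with hg
  have hgd : ∀ y : ℝ, HasDerivAt g
      (cexp (2 * I * μ * ((y : ℂ) - (x : ℂ))) * (-(κ' y / (2 * I * μ)))) y := by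
    intro y
    have h1 : HasDerivAt (fun y : ℝ => cexp (2 * I * μ * ((y : ℂ) - (x : ℂ))))
        (cexp (2 * I * μ * ((y : ℂ) - (x : ℂ))) * (2 * I * μ)) y := by
      have := (((hasDerivAt_id (y : ℂ)).sub_const (x : ℂ)).const_mul (2 * I * μ)).cexp.comp_ofReal
      simpa using this
    have h2 := ((hm.deriv1 y).add ((hm.deriv0 y).const_mul (I * b₀ / ζ))).sub
      ((hκd y).div_const (2 * I * μ))
    refine (h1.mul h2).congr_deriv ?_
    have h3 : (I : ℂ) ≠ 0 := I_ne_zero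
    have h4 : 2 * I * μ * ((m y 1 + I * b₀ / ζ * m y 0) - κ y / (2 * I * μ)) =
        2 * I * μ * (m y 1 + I * b₀ / ζ * m y 0) - κ y := by
      rw [mul_sub, mul_div_cancel₀ _ (by simp [hμ0])]
    have h5 : 2 * I * μ * (m y 1 + I * b₀ / ζ * m y 0) - κ y +
        (b y * m y 0 - I * ζ * m y 1 + I * b₀ / ζ *
          (I * (a₀ * b₀) / ζ * m y 0 + a y * m y 1)) = 0 := by
      simp only [hκ, hμ, coreLam]
      field_simp
      linear_combination b₀ * ζ ^ 2 * m y 0 * I_sq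
    rw [mul_assoc, ← mul_add]
    congr 1
    rw [show (((fun y => m y 1) + fun y => I * b₀ / ζ * m y 0) - fun x => κ x / (2 * I * μ)) y =
      (m y 1 + I * b₀ / ζ * m y 0) - κ y / (2 * I * μ) from rfl]
    linear_combination h4 + h5
  have hcomp : ∀ y ∈ Set.Icc X x, ‖m y 0‖ ≤ B ∧ ‖m y 1‖ ≤ B := fun y hy =>
    ⟨(norm_le_pi_norm _ _).trans (hB y hy), (norm_le_pi_norm _ _).trans (hB y hy)⟩
  have hB0 : 0 ≤ B := (norm_nonneg _).trans (hB X ⟨le_rfl, hX⟩)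
  have hζi : ‖ζ‖⁻¹ ≤ 1 := inv_le_one_of_one_le₀ hζ1
  have hbz : ‖I * b₀ / ζ‖ ≤ A := by
    rw [norm_div, norm_mul, Complex.norm_I, one_mul]
    exact (div_le_self (norm_nonneg _) hζ1).trans hb₀
  have hΔa : ∀ y ∈ Set.Icc X x, ‖a y - a₀‖ ≤ 2 * A := fun y hy =>
    (norm_sub_le _ _).trans (by linarith [ha y hy])
  have hΔb : ∀ y ∈ Set.Icc X x, ‖b y - b₀‖ ≤ 2 * A := fun y hy =>
    (norm_sub_le _ _).trans (by linarith [hb y hy])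
  have hκb : ∀ y ∈ Set.Icc X x, ‖κ y‖ ≤ 2 * A * B + A * (2 * A * B) := by
    intro y hy
    obtain ⟨h0, h1⟩ := hcomp y hy
    refine (norm_add_le _ _).trans ?_
    simp only [norm_mul]
    have := hΔa y hy
    have := hΔb y hy
    gcongr
  have hκ'b : ∀ y ∈ Set.Icc X x, ‖κ' y‖ ≤ A * B + 2 * A * (A * B + A * B) +
        A * (A * B + 2 * A * (A * B + B)) := by
    intro y hy
    obtain ⟨h0, h1⟩ := hcomp y hy
    -- The factor `ζ` in the derivative of `m₁` is absorbed by the coefficient `1/ζ`.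
    have e1 : κ' y = (deriv b y * m y 0 + (b y - b₀) *
      (I * (a₀ * b₀) / ζ * m y 0 + a y * m y 1)) + (I * b₀ / ζ * (deriv a y * m y 1) +
      I * b₀ * ((a y - a₀) * (b y / ζ * m y 0 - I * m y 1))) := by
      simp only [hκ']
      field_simp
    have h2 : ‖I * (a₀ * b₀) / ζ‖ ≤ A := by
      rw [norm_div, norm_mul, Complex.norm_I, one_mul]
      exact (div_le_self (norm_nonneg _) hζ1).trans hc
    have h3 : ‖b y / ζ‖ ≤ A := by
      rw [norm_div]
      exact (div_le_self (norm_nonneg _) hζ1).trans (hb y hy)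
    have f1 : ‖I * (a₀ * b₀) / ζ * m y 0 + a y * m y 1‖ ≤ A * B + A * B := by
      refine (norm_add_le _ _).trans ?_
      rw [norm_mul, norm_mul]
      have := ha y hy
      gcongr
    have f2 : ‖b y / ζ * m y 0 - I * m y 1‖ ≤ A * B + B := by
      refine (norm_sub_le _ _).trans ?_
      rw [norm_mul, norm_mul, Complex.norm_I, one_mul]
      gcongr
    have f3 : ‖I * b₀‖ ≤ A := by rwa [norm_mul, Complex.norm_I, one_mul]
    have f4 := ha' y hy
    have f5 := hb' y hy
    have f6 := hΔa y hy
    have f7 := hΔb y hy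
    rw [e1]
    refine (norm_add_le _ _).trans (add_le_add ((norm_add_le _ _).trans ?_)
      ((norm_add_le _ _).trans ?_))
    · rw [norm_mul, norm_mul]
      gcongr
    · rw [norm_mul, norm_mul, norm_mul (I * b₀), norm_mul (a y - a₀), mul_add A]
      gcongr
  have hmv := (convex_Icc X x).norm_image_sub_le_of_norm_hasDerivWithin_le
    (C := (A * B + 2 * A * (A * B + A * B) + A * (A * B + 2 * A * (A * B + B))) * ‖2 * I * μ‖⁻¹)
    (fun y _ => (hgd y).hasDerivWithinAt) (fun y hy => by
      rw [norm_mul, norm_neg, norm_div, div_eq_mul_inv]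
      have h1 := norm_cexp_le_one hζ.2 (s := x - y) (by linarith [hy.2])
      have h2 : -(2 * I * coreLam (a₀ * b₀) ζ * ((x - y : ℝ) : ℂ)) = 2 * I * μ * (y - x) := by
        push_cast; ring
      rw [h2] at h1
      refine (mul_le_of_le_one_left (by positivity) h1).trans ?_
      have := hκ'b y hy
      gcongr) (Set.left_mem_Icc.2 hX) (Set.right_mem_Icc.2 hX)
  have hgx : g x = w x := by simp [hg]
  have hgX : ‖g X‖ ≤ ‖w X‖ := by
    have h1 := norm_cexp_le_one hζ.2 (s := x - X) (by linarith)
    have h2 : -(2 * I * coreLam (a₀ * b₀) ζ * ((x - X : ℝ) : ℂ)) = 2 * I * μ * (X - x) := by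
      push_cast; ring
    rw [h2] at h1
    rw [hg, norm_mul]
    exact mul_le_of_le_one_left (norm_nonneg _) h1
  have hinv : ‖2 * I * μ‖⁻¹ ≤ 2 / ‖ζ‖ := by
    rw [norm_mul, norm_mul, Complex.norm_I, Complex.norm_ofNat, mul_one,
      show 2 / ‖ζ‖ = (‖ζ‖ / 2)⁻¹ by rw [inv_div]]
    exact inv_anti₀ (by linarith) (by linarith)
  have hk : ∀ y ∈ Set.Icc X x, ‖κ y / (2 * I * μ)‖ ≤ (2 * A * B + A * (2 * A * B)) * (2 / ‖ζ‖) := by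
    intro y hy
    rw [norm_div, div_eq_mul_inv]
    have := hκb y hy
    gcongr
  have hxx := hk x (Set.right_mem_Icc.2 hX)
  have hXX := hk X (Set.left_mem_Icc.2 hX)
  have e1 : m x 1 + I * b₀ / ζ * m x 0 = w x + κ x / (2 * I * μ) := by simp [hw]
  have e2 : ‖w X‖ ≤ ‖m X 1 + I * b₀ / ζ * m X 0‖ + ‖κ X / (2 * I * μ)‖ := norm_sub_le _ _
  have e3 : ‖w x‖ ≤ ‖g x - g X‖ + ‖g X‖ := by
    rw [← hgx]
    simpa using norm_add_le (g x - g X) (g X)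
  rw [Real.norm_of_nonneg (sub_nonneg.2 hX)] at hmv
  have e4 : (A * B + 2 * A * (A * B + A * B) + A * (A * B + 2 * A * (A * B + B))) * ‖2 * I * μ‖⁻¹ *
      (x - X) ≤ (A * B + 2 * A * (A * B + A * B) + A * (A * B + 2 * A * (A * B + B))) * (2 / ‖ζ‖) *
      (x - X) := by
    have := sub_nonneg.2 hX
    gcongr
  rw [e1]
  refine (norm_add_le _ _).trans ?_
  have e5 : (2 * (2 * A * B + A * (2 * A * B)) + (A * B + 2 * A * (A * B + A * B) +
        A * (A * B + 2 * A * (A * B + B))) * (x - X)) / ‖ζ‖ * 2 =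
      (2 * A * B + A * (2 * A * B)) * (2 / ‖ζ‖) + (2 * A * B + A * (2 * A * B)) * (2 / ‖ζ‖) +
      (A * B + 2 * A * (A * B + A * B) + A * (A * B + 2 * A * (A * B + B))) * (2 / ‖ζ‖) *
      (x - X) := by ring
  rw [e5]
  linarith

variable {l : Filter ℂ}

/-- The second component tends to `0` as `ζ → ∞`: near `-∞` it is close to its boundary value, which
is `O(1/ζ)`, and on a compact interval the oscillation gains a factor `1/λ`. -/
theorem IsCorePot.tendsto_snd (h : IsCorePot a b a₀ b₀) (hl : Tendsto (fun ζ : ℂ => ‖ζ‖) l atTop)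
    (hdom : ∀ᶠ ζ in l, ζ ∈ coreDom (a₀ * b₀)) (x : ℝ) :
    Tendsto (fun ζ => coreSol a b a₀ b₀ ζ x 1) l (𝓝 0) := by
  obtain ⟨B, δ, R, hBmono, hB0, hδ, hR1, hR2, hbd⟩ := h.exists_uniform_bound
  rw [Metric.tendsto_nhds]
  intro ε hε
  have hδ' : Tendsto (fun x => (1 + ‖b₀‖) * δ x) atBot (𝓝 0) := by
    simpa using hδ.const_mul (1 + ‖b₀‖)
  obtain ⟨X, hXε, hXx⟩ := ((hδ'.eventually (gt_mem_nhds (show (0 : ℝ) < ε / 3 by positivity))).and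
    (eventually_le_atBot x)).exists
  have hca := h.diff_a.continuous
  have hcb := h.diff_b.continuous
  obtain ⟨A₁, hA₁⟩ := isCompact_Icc.exists_bound_of_continuousOn (s := Set.Icc X x) hca.continuousOn
  obtain ⟨A₂, hA₂⟩ := isCompact_Icc.exists_bound_of_continuousOn (s := Set.Icc X x) hcb.continuousOn
  obtain ⟨A₃, hA₃⟩ := isCompact_Icc.exists_bound_of_continuousOn (s := Set.Icc X x)
    (h.diff_a.continuous_deriv (by norm_num)).continuousOn
  obtain ⟨A₄, hA₄⟩ := isCompact_Icc.exists_bound_of_continuousOn (s := Set.Icc X x)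
    (h.diff_b.continuous_deriv (by norm_num)).continuousOn
  set A := |A₁| + |A₂| + |A₃| + |A₄| + ‖a₀‖ + ‖b₀‖ + ‖a₀ * b₀‖ with hA
  have p1 := abs_nonneg A₁
  have p2 := abs_nonneg A₂
  have p3 := abs_nonneg A₃
  have p4 := abs_nonneg A₄
  have q1 := le_abs_self A₁
  have q2 := le_abs_self A₂
  have q3 := le_abs_self A₃
  have q4 := le_abs_self A₄
  have r1 := norm_nonneg a₀
  have r2 := norm_nonneg b₀
  have r3 := norm_nonneg (a₀ * b₀)
  set K := (2 * (2 * A * B x + A * (2 * A * B x)) + (A * B x + 2 * A * (A * B x + A * B x) +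
        A * (A * B x + 2 * A * (A * B x + B x))) * (x - X)) with hK
  have hinv : Tendsto (fun ζ : ℂ => ‖ζ‖⁻¹) l (𝓝 0) := tendsto_inv_atTop_zero.comp hl
  have t1 : Tendsto (fun ζ : ℂ => K / ‖ζ‖ * 2) l (𝓝 0) := by
    simpa [div_eq_mul_inv] using (hinv.const_mul K).mul_const 2
  have t2 : Tendsto (fun ζ : ℂ => ‖b₀‖ / ‖ζ‖ * B x) l (𝓝 0) := by
    simpa [div_eq_mul_inv] using (hinv.const_mul ‖b₀‖).mul_const (B x)
  filter_upwards [hdom, hl.eventually_ge_atTop R,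
    t1.eventually (gt_mem_nhds (show (0 : ℝ) < ε / 3 by positivity)),
    t2.eventually (gt_mem_nhds (show (0 : ℝ) < ε / 3 by positivity))] with ζ hζ hζR h1 h2
  have hζ1 : 1 ≤ ‖ζ‖ := hR1.trans hζR
  have hsol := h.isCoreSol hζ
  have key := hsol.norm_snd_le h hζ hζ1 (hR2.trans hζR) hXx (A := A) (B := B x)
    (by linarith) (by linarith) (by linarith) (fun y hy => by linarith [hA₁ y hy])
    (fun y hy => by linarith [hA₂ y hy]) (fun y hy => by linarith [hA₃ y hy])
    (fun y hy => by linarith [hA₄ y hy])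
    (fun y hy => (hbd ζ hζ hζR y).1.trans (hBmono hy.2))
  have hnX : ‖coreSol a b a₀ b₀ ζ X 1 + I * b₀ / ζ * coreSol a b a₀ b₀ ζ X 0‖
      ≤ (1 + ‖b₀‖) * δ X := by
    have h3 := (hbd ζ hζ hζR X).2
    have h4 := (norm_le_pi_norm (coreSol a b a₀ b₀ ζ X - coreE b₀ ζ) 0).trans h3
    have h5 := (norm_le_pi_norm (coreSol a b a₀ b₀ ζ X - coreE b₀ ζ) 1).trans h3
    simp only [Pi.sub_apply, coreE, Matrix.cons_val_zero, Matrix.cons_val_one,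
      Matrix.cons_val_fin_one] at h4 h5
    have e1 : coreSol a b a₀ b₀ ζ X 1 + I * b₀ / ζ * coreSol a b a₀ b₀ ζ X 0 =
        (coreSol a b a₀ b₀ ζ X 1 - -(I * b₀ / ζ)) + I * b₀ / ζ * (coreSol a b a₀ b₀ ζ X 0 - 1) := by
      ring
    rw [e1]
    refine (norm_add_le _ _).trans ?_
    rw [norm_mul, norm_div, norm_mul, Complex.norm_I, one_mul]
    have h6 : ‖b₀‖ / ‖ζ‖ ≤ ‖b₀‖ := div_le_self r2 hζ1
    have h7 := norm_nonneg (coreSol a b a₀ b₀ ζ X 0 - 1)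
    nlinarith [mul_le_mul h6 h4 h7 r2]
  have h8 : ‖I * b₀ / ζ * coreSol a b a₀ b₀ ζ x 0‖ ≤ ‖b₀‖ / ‖ζ‖ * B x := by
    rw [norm_mul, norm_div, norm_mul, Complex.norm_I, one_mul]
    have := (norm_le_pi_norm (coreSol a b a₀ b₀ ζ x) 0).trans (hbd ζ hζ hζR x).1
    gcongr
  rw [dist_zero_right]
  have h9 := norm_sub_le (coreSol a b a₀ b₀ ζ x 1 + I * b₀ / ζ * coreSol a b a₀ b₀ ζ x 0)
    (I * b₀ / ζ * coreSol a b a₀ b₀ ζ x 0)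
  rw [add_sub_cancel_right] at h9
  linarith

/-- The first component tends to `1` as `ζ → ∞`: its derivative, in the eigenbasis of the
constant part, involves the second component, so dominated convergence applies to the integral
from `-∞`. -/
theorem IsCorePot.tendsto_fst [l.IsCountablyGenerated] (h : IsCorePot a b a₀ b₀)
    (hl : Tendsto (fun ζ : ℂ => ‖ζ‖) l atTop)
    (hdom : ∀ᶠ ζ in l, ζ ∈ coreDom (a₀ * b₀)) (x : ℝ) :
    Tendsto (fun ζ => coreSol a b a₀ b₀ ζ x 0) l (𝓝 1) := by
  obtain ⟨B, δ, R, hBmono, hB0, hδ, hR1, hR2, hbd⟩ := h.exists_uniform_bound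
  have hinv : Tendsto (fun ζ : ℂ => ζ⁻¹) l (𝓝 0) := by
    rw [tendsto_zero_iff_norm_tendsto_zero]
    simpa [Function.comp_def] using tendsto_inv_atTop_zero.comp hl
  -- The first component in the eigenbasis of the constant part
  set L : ℂ → ℝ → ℂ := fun ζ y => coreSol a b a₀ b₀ ζ y 0 - I * a₀ * ζ⁻¹ * coreSol a b a₀ b₀ ζ y 1
    with hL
  set L' : ℂ → ℝ → ℂ := fun ζ y => (a y - a₀) * coreSol a b a₀ b₀ ζ y 1 -
    I * a₀ * ζ⁻¹ * ((b y - b₀) * coreSol a b a₀ b₀ ζ y 0) with hL'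
  have hca := h.diff_a.continuous
  have hcb := h.diff_b.continuous
  have hLd : ∀ ζ ∈ coreDom (a₀ * b₀), ∀ y, HasDerivAt (L ζ) (L' ζ y) y := by
    intro ζ hζ y
    have hs := h.isCoreSol hζ
    have hζ0 := hζ.1
    refine ((hs.deriv0 y).sub ((hs.deriv1 y).const_mul _)).congr_deriv ?_
    simp only [hL']
    field_simp
    linear_combination a₀ * ζ * coreSol a b a₀ b₀ ζ y 1 * I_sq
  have hsc : ∀ ζ ∈ coreDom (a₀ * b₀), ∀ i, Continuous fun y => coreSol a b a₀ b₀ ζ y i := by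
    intro ζ hζ i
    have hs := h.isCoreSol hζ
    exact (continuous_apply i).comp
      (continuous_iff_continuousAt.2 fun y => (hs.hasDerivAt y).continuousAt)
  have hL'c : ∀ ζ ∈ coreDom (a₀ * b₀), Continuous (L' ζ) := by
    intro ζ hζ
    have := hsc ζ hζ
    simp only [hL']
    fun_prop
  set bound : ℝ → ℝ := fun y => B x * ((1 + |y|) * ‖a y - a₀‖) +
    ‖a₀‖ * B x * ((1 + |y|) * ‖b y - b₀‖) with hbound
  have hbi : IntegrableOn bound (Set.Iic x) :=
    ((h.int_a x).const_mul _).add ((h.int_b x).const_mul _)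
  have hle : ∀ ζ ∈ coreDom (a₀ * b₀), R ≤ ‖ζ‖ → ∀ y ≤ x, ‖L' ζ y‖ ≤ bound y := by
    intro ζ hζ hζR y hy
    have h1 := (hbd ζ hζ hζR y).1.trans (hBmono hy)
    have h2 := (norm_le_pi_norm (coreSol a b a₀ b₀ ζ y) 0).trans h1
    have h3 := (norm_le_pi_norm (coreSol a b a₀ b₀ ζ y) 1).trans h1
    have h4 : ‖I * a₀ * ζ⁻¹‖ ≤ ‖a₀‖ := by
      rw [norm_mul, norm_mul, Complex.norm_I, one_mul, norm_inv]
      exact mul_le_of_le_one_right (norm_nonneg _) (inv_le_one_of_one_le₀ (hR1.trans hζR))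
    have h5 : ∀ u : ℂ, ‖u‖ ≤ (1 + |y|) * ‖u‖ := fun u =>
      le_mul_of_one_le_left (norm_nonneg _) (by linarith [abs_nonneg y])
    refine (norm_sub_le _ _).trans ?_
    rw [norm_mul, norm_mul (I * a₀ * ζ⁻¹), norm_mul (b y - b₀)]
    have hBx := hB0 x
    calc _ ≤ ((1 + |y|) * ‖a y - a₀‖) * B x + ‖a₀‖ * (((1 + |y|) * ‖b y - b₀‖) * B x) := by
          have := h5 (a y - a₀)
          have := h5 (b y - b₀)
          gcongr
      _ = bound y := by simp only [hbound]; ring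
  have hdct : Tendsto (fun ζ => ∫ y in Set.Iic x, L' ζ y) l (𝓝 (∫ _ in Set.Iic x, (0 : ℂ))) := by
    refine tendsto_integral_filter_of_dominated_convergence bound ?_ ?_ hbi ?_
    · filter_upwards [hdom] with ζ hζ using (hL'c ζ hζ).aestronglyMeasurable
    · filter_upwards [hdom, hl.eventually_ge_atTop R] with ζ hζ hζR
      filter_upwards [ae_restrict_mem measurableSet_Iic] with y hy using hle ζ hζ hζR y hy
    · filter_upwards [ae_restrict_mem measurableSet_Iic] with y hy
      have t1 := (h.tendsto_snd hl hdom y).const_mul (a y - a₀)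
      have t2 : Tendsto (fun ζ => I * a₀ * ζ⁻¹ * ((b y - b₀) * coreSol a b a₀ b₀ ζ y 0)) l
          (𝓝 0) := by
        have hz : Tendsto (fun ζ : ℂ => ‖I * a₀ * ζ⁻¹‖ * (‖b y - b₀‖ * B x)) l (𝓝 0) := by
          simpa using ((hinv.const_mul (I * a₀)).norm).mul_const (‖b y - b₀‖ * B x)
        refine squeeze_zero_norm' ?_ hz
        filter_upwards [hdom, hl.eventually_ge_atTop R] with ζ hζ hζR
        have h1 := (hbd ζ hζ hζR y).1.trans (hBmono hy)
        have h2 := (norm_le_pi_norm (coreSol a b a₀ b₀ ζ y) 0).trans h1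
        rw [norm_mul, norm_mul (b y - b₀)]
        gcongr
      simpa using t1.sub t2
  rw [integral_zero] at hdct
  have hLx : ∀ᶠ ζ in l, L ζ x = (1 - a₀ * b₀ * ζ⁻¹ * ζ⁻¹) + ∫ y in Set.Iic x, L' ζ y := by
    filter_upwards [hdom, hl.eventually_ge_atTop R] with ζ hζ hζR
    have hi : IntegrableOn (L' ζ) (Set.Iic x) :=
      Integrable.mono' hbi (hL'c ζ hζ).aestronglyMeasurable (by
        filter_upwards [ae_restrict_mem measurableSet_Iic] with y hy using hle ζ hζ hζR y hy)
    have hlim : Tendsto (L ζ) atBot (𝓝 (1 - a₀ * b₀ * ζ⁻¹ * ζ⁻¹)) := by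
      have hs := (h.isCoreSol hζ).lim
      have t0 := (tendsto_pi_nhds.1 hs) 0
      have t1 := (tendsto_pi_nhds.1 hs) 1
      have := t0.sub (t1.const_mul (I * a₀ * ζ⁻¹))
      convert this using 2
      simp only [coreE, Matrix.cons_val_zero, Matrix.cons_val_one, Matrix.cons_val_fin_one]
      rw [div_eq_mul_inv]
      linear_combination -a₀ * b₀ * ζ⁻¹ * ζ⁻¹ * I_sq
    rw [integral_Iic_of_hasDerivAt_of_tendsto' (fun y _ => hLd ζ hζ y) hi hlim]
    ring
  have t1 : Tendsto (fun ζ => L ζ x) l (𝓝 1) := by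
    refine Tendsto.congr' (hLx.mono fun ζ h => h.symm) ?_
    have := (((hinv.const_mul (a₀ * b₀)).mul hinv).const_sub 1).add hdct
    simpa using this
  have t2 : Tendsto (fun ζ => I * a₀ * ζ⁻¹ * coreSol a b a₀ b₀ ζ x 1) l (𝓝 0) := by
    simpa using (hinv.const_mul (I * a₀)).mul (h.tendsto_snd hl hdom x)
  have := t1.add t2
  simpa [hL] using this

theorem neg_I_mul_mem_coreDom {c : ℂ} {τ : ℝ} (h1 : 1 ≤ τ) (h2 : ‖c‖ ≤ τ) :
    -(I * τ) ∈ coreDom c := by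
  have hτ : (τ : ℂ) ≠ 0 := by exact_mod_cast (by linarith : τ ≠ 0)
  refine ⟨by simp [hτ], ?_⟩
  have e1 : coreLam c (-(I * τ)) = -(I * (τ + c * ((τ⁻¹ : ℝ) : ℂ))) / 2 := by
    rw [coreLam]
    push_cast
    field_simp
    linear_combination c * I_sq
  have h3 : |(c * ((τ⁻¹ : ℝ) : ℂ)).re| ≤ 1 := by
    refine (Complex.abs_re_le_norm _).trans ?_
    rw [norm_mul, Complex.norm_real, Real.norm_of_nonneg (by positivity), ← div_eq_mul_inv]
    exact (div_le_one (by linarith)).2 h2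
  have e2 : (coreLam c (-(I * τ))).im = -(τ + (c * ((τ⁻¹ : ℝ) : ℂ)).re) / 2 := by
    rw [e1]
    simp [Complex.normSq]
  rw [e2]
  linarith [(abs_le.1 h3).1]

/-- Along the negative imaginary axis the second component is `b(x) / τ` to leading order. -/
theorem IsCorePot.tendsto_snd_ray (h : IsCorePot a b a₀ b₀) (x : ℝ) :
    Tendsto (fun τ : ℝ => (τ : ℂ) * coreSol a b a₀ b₀ (-(I * τ)) x 1) atTop (𝓝 (b x)) := by
  obtain ⟨B, δ, R, hBmono, hB0, hδ, hR1, hR2, hbd⟩ := h.exists_uniform_bound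
  have hnorm : ∀ τ : ℝ, 0 ≤ τ → ‖(-(I * τ) : ℂ)‖ = τ := fun τ hτ => by
    rw [norm_neg, norm_mul, Complex.norm_I, one_mul, Complex.norm_real, Real.norm_of_nonneg hτ]
  have hray : Tendsto (fun τ : ℝ => (-(I * τ) : ℂ)) atTop
      (Filter.map (fun τ : ℝ => (-(I * τ) : ℂ)) atTop) := tendsto_map
  have hl : Tendsto (fun ζ : ℂ => ‖ζ‖) (Filter.map (fun τ : ℝ => (-(I * τ) : ℂ)) atTop) atTop := by
    rw [tendsto_map'_iff]
    refine tendsto_id.congr' ?_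
    filter_upwards [eventually_ge_atTop (0 : ℝ)] with τ hτ using (hnorm τ hτ).symm
  have hdom : ∀ᶠ ζ in Filter.map (fun τ : ℝ => (-(I * τ) : ℂ)) atTop, ζ ∈ coreDom (a₀ * b₀) := by
    rw [eventually_map]
    filter_upwards [eventually_ge_atTop (1 : ℝ), eventually_ge_atTop ‖a₀ * b₀‖] with τ h1 h2
    exact neg_I_mul_mem_coreDom h1 h2
  have hfst : Tendsto (fun τ : ℝ => coreSol a b a₀ b₀ (-(I * τ)) x 0) atTop (𝓝 1) :=
    (h.tendsto_fst hl hdom x).comp hray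
  have hca := h.diff_a.continuous
  have hcb := h.diff_b.continuous
  obtain ⟨A₁, hA₁⟩ := isCompact_Icc.exists_bound_of_continuousOn (s := Set.Icc (x - 1) x)
    hca.continuousOn
  obtain ⟨A₂, hA₂⟩ := isCompact_Icc.exists_bound_of_continuousOn (s := Set.Icc (x - 1) x)
    hcb.continuousOn
  obtain ⟨A₃, hA₃⟩ := isCompact_Icc.exists_bound_of_continuousOn (s := Set.Icc (x - 1) x)
    (h.diff_b.continuous_deriv (by norm_num)).continuousOn
  have hx1 : x - 1 ∈ Set.Icc (x - 1) x := ⟨le_rfl, by linarith⟩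
  have p1 : 0 ≤ A₁ := (norm_nonneg _).trans (hA₁ _ hx1)
  have p2 : 0 ≤ A₂ := (norm_nonneg _).trans (hA₂ _ hx1)
  have p3 : 0 ≤ A₃ := (norm_nonneg _).trans (hA₃ _ hx1)
  have p4 := hB0 x
  set C := A₃ * B x + A₂ * (‖a₀ * b₀‖ * B x + A₁ * B x) with hC
  have hC0 : 0 ≤ C := by positivity
  suffices hw : Tendsto (fun τ : ℝ => (τ : ℂ) * coreSol a b a₀ b₀ (-(I * τ)) x 1 -
      b x * coreSol a b a₀ b₀ (-(I * τ)) x 0) atTop (𝓝 0) by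
    simpa using hw.add (hfst.const_mul (b x))
  rw [Metric.tendsto_nhds]
  intro ε hε
  -- The step on which the derivative contributes less than `ε / 2`
  set d := min 1 (ε / (2 * (C + 1))) with hd
  have hd0 : 0 < d := by positivity
  have hd1 : d ≤ 1 := min_le_left _ _
  have hCd : C * d < ε / 2 := by
    have h1 : d ≤ ε / (2 * (C + 1)) := min_le_right _ _
    have h2 : (C + 1) * d ≤ ε / 2 := by
      calc (C + 1) * d ≤ (C + 1) * (ε / (2 * (C + 1))) := by gcongr
        _ = ε / 2 := by field_simp
    nlinarith
  have hexp : Tendsto (fun τ : ℝ => Real.exp (-(τ * d)) * ((τ + A₂) * B x)) atTop (𝓝 0) := by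
    have h1 := (Real.tendsto_pow_mul_exp_neg_atTop_nhds_zero 1).comp
      (tendsto_id.atTop_mul_const hd0)
    have h2 := (Real.tendsto_pow_mul_exp_neg_atTop_nhds_zero 0).comp
      (tendsto_id.atTop_mul_const hd0)
    have h3 := (h1.const_mul (B x / d)).add (h2.const_mul (A₂ * B x))
    simp only [mul_zero, add_zero] at h3
    refine h3.congr fun τ => ?_
    simp only [Function.comp_apply, id, pow_one, pow_zero]
    field_simp
  filter_upwards [eventually_ge_atTop (1 : ℝ), eventually_ge_atTop ‖a₀ * b₀‖,
    eventually_ge_atTop R, hexp.eventually (gt_mem_nhds (show (0 : ℝ) < ε / 2 by positivity))]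
    with τ h1 h2 h3 h4
  have hτ0 : (τ : ℂ) ≠ 0 := by exact_mod_cast (by linarith : τ ≠ 0)
  have hζ : -(I * τ) ∈ coreDom (a₀ * b₀) := neg_I_mul_mem_coreDom h1 h2
  have hs := h.isCoreSol hζ
  have hnb : ∀ y ≤ x, ‖coreSol a b a₀ b₀ (-(I * τ)) y‖ ≤ B x := fun y hy =>
    (hbd _ hζ (by rwa [hnorm τ (by linarith)]) y).1.trans (hBmono hy)
  set m := coreSol a b a₀ b₀ (-(I * τ)) with hm
  have hn0 : ∀ y ≤ x, ‖m y 0‖ ≤ B x := fun y hy => (norm_le_pi_norm _ _).trans (hnb y hy)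
  have hn1 : ∀ y ≤ x, ‖m y 1‖ ≤ B x := fun y hy => (norm_le_pi_norm _ _).trans (hnb y hy)
  -- On the ray `ζ = -iτ` the second component relaxes towards `b m₀ / τ` at the rate `τ`.
  set v : ℝ → ℂ := fun y => deriv b y * m y 0 +
    b y * (-(a₀ * b₀ * ((τ⁻¹ : ℝ) : ℂ)) * m y 0 + a y * m y 1) with hv
  set g : ℝ → ℂ := fun y => cexp (τ * ((y : ℂ) - (x : ℂ))) * (τ * m y 1 - b y * m y 0) with hg
  have hgd : ∀ y : ℝ, HasDerivAt g (-(cexp (τ * ((y : ℂ) - (x : ℂ))) * v y)) y := by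
    intro y
    have e1 : HasDerivAt (fun y : ℝ => cexp (τ * ((y : ℂ) - (x : ℂ))))
        (cexp (τ * ((y : ℂ) - (x : ℂ))) * τ) y := by
      have := (((hasDerivAt_id (y : ℂ)).sub_const (x : ℂ)).const_mul (τ : ℂ)).cexp.comp_ofReal
      simpa using this
    have e2 := ((hs.deriv1 y).const_mul (τ : ℂ)).sub
      (((h.diff_b.differentiable (by norm_num)).differentiableAt (x := y)).hasDerivAt.mul
        (hs.deriv0 y))
    refine (e1.mul e2).congr_deriv ?_
    simp only [hv, Pi.sub_apply, Pi.mul_apply]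
    push_cast
    field_simp
    ring_nf
    rw [I_sq]
    ring
  have hexpn : ∀ y : ℝ, ‖cexp (τ * ((y : ℂ) - (x : ℂ)))‖ = Real.exp (τ * (y - x)) := by
    intro y
    rw [Complex.norm_exp, ← Complex.ofReal_sub, ← Complex.ofReal_mul, Complex.ofReal_re]
  have hmv := (convex_Icc (x - d) x).norm_image_sub_le_of_norm_hasDerivWithin_le (C := C)
    (fun y _ => (hgd y).hasDerivWithinAt) (fun y hy => by
      have hy' : y ∈ Set.Icc (x - 1) x := ⟨by linarith [hy.1], hy.2⟩
      rw [norm_neg, norm_mul, hexpn]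
      refine (mul_le_of_le_one_left (norm_nonneg _) (Real.exp_le_one_iff.2
        (mul_nonpos_of_nonneg_of_nonpos (by linarith) (by linarith [hy.2])))).trans ?_
      have b0 := hn0 y hy.2
      have b1 := hn1 y hy.2
      have b2 := hA₁ y hy'
      have b3 := hA₂ y hy'
      have b4 := hA₃ y hy'
      have b5 : ‖-(a₀ * b₀ * ((τ⁻¹ : ℝ) : ℂ))‖ ≤ ‖a₀ * b₀‖ := by
        rw [norm_neg, norm_mul (a₀ * b₀), Complex.norm_real, Real.norm_of_nonneg (by positivity)]
        exact mul_le_of_le_one_right (norm_nonneg _) (inv_le_one_of_one_le₀ h1)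
      have b6 : ‖-(a₀ * b₀ * ((τ⁻¹ : ℝ) : ℂ)) * m y 0 + a y * m y 1‖ ≤
          ‖a₀ * b₀‖ * B x + A₁ * B x := by
        refine (norm_add_le _ _).trans ?_
        rw [norm_mul _ (m y 0), norm_mul _ (m y 1)]
        gcongr
      refine (norm_add_le _ _).trans ?_
      rw [norm_mul, norm_mul (b y)]
      exact add_le_add (mul_le_mul b4 b0 (norm_nonneg _) p3) (mul_le_mul b3 b6 (norm_nonneg _) p2))
    (Set.left_mem_Icc.2 (by linarith)) (Set.right_mem_Icc.2 (by linarith))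
  have hgx : g x = τ * m x 1 - b x * m x 0 := by simp [hg]
  have hgd' : ‖g (x - d)‖ ≤ Real.exp (-(τ * d)) * ((τ + A₂) * B x) := by
    rw [hg, norm_mul, hexpn, show τ * (x - d - x) = -(τ * d) by ring]
    refine mul_le_mul_of_nonneg_left ?_ (Real.exp_pos _).le
    have b0 := hn0 (x - d) (by linarith)
    have b1 := hn1 (x - d) (by linarith)
    have b3 := hA₂ (x - d) ⟨by linarith, by linarith⟩
    refine (norm_sub_le _ _).trans ?_
    rw [norm_mul, norm_mul, Complex.norm_real, Real.norm_of_nonneg (by linarith), add_mul]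
    gcongr
  rw [dist_zero_right, ← hgx]
  rw [sub_sub_cancel, Real.norm_of_nonneg hd0.le] at hmv
  have := norm_sub_norm_le (g x) (g (x - d))
  linarith

end

/-! ### Linear evolution in time: existence, zero curvature, asymptotics -/

section

variable {E : Type*} [NormedAddCommGroup E] [NormedSpace ℂ E]

/-- The half-line is mapped to the line by `x = exp y`; the point `x = 0` becomes `-∞`, where the
Volterra equation prescribes the value of the solution. -/
theorem exists_hasDerivAt_linear_pos [CompleteSpace E] {A : ℝ → E →L[ℂ] E} (hA : Continuous A)
    (e : E) :
    ∃ u : ℝ → E, Tendsto u (𝓝[>] 0) (𝓝 e) ∧ ∀ x, 0 < x → HasDerivAt u (A x (u x)) x := by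
  set D : ℝ → E →L[ℂ] E := fun y => ((Real.exp y : ℝ) : ℂ) • A (Real.exp y) with hD
  have hDc : Continuous D := by
    have := Real.continuous_exp
    exact (Complex.continuous_ofReal.comp this).smul (hA.comp this)
  have hDn : ∀ y, ‖D y‖ = Real.exp y * ‖A (Real.exp y)‖ := fun y => by
    rw [hD, norm_smul, Complex.norm_real, Real.norm_of_nonneg (Real.exp_pos y).le]
  have hV : VolterraBound 0 (0 : E →L[ℂ] E) D (fun y => ‖D y‖) (fun _ => 1) := by
    refine ⟨by simp, hDc, hDc.norm, fun x => ?_, fun _ => le_rfl, monotone_const, fun x y _ => ?_⟩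
    · obtain ⟨C, hC⟩ := isCompact_Icc.exists_bound_of_continuousOn
        (s := Set.Icc 0 (Real.exp x)) hA.continuousOn
      refine Integrable.mono' ((integrableOn_exp_Iic x).mul_const C)
        hDc.norm.aestronglyMeasurable ?_
      filter_upwards [ae_restrict_mem measurableSet_Iic] with y hy
      rw [norm_norm, hDn]
      exact mul_le_mul_of_nonneg_left (hC _ ⟨(Real.exp_pos y).le, Real.exp_le_exp.2 hy⟩)
        (Real.exp_pos y).le
    · simp
  refine ⟨fun x => volterraSol 0 0 D e (Real.log x), ?_, fun x hx => ?_⟩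
  · exact (hV.tendsto_volterraSol (by simp) e).comp Real.tendsto_log_nhdsGT_zero
  · have h1 := (hV.hasDerivAt_volterraSol (by simp) (e := e) (by simp) (Real.log x)).scomp x
      (Real.hasDerivAt_log hx.ne')
    refine h1.congr_deriv ?_
    simp only [hD, zero_apply, zero_add, Real.exp_log hx,
      smul_apply]
    rw [← Complex.coe_smul, smul_smul, ← Complex.ofReal_mul, inv_mul_cancel₀ hx.ne',
      Complex.ofReal_one, one_smul]

/-- Global existence for a homogeneous linear equation with continuous coefficients. -/
theorem exists_hasDerivAt_linear [CompleteSpace E] {A : ℝ → E →L[ℂ] E} (hA : Continuous A)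
    (e : E) : ∃ u : ℝ → E, u 0 = e ∧ ∀ x, HasDerivAt u (A x (u x)) x := by
  obtain ⟨u, hu0, hu⟩ := exists_hasDerivAt_linear_pos hA e
  obtain ⟨v, hv0, hv⟩ := exists_hasDerivAt_linear_pos (A := fun x => -A (-x))
    (hA.comp continuous_neg).neg e
  set w : ℝ → E := fun x => if 0 < x then u x else if x < 0 then v (-x) else e with hw
  have hw0 : w 0 = e := by simp [hw]
  have hpos : ∀ x, 0 < x → w x = u x := fun x hx => by simp [hw, hx]
  have hneg : ∀ x, x < 0 → w x = v (-x) := fun x hx => by simp [hw, hx, hx.le.not_gt]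
  have hc : ContinuousAt w 0 := by
    rw [continuousAt_iff_continuous_left'_right', ContinuousWithinAt, ContinuousWithinAt, hw0]
    constructor
    · have h1 : Tendsto (fun x : ℝ => -x) (𝓝[<] 0) (𝓝[>] 0) := by
        simpa using tendsto_neg_nhdsLT (a := (0 : ℝ))
      refine (hv0.comp h1).congr' ?_
      filter_upwards [self_mem_nhdsWithin] with x hx using (hneg x hx).symm
    · refine hu0.congr' ?_
      filter_upwards [self_mem_nhdsWithin] with x hx using (hpos x hx).symm
  refine ⟨w, hw0, hasDerivAt_of_hasDerivAt_of_ne' (fun x hx => ?_) hc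
    (hA.continuousAt.clm_apply hc)⟩
  rcases lt_or_gt_of_ne hx with hx | hx
  · have h1 := (hv (-x) (by linarith)).scomp x (hasDerivAt_neg x)
    have h2 : HasDerivAt (fun y => v (-y)) (A x (w x)) x := by
      refine h1.congr_deriv ?_
      rw [hneg x hx]
      simp
    refine h2.congr_of_eventuallyEq ?_
    filter_upwards [gt_mem_nhds hx] with y hy using hneg y hy
  · rw [hpos x hx]
    refine (hu x hx).congr_of_eventuallyEq ?_
    filter_upwards [lt_mem_nhds hx] with y hy using hpos y hy

theorem hasDerivAt_clm_apply_complex {L : ℝ → E →L[ℂ] E} {L' : E →L[ℂ] E} {v : ℝ → E} {v' : E}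
    {s : ℝ} (hL : HasDerivAt L L' s) (hv : HasDerivAt v v' s) :
    HasDerivAt (fun s => L s (v s)) (L' (v s) + L s v') s :=
  ((ContinuousLinearMap.restrictScalarsL ℂ E E ℝ ℝ).hasFDerivAt.comp_hasDerivAt s hL).clm_apply hv

theorem gronwallBound_mul (c δ K ε x : ℝ) :
    gronwallBound (c * δ) K (c * ε) x = c * gronwallBound δ K ε x := by
  by_cases hK : K = 0
  · subst hK; simp only [gronwallBound_K0]; ring
  · simp only [gronwallBound_of_K_ne_0 hK]; ring

/-- A family of vector functions that satisfies `φ_t = T φ` for all times, and `φ_x = X φ` at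
`t = 0`, satisfies the latter for all `t ≥ 0` if the zero curvature condition holds. Here
`φ(x + h) - φ(x) - h X φ(x)` is estimated by Gronwall's lemma, with a source of size `o(h)`. -/
theorem hasDerivAt_of_zero_curvature_of_nonneg {X T Xt Tx : ℝ → ℝ → E →L[ℂ] E}
    (hX : ∀ x t, HasDerivAt (fun s => X x s) (Xt x t) t)
    (hT : ∀ x t, HasDerivAt (fun y => T y t) (Tx x t) x)
    (hTc : Continuous fun p : ℝ × ℝ => T p.1 p.2)
    (hTxc : Continuous fun p : ℝ × ℝ => Tx p.1 p.2)
    (hzc : ∀ x t, Xt x t - Tx x t + (X x t ∘L T x t - T x t ∘L X x t) = 0)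
    {φ : ℝ → ℝ → E} (hφt : ∀ x t, HasDerivAt (fun s => φ x s) (T x t (φ x t)) t)
    (hφ0 : ∀ x, HasDerivAt (fun y => φ y 0) (X x 0 (φ x 0)) x) (x : ℝ) {t : ℝ} (ht : 0 ≤ t) :
    HasDerivAt (fun y => φ y t) (X x t (φ x t)) x := by
  set ψ : ℝ → E := fun s => X x s (φ x s) with hψ
  have hψd : ∀ s, HasDerivAt ψ (Tx x s (φ x s) + T x s (ψ s)) s := by
    intro s
    have h1 := hasDerivAt_clm_apply_complex (hX x s) (hφt x s)
    refine h1.congr_deriv ?_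
    have h2 := congrArg (fun L : E →L[ℂ] E => L (φ x s)) (hzc x s)
    simp only [add_apply, sub_apply,
      ContinuousLinearMap.comp_apply, zero_apply] at h2
    have h3 : Xt x s (φ x s) + X x s (T x s (φ x s)) - (Tx x s (φ x s) + T x s (X x s (φ x s))) =
        0 := by rw [← h2]; abel
    exact sub_eq_zero.1 h3
  have hφc : Continuous fun s => φ x s :=
    continuous_iff_continuousAt.2 fun s => (hφt x s).continuousAt
  have hψc : Continuous ψ := continuous_iff_continuousAt.2 fun s => (hψd s).continuousAt
  obtain ⟨M₁, hM₁⟩ := isCompact_Icc.exists_bound_of_continuousOn (s := Set.Icc 0 t)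
    hφc.continuousOn
  obtain ⟨M₂, hM₂⟩ := isCompact_Icc.exists_bound_of_continuousOn (s := Set.Icc 0 t)
    hψc.continuousOn
  obtain ⟨K, hK⟩ := ((isCompact_Icc (a := x - 1) (b := x + 1)).prod
    (isCompact_Icc (a := 0) (b := t))).exists_bound_of_continuousOn hTc.continuousOn
  have h0mem : (0 : ℝ) ∈ Set.Icc 0 t := ⟨le_rfl, ht⟩
  set G := gronwallBound 1 K (M₁ + M₂) t with hG
  rw [hasDerivAt_iff_isLittleO, Asymptotics.isLittleO_iff]
  intro c hc
  set ε := c / (|G| + 1) with hε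
  have hε0 : 0 < ε := by positivity
  have hεG : ε * G ≤ c := by
    have h1 : ε * (|G| + 1) = c := by rw [hε]; field_simp
    nlinarith [le_abs_self G]
  have ev1 : ∀ᶠ y in 𝓝 x, ∀ s ∈ Set.Icc 0 t, ‖Tx y s - Tx x s‖ < ε :=
    isCompact_Icc.eventually_forall_of_forall_eventually fun s _ => by
      have h1 : Continuous fun p : ℝ × ℝ => ‖Tx p.1 p.2 - Tx x p.2‖ :=
        (hTxc.sub (hTxc.comp (continuous_const.prodMk continuous_snd))).norm
      have h2 := h1.tendsto (x, s)
      simp only [sub_self, norm_zero] at h2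
      exact h2.eventually (gt_mem_nhds hε0)
  have ev2 : ∀ᶠ y in 𝓝 x, ∀ s ∈ Set.Icc 0 t, ‖T y s - T x s‖ < ε :=
    isCompact_Icc.eventually_forall_of_forall_eventually fun s _ => by
      have h1 : Continuous fun p : ℝ × ℝ => ‖T p.1 p.2 - T x p.2‖ :=
        (hTc.sub (hTc.comp (continuous_const.prodMk continuous_snd))).norm
      have h2 := h1.tendsto (x, s)
      simp only [sub_self, norm_zero] at h2
      exact h2.eventually (gt_mem_nhds hε0)
  have ev3 := (Asymptotics.isLittleO_iff.1 (hasDerivAt_iff_isLittleO.1 (hφ0 x))) hε0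
  obtain ⟨r, hr, hball⟩ := Metric.eventually_nhds_iff_ball.1
    ((ev1.and ev2).and (ev3.and (Metric.ball_mem_nhds x one_pos)))
  filter_upwards [Metric.ball_mem_nhds x hr] with y hy
  have hy1 : y ∈ Set.Icc (x - 1) (x + 1) := by
    have := (hball y hy).2.2
    rw [Real.dist_eq] at this
    have := abs_lt.1 this
    constructor <;> linarith
  have hmean : ∀ s ∈ Set.Icc 0 t, ‖T y s - T x s - (y - x) • Tx x s‖ ≤ ε * ‖y - x‖ := by
    intro s hs
    have := (convex_ball x r).norm_image_sub_le_of_norm_hasDerivWithin_le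
      (f := fun y => T y s - y • Tx x s) (f' := fun y => Tx y s - Tx x s) (C := ε)
      (fun z _ => ((hT z s).sub
        (by simpa using (hasDerivAt_id z).smul_const (Tx x s))).hasDerivWithinAt)
      (fun z hz => ((hball z hz).1.1 s hs).le) (Metric.mem_ball_self hr) hy
    have e1 : T y s - T x s - (y - x) • Tx x s = T y s - y • Tx x s - (T x s - x • Tx x s) := by
      rw [sub_smul]
      abel
    rw [e1]
    exact this
  have hgr := norm_le_gronwallBound_of_norm_deriv_right_le
    (f := fun s => φ y s - φ x s - (y - x) • ψ s)
    (f' := fun s => T y s (φ y s) - T x s (φ x s) - (y - x) • (Tx x s (φ x s) + T x s (ψ s)))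
    (δ := (ε * ‖y - x‖) * 1) (K := K) (ε := (ε * ‖y - x‖) * (M₁ + M₂)) (a := 0) (b := t)
    ?_ ?_ ?_ ?_ t ⟨ht, le_rfl⟩
  · rw [sub_zero, gronwallBound_mul] at hgr
    refine hgr.trans ?_
    calc _ = (ε * G) * ‖y - x‖ := by ring
      _ ≤ _ := by gcongr
  · have : Continuous fun s => φ y s :=
      continuous_iff_continuousAt.2 fun s => (hφt y s).continuousAt
    exact ((this.sub hφc).sub (hψc.const_smul _)).continuousOn
  · intro s _
    exact (((hφt y s).sub (hφt x s)).sub ((hψd s).const_smul (y - x))).hasDerivWithinAt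
  · rw [mul_one]
    exact (hball y hy).2.1
  · intro s hs
    have hs' : s ∈ Set.Icc 0 t := Set.Ico_subset_Icc_self hs
    have e1 : T y s (φ y s) - T x s (φ x s) - (y - x) • (Tx x s (φ x s) + T x s (ψ s)) =
        T y s (φ y s - φ x s - (y - x) • ψ s) + ((T y s - T x s - (y - x) • Tx x s) (φ x s) +
          (y - x) • (T y s - T x s) (ψ s)) := by
      simp only [map_sub, sub_apply, smul_apply, smul_add,
        smul_sub, ContinuousLinearMap.map_smul_of_tower]
      abel
    rw [e1]
    have n1 : ‖T y s (φ y s - φ x s - (y - x) • ψ s)‖ ≤ K * ‖φ y s - φ x s - (y - x) • ψ s‖ :=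
      (T y s).le_of_opNorm_le (hK (y, s) ⟨hy1, hs'⟩) _
    have n2 : ‖(T y s - T x s - (y - x) • Tx x s) (φ x s)‖ ≤ ε * ‖y - x‖ * M₁ :=
      (ContinuousLinearMap.le_of_opNorm_le _ (hmean s hs') _).trans
        (mul_le_mul_of_nonneg_left (hM₁ s hs') (by positivity))
    have n3 : ‖(y - x) • (T y s - T x s) (ψ s)‖ ≤ ε * ‖y - x‖ * M₂ := by
      rw [norm_smul, mul_comm ε, mul_assoc]
      refine mul_le_mul_of_nonneg_left ?_ (norm_nonneg _)
      exact (ContinuousLinearMap.le_of_opNorm_le _ ((hball y hy).1.2 s hs').le _).trans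
        (mul_le_mul_of_nonneg_left (hM₂ s hs') hε0.le)
    refine (norm_add_le _ _).trans (add_le_add n1 ((norm_add_le _ _).trans ?_))
    rw [mul_add]
    exact add_le_add n2 n3

theorem hasDerivAt_of_zero_curvature {X T Xt Tx : ℝ → ℝ → E →L[ℂ] E}
    (hX : ∀ x t, HasDerivAt (fun s => X x s) (Xt x t) t)
    (hT : ∀ x t, HasDerivAt (fun y => T y t) (Tx x t) x)
    (hTc : Continuous fun p : ℝ × ℝ => T p.1 p.2)
    (hTxc : Continuous fun p : ℝ × ℝ => Tx p.1 p.2)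
    (hzc : ∀ x t, Xt x t - Tx x t + (X x t ∘L T x t - T x t ∘L X x t) = 0)
    {φ : ℝ → ℝ → E} (hφt : ∀ x t, HasDerivAt (fun s => φ x s) (T x t (φ x t)) t)
    (hφ0 : ∀ x, HasDerivAt (fun y => φ y 0) (X x 0 (φ x 0)) x) (x t : ℝ) :
    HasDerivAt (fun y => φ y t) (X x t (φ x t)) x := by
  rcases le_total 0 t with ht | ht
  · exact hasDerivAt_of_zero_curvature_of_nonneg hX hT hTc hTxc hzc hφt hφ0 x ht
  · have hneg : Continuous fun p : ℝ × ℝ => (p.1, -p.2) :=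
      continuous_fst.prodMk continuous_snd.neg
    have := hasDerivAt_of_zero_curvature_of_nonneg (X := fun x t => X x (-t))
      (T := fun x t => -T x (-t)) (Xt := fun x t => -Xt x (-t)) (Tx := fun x t => -Tx x (-t))
      (φ := fun x t => φ x (-t))
        (fun x t => ((hX x (-t)).scomp t (hasDerivAt_neg t)).congr_deriv (by simp))
      (fun x t => (hT x (-t)).neg) (hTc.comp hneg).neg (hTxc.comp hneg).neg
      (fun x t => by
        rw [← neg_eq_zero, ← hzc x (-t)]
        simp only [ContinuousLinearMap.comp_neg, ContinuousLinearMap.neg_comp]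
        abel)
      (fun x t => ((hφt x (-t)).scomp t (hasDerivAt_neg t)).congr_deriv (by simp))
        (by simpa using hφ0) x
      (neg_nonneg.2 ht)
    simpa using this

theorem tendsto_of_evolution_of_nonneg {T : ℝ → ℝ → E →L[ℂ] E} {T₀ : E →L[ℂ] E} {l : Filter ℝ}
    (hT : TendstoLocallyUniformly T (fun _ => T₀) l) {Ω : ℂ} {e : E} (he : T₀ e = Ω • e)
    {φ : ℝ → ℝ → E} (hφt : ∀ x t, HasDerivAt (fun s => φ x s) (T x t (φ x t)) t) {g : ℝ → ℂ}
    (h0 : Tendsto (fun x => cexp (g x) • φ x 0) l (𝓝 e)) {t : ℝ} (ht : 0 ≤ t) :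
    Tendsto (fun x => cexp (g x - Ω * t) • φ x t) l (𝓝 e) := by
  set K := ‖T₀‖ + 1 + ‖Ω‖ with hK
  set G := gronwallBound 1 K ‖e‖ t with hG
  rw [Metric.tendsto_nhds]
  intro c hc
  set ε := min 1 (c / (2 * (|G| + 1))) with hε
  have hε0 : 0 < ε := by positivity
  have hε1 : ε ≤ 1 := min_le_left _ _
  have hεG : ε * G < c := by
    have h1 : ε ≤ c / (2 * (|G| + 1)) := min_le_right _ _
    have h2 : ε * (|G| + 1) ≤ c / 2 := by
      calc _ ≤ c / (2 * (|G| + 1)) * (|G| + 1) := by gcongr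
        _ = c / 2 := by field_simp
    nlinarith [le_abs_self G]
  have ev1 : ∀ᶠ x in l, ∀ s ∈ Set.Icc 0 t, dist T₀ (T x s) < ε :=
    (tendstoLocallyUniformlyOn_iff_tendstoUniformlyOn_of_compact isCompact_Icc).1
      (hT.tendstoLocallyUniformlyOn) _ (Metric.dist_mem_uniformity hε0)
  filter_upwards [ev1, (Metric.tendsto_nhds.1 h0) ε hε0] with x h1 h2
  have hd : ∀ s : ℝ, HasDerivAt (fun s : ℝ => cexp (g x - Ω * s) • φ x s - e)
      (T x s (cexp (g x - Ω * s) • φ x s) - Ω • (cexp (g x - Ω * s) • φ x s)) s := by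
    intro s
    have e1 : HasDerivAt (fun s : ℝ => cexp (g x - Ω * s)) (cexp (g x - Ω * s) * (-Ω)) s := by
      have := (((hasDerivAt_id (s : ℂ)).const_mul Ω).const_sub (g x)).cexp.comp_ofReal
      simpa using this
    refine ((e1.smul (hφt x s)).sub_const e).congr_deriv ?_
    rw [map_smul, smul_smul, mul_neg, neg_smul, mul_comm Ω (cexp _)]
    abel
  have hgr := norm_le_gronwallBound_of_norm_deriv_right_le
    (f := fun s : ℝ => cexp (g x - Ω * s) • φ x s - e)
    (f' := fun s : ℝ => T x s (cexp (g x - Ω * s) • φ x s) - Ω • (cexp (g x - Ω * s) • φ x s))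
    (δ := ε * 1) (K := K) (ε := ε * ‖e‖) (a := 0) (b := t)
    (fun s _ => (hd s).continuousAt.continuousWithinAt) (fun s _ => (hd s).hasDerivWithinAt) ?_ ?_
    t ⟨ht, le_rfl⟩
  · rw [sub_zero, gronwallBound_mul] at hgr
    rw [dist_eq_norm]
    exact hgr.trans_lt hεG
  · rw [mul_one]
    simpa [dist_eq_norm] using h2.le
  · intro s hs
    have h3 := h1 s (Set.Ico_subset_Icc_self hs)
    rw [dist_comm, dist_eq_norm] at h3
    set v := cexp (g x - Ω * s) • φ x s with hv
    have e1 : T x s v - Ω • v = (T x s (v - e) - Ω • (v - e)) + (T x s - T₀) e := by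
      rw [sub_apply, he, map_sub, smul_sub]
      abel
    have n1 : ‖T x s‖ ≤ ‖T₀‖ + 1 := by
      have := norm_le_norm_add_norm_sub' (T x s) T₀
      linarith
    have n2 : ‖T x s (v - e) - Ω • (v - e)‖ ≤ K * ‖v - e‖ := by
      refine (norm_sub_le _ _).trans ?_
      rw [norm_smul, hK, add_mul]
      exact add_le_add_left ((T x s).le_of_opNorm_le n1 _) _
    rw [e1]
    exact (norm_add_le _ _).trans (add_le_add n2 (ContinuousLinearMap.le_of_opNorm_le _ h3.le _))

/-- The normalization `e^{g(x) - Ω t} φ(x, t) → e` at an end of the line is preserved by the time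
evolution if, in the limit, the evolution operator has `e` as an eigenvector for `Ω`. -/
theorem tendsto_of_evolution {T : ℝ → ℝ → E →L[ℂ] E} {T₀ : E →L[ℂ] E} {l : Filter ℝ}
    (hT : TendstoLocallyUniformly T (fun _ => T₀) l) {Ω : ℂ} {e : E} (he : T₀ e = Ω • e)
    {φ : ℝ → ℝ → E} (hφt : ∀ x t, HasDerivAt (fun s => φ x s) (T x t (φ x t)) t) {g : ℝ → ℂ}
    (h0 : Tendsto (fun x => cexp (g x) • φ x 0) l (𝓝 e)) (t : ℝ) :
    Tendsto (fun x => cexp (g x - Ω * t) • φ x t) l (𝓝 e) := by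
  rcases le_total 0 t with ht | ht
  · exact tendsto_of_evolution_of_nonneg hT he hφt h0 ht
  · have hT' : TendstoLocallyUniformly (fun x t => -T x (-t)) (fun _ => -T₀) l :=
      (hT.comp (fun t : ℝ => -t) continuous_neg).neg
    have := tendsto_of_evolution_of_nonneg hT' (Ω := -Ω) (e := e) (by simp [he])
      (φ := fun x t => φ x (-t))
      (fun x t => ((hφt x (-t)).scomp t (hasDerivAt_neg t)).congr_deriv (by simp)) (g := g)
      (by simpa using h0) (neg_nonneg.2 ht)
    simpa using this

end

/-! ### The linear system for the residues -/

section

variable {ι : Type*} [Fintype ι] [DecidableEq ι]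

/-- Cramer's rule in bordered form: the bordered determinant pairs the row with the solution of the
linear system. -/
theorem det_fromBlocks_replicate_zero {H : Matrix ι ι ℂ} (hH : H.det ≠ 0) {β u : ι → ℂ}
    (hu : H.mulVec u = β) (α : ι → ℂ) :
    (Matrix.fromBlocks H (Matrix.replicateCol Unit β) (Matrix.replicateRow Unit α) 0).det =
      H.det * -(∑ n, α n * u n) := by
  have hunit : IsUnit H.det := isUnit_iff_ne_zero.2 hH
  have : Invertible H := H.invertibleOfIsUnitDet hunit
  rw [Matrix.det_fromBlocks₁₁, Matrix.det_unique (n := Unit)]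
  congr 1
  have h1 : ⅟H * Matrix.replicateCol Unit β = Matrix.replicateCol Unit u := by
    rw [Matrix.invOf_eq_nonsing_inv, ← Matrix.replicateCol_mulVec, ← hu, Matrix.mulVec_mulVec,
      Matrix.nonsing_inv_mul H hunit, Matrix.one_mulVec]
  rw [Matrix.mul_assoc, h1]
  simp [Matrix.mul_apply]

/-- The matrix of the linear system for the residues is invertible as soon as the system is solvable
for the two right-hand sides `(-κ / η_k)` and `(-1)`: the left kernel is orthogonal to both, hence
(by the Cauchy structure of the matrix) invariant under the diagonal matrix with the distinct
entries `η_k + c / η_k`, and orthogonal to the constant vector; so it vanishes. -/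
theorem det_ne_zero_of_solvable {η α : ι → ℂ} {c κ : ℂ} (hη0 : ∀ k, η k ≠ 0)
    (hκ : κ ≠ 0) (hηη : ∀ k n, η k * η n ≠ c) (hinj : Function.Injective η) {H : Matrix ι ι ℂ}
    (hH : ∀ k n, H k n = α n / (η k - c / η n) - if k = n then κ / η k else 0) {u v : ι → ℂ}
    (hu : H.mulVec u = fun k => -(κ / η k)) (hv : H.mulVec v = fun _ => -1) : H.det ≠ 0 := by
  have h1 : ∀ w : ι → ℂ, Matrix.vecMul w H = 0 → ∑ k, w k = 0 := by
    intro w hw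
    have := congrArg (dotProduct w) hv
    rw [Matrix.dotProduct_mulVec, hw, zero_dotProduct] at this
    simpa [dotProduct] using this.symm
  have h2 : ∀ w : ι → ℂ, Matrix.vecMul w H = 0 → ∑ k, w k / η k = 0 := by
    intro w hw
    have := congrArg (dotProduct w) hu
    rw [Matrix.dotProduct_mulVec, hw, zero_dotProduct] at this
    have h3 : ∑ k, w k * -(κ / η k) = -κ * ∑ k, w k / η k := by
      rw [Finset.mul_sum]
      exact Finset.sum_congr rfl fun k _ => by ring
    rw [dotProduct, h3] at this
    exact (mul_eq_zero.1 this.symm).resolve_left (neg_ne_zero.2 hκ)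
  have hker : ∀ w : ι → ℂ, Matrix.vecMul w H = 0 ↔
      ∀ n, α n * η n * ∑ k, w k / (η k * η n - c) = κ / η n * w n := by
    intro w
    rw [funext_iff]
    refine forall_congr' fun n => ?_
    have e1 : Matrix.vecMul w H n = ∑ k, (α n * η n * (w k / (η k * η n - c)) -
        if k = n then κ / η n * w n else 0) := by
      refine Finset.sum_congr rfl fun k _ => ?_
      have := hη0 n
      have h3 : η k * η n - c ≠ 0 := sub_ne_zero.2 (hηη k n)
      have h4 : η k - c / η n = (η k * η n - c) / η n := by field_simp
      change w k * H k n = _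
      rw [hH, h4]
      split_ifs with h
      · subst h
        field_simp
      · field_simp
        ring
    rw [e1, Finset.sum_sub_distrib, ← Finset.mul_sum, Finset.sum_ite_eq' Finset.univ n,
      if_pos (Finset.mem_univ n), Pi.zero_apply, sub_eq_zero]
  set d : ι → ℂ := fun k => η k + c / η k with hd
  have hdinj : Function.Injective d := by
    intro k n hkn
    have hk := hη0 k
    have hn := hη0 n
    have h3 : (η k - η n) * (η k * η n - c) = 0 := by
      simp only [hd] at hkn
      field_simp at hkn
      linear_combination hkn
    exact hinj (sub_eq_zero.1 ((mul_eq_zero.1 h3).resolve_right (sub_ne_zero.2 (hηη k n))))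
  have hinv : ∀ w : ι → ℂ, Matrix.vecMul w H = 0 → Matrix.vecMul (fun k => d k * w k) H = 0 := by
    intro w hw
    have hs1 := h1 w hw
    have hs2 := h2 w hw
    rw [hker] at hw ⊢
    intro n
    have hn := hη0 n
    have e1 : ∑ k, d k * w k / (η k * η n - c) =
        d n * (∑ k, w k / (η k * η n - c)) + ((1 / η n) * (∑ k, w k) - ∑ k, w k / η k) := by
      rw [Finset.mul_sum, Finset.mul_sum, ← Finset.sum_sub_distrib, ← Finset.sum_add_distrib]
      refine Finset.sum_congr rfl fun k _ => ?_
      have hk := hη0 k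
      have h3 : η k * η n - c ≠ 0 := sub_ne_zero.2 (hηη k n)
      simp only [hd]
      field_simp
      ring
    rw [e1, hs1, hs2, mul_zero, sub_zero, add_zero]
    linear_combination d n * hw n
  have hprod : ∀ (w : ι → ℂ), Matrix.vecMul w H = 0 → ∀ s : Finset ι,
      Matrix.vecMul (fun k => (∏ j ∈ s, (d k - d j)) * w k) H = 0 := by
    intro w hw s
    induction s using Finset.induction_on with
    | empty => simpa using hw
    | insert i s his ih =>
      have h3 := hinv _ ih
      have h4 : (fun k => (∏ j ∈ insert i s, (d k - d j)) * w k) =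
          (fun k => d k * ((∏ j ∈ s, (d k - d j)) * w k)) -
            d i • fun k => (∏ j ∈ s, (d k - d j)) * w k := by
        funext k
        simp only [Finset.prod_insert his, Pi.sub_apply, Pi.smul_apply, smul_eq_mul]
        ring
      rw [h4, Matrix.sub_vecMul, Matrix.smul_vecMul, h3, ih, smul_zero, sub_zero]
  intro hdet
  obtain ⟨w, hw0, hw⟩ := Matrix.exists_vecMul_eq_zero_iff.2 hdet
  refine hw0 (funext fun i => ?_)
  -- The product of `d - d_j` over `j ≠ i` leaves only the entry `i` of a left null vector.
  have h3 := h1 _ (hprod w hw (Finset.univ.erase i))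
  rw [Finset.sum_eq_single i] at h3
  · refine (mul_eq_zero.1 h3).resolve_left (Finset.prod_ne_zero_iff.2 fun j hj => ?_)
    exact sub_ne_zero.2 fun h => Finset.ne_of_mem_erase hj (hdinj h).symm
  · intro k _ hki
    rw [Finset.prod_eq_zero (Finset.mem_erase.2 ⟨hki, Finset.mem_univ k⟩) (sub_self _), zero_mul]
  · intro h
    exact absurd (Finset.mem_univ i) h

end

/-! ### The Lax pair -/

/-- The operator on `ℂ²` of the traceless matrix `[[a, b], [c, -a]]`. -/
def slCLM (a b c : ℂ) : (Fin 2 → ℂ) →L[ℂ] (Fin 2 → ℂ) :=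
  a • matCLM !![1, 0; 0, -1] + b • matCLM !![0, 1; 0, 0] + c • matCLM !![0, 0; 1, 0]

@[simp] theorem slCLM_apply_zero (a b c : ℂ) (v : Fin 2 → ℂ) :
    slCLM a b c v 0 = a * v 0 + b * v 1 := by
  simp [slCLM, Matrix.vecHead, Matrix.vecTail]

@[simp] theorem slCLM_apply_one (a b c : ℂ) (v : Fin 2 → ℂ) :
    slCLM a b c v 1 = c * v 0 - a * v 1 := by
  simp [slCLM, Matrix.vecHead, Matrix.vecTail]
  ring

theorem tendsto_slCLM {α : Type*} {l : Filter α} {a b c : α → ℂ} {a₀ b₀ c₀ : ℂ}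
    (ha : Tendsto a l (𝓝 a₀)) (hb : Tendsto b l (𝓝 b₀)) (hc : Tendsto c l (𝓝 c₀)) :
    Tendsto (fun p => slCLM (a p) (b p) (c p)) l (𝓝 (slCLM a₀ b₀ c₀)) :=
  ((ha.smul_const (matCLM !![1, 0; 0, -1])).add (hb.smul_const (matCLM !![0, 1; 0, 0]))).add
    (hc.smul_const (matCLM !![0, 0; 1, 0]))

theorem hasDerivAt_slCLM {a b c : ℝ → ℂ} {a' b' c' : ℂ} {x : ℝ} (ha : HasDerivAt a a' x)
    (hb : HasDerivAt b b' x) (hc : HasDerivAt c c' x) :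
    HasDerivAt (fun y => slCLM (a y) (b y) (c y)) (slCLM a' b' c') x :=
  ((ha.smul_const (matCLM !![1, 0; 0, -1])).add (hb.smul_const (matCLM !![0, 1; 0, 0]))).add
    (hc.smul_const (matCLM !![0, 0; 1, 0]))

theorem tendstoLocallyUniformly_const_iff {X β : Type*} [TopologicalSpace X] [UniformSpace β]
    {F : ℝ → X → β} {c : β} {l : Filter ℝ} :
    TendstoLocallyUniformly F (fun _ => c) l ↔
      ∀ t, Tendsto (fun p : ℝ × X => F p.1 p.2) (l ×ˢ 𝓝 t) (𝓝 c) := by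
  rw [tendstoLocallyUniformly_iff_forall_tendsto]
  exact forall_congr' fun t => Uniform.tendsto_nhds_right.symm

/-- The derivatives that occur in the Lax pair, for a function `q` on the plane: `q₁`, `q₂`, `q₃`
are the derivatives in `x`, and `q'` is the derivative in `t`. -/
structure HasJets (q q₁ q₂ q₃ q' : ℝ → ℝ → ℂ) : Prop where
  deriv₀ : ∀ x t, HasDerivAt (fun y => q y t) (q₁ x t) x
  deriv₁ : ∀ x t, HasDerivAt (fun y => q₁ y t) (q₂ x t) x
  deriv₂ : ∀ x t, HasDerivAt (fun y => q₂ y t) (q₃ x t) x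
  derivt : ∀ x t, HasDerivAt (fun s => q x s) (q' x t) t
  cont₀ : Continuous fun p : ℝ × ℝ => q p.1 p.2
  cont₁ : Continuous fun p : ℝ × ℝ => q₁ p.1 p.2
  cont₂ : Continuous fun p : ℝ × ℝ => q₂ p.1 p.2
  cont₃ : Continuous fun p : ℝ × ℝ => q₃ p.1 p.2

theorem exists_hasJets_of_contDiff {q : ℝ → ℝ → ℝ}
    (hq : ContDiff ℝ 3 fun p : ℝ × ℝ => q p.1 p.2) :
    HasJets (fun x t => (q x t : ℂ)) (fun x t => ((deriv (fun y => q y t) x : ℝ) : ℂ))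
      (fun x t => ((iteratedDeriv 2 (fun y => q y t) x : ℝ) : ℂ))
      (fun x t => ((iteratedDeriv 3 (fun y => q y t) x : ℝ) : ℂ))
      (fun x t => ((deriv (fun s => q x s) t : ℝ) : ℂ)) := by
  have key : ∀ (n : ℕ) (F : ℝ × ℝ → ℝ), ContDiff ℝ (n + 1) F →
      ∀ x t, HasDerivAt (fun y => F (y, t)) (fderiv ℝ F (x, t) (1, 0)) x := by
    intro n F hF x t
    have h1 := ((hF.differentiable (by simp)).differentiableAt (x := (x, t))).hasFDerivAt
    exact h1.comp_hasDerivAt x ((hasDerivAt_id x).prodMk (hasDerivAt_const x t))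
  have smooth : ∀ (n : ℕ) (F : ℝ × ℝ → ℝ), ContDiff ℝ (n + 1) F →
      ContDiff ℝ n fun p => fderiv ℝ F p (1, 0) := fun n F hF =>
    (hF.fderiv_right (m := n) le_rfl).clm_apply contDiff_const
  set F : ℝ × ℝ → ℝ := fun p => q p.1 p.2 with hF
  have c0 : ContDiff ℝ ((2 : ℕ) + 1) F := by exact_mod_cast hq
  set F₁ : ℝ × ℝ → ℝ := fun p => fderiv ℝ F p (1, 0) with hF₁
  have c1 : ContDiff ℝ ((1 : ℕ) + 1) F₁ := by exact_mod_cast smooth 2 F c0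
  set F₂ : ℝ × ℝ → ℝ := fun p => fderiv ℝ F₁ p (1, 0) with hF₂
  have c2 : ContDiff ℝ ((0 : ℕ) + 1) F₂ := by exact_mod_cast smooth 1 F₁ c1
  set F₃ : ℝ × ℝ → ℝ := fun p => fderiv ℝ F₂ p (1, 0) with hF₃
  have c3 : Continuous F₃ := (smooth 0 F₂ c2).continuous
  have d0 : ∀ x t, HasDerivAt (fun y => q y t) (F₁ (x, t)) x := key 2 F c0
  have d1 : ∀ x t, HasDerivAt (fun y => F₁ (y, t)) (F₂ (x, t)) x := key 1 F₁ c1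
  have d2 : ∀ x t, HasDerivAt (fun y => F₂ (y, t)) (F₃ (x, t)) x := key 0 F₂ c2
  have e1 : ∀ x t, deriv (fun y => q y t) x = F₁ (x, t) := fun x t => (d0 x t).deriv
  have e2 : ∀ x t, iteratedDeriv 2 (fun y => q y t) x = F₂ (x, t) := by
    intro x t
    rw [iteratedDeriv_succ, iteratedDeriv_one, funext fun y => e1 y t]
    exact (d1 x t).deriv
  have e3 : ∀ x t, iteratedDeriv 3 (fun y => q y t) x = F₃ (x, t) := by
    intro x t
    rw [iteratedDeriv_succ, funext fun y => e2 y t]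
    exact (d2 x t).deriv
  simp only [e1, e2, e3]
  refine ⟨fun x t => (d0 x t).ofReal_comp, fun x t => (d1 x t).ofReal_comp,
    fun x t => (d2 x t).ofReal_comp, fun x t => ?_, ?_, ?_, ?_, ?_⟩
  · have h1 : DifferentiableAt ℝ (fun s => q x s) t :=
      (c0.differentiable (by simp)).differentiableAt.comp t
        ((hasDerivAt_const t x).prodMk (hasDerivAt_id t)).differentiableAt
    exact h1.hasDerivAt.ofReal_comp
  · exact Complex.continuous_ofReal.comp c0.continuous
  · exact Complex.continuous_ofReal.comp c1.continuous
  · exact Complex.continuous_ofReal.comp c2.continuous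
  · exact Complex.continuous_ofReal.comp c3

theorem HasJets.reflect {q q₁ q₂ q₃ q' : ℝ → ℝ → ℂ} (h : HasJets q q₁ q₂ q₃ q') (s : ℂ) :
    HasJets (fun x t => s * q (-x) (-t)) (fun x t => -(s * q₁ (-x) (-t)))
      (fun x t => s * q₂ (-x) (-t)) (fun x t => -(s * q₃ (-x) (-t)))
      (fun x t => -(s * q' (-x) (-t))) := by
  have hc : Continuous fun p : ℝ × ℝ => (-p.1, -p.2) :=
    continuous_fst.neg.prodMk continuous_snd.neg
  have hd : ∀ {f : ℝ → ℂ} {f' : ℂ} {x : ℝ}, HasDerivAt f f' (-x) →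
      HasDerivAt (fun y => s * f (-y)) (-(s * f')) x := fun {f f' x} hf =>
    ((hf.scomp x (hasDerivAt_neg x)).const_mul s).congr_deriv (by simp)
  exact ⟨fun x t => hd (h.deriv₀ (-x) (-t)),
    fun x t => (hd (h.deriv₁ (-x) (-t))).neg.congr_deriv (by simp),
    fun x t => hd (h.deriv₂ (-x) (-t)), fun x t => hd (h.derivt (-x) (-t)),
    continuous_const.mul (h.cont₀.comp hc), (continuous_const.mul (h.cont₁.comp hc)).neg,
    continuous_const.mul (h.cont₂.comp hc), (continuous_const.mul (h.cont₃.comp hc)).neg⟩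

theorem HasJets.continuous_time {q q₁ q₂ q₃ q' : ℝ → ℝ → ℂ} (h : HasJets q q₁ q₂ q₃ q') (x : ℝ) :
    (Continuous fun t => q x t) ∧ (Continuous fun t => q₁ x t) ∧ Continuous fun t => q₂ x t := by
  have hx : Continuous fun t : ℝ => (x, t) := continuous_const.prodMk continuous_id
  exact ⟨h.cont₀.comp hx, h.cont₁.comp hx, h.cont₂.comp hx⟩

/-- The operator `T` of the time evolution `φ_t = T φ`, as a function of `k`, of the potentials, and
of their first two derivatives in `x`. -/
def laxT (k q q₁ q₂ r r₁ r₂ : ℂ) : (Fin 2 → ℂ) →L[ℂ] (Fin 2 → ℂ) :=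
  slCLM (4 * I * k ^ 3 + 2 * I * k * q * r + (q₁ * r - q * r₁))
    (4 * k ^ 2 * q + 2 * q ^ 2 * r - 2 * I * k * q₁ - q₂)
    (4 * k ^ 2 * r + 2 * q * r ^ 2 + 2 * I * k * r₁ - r₂)

section

variable {q q₁ q₂ q₃ q' r r₁ r₂ r₃ r' : ℝ → ℝ → ℂ}

/-- The zero curvature condition is the coupled system `q_t - 6 q r q_x + q_xxx = 0`,
`r_t - 6 q r r_x + r_xxx = 0`; so the Jost solutions at `t = 0` evolve to solutions of the
scattering problem for all times. -/
theorem HasJets.hasDerivAt_of_evolution (hq : HasJets q q₁ q₂ q₃ q') (hr : HasJets r r₁ r₂ r₃ r')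
    (pq : ∀ x t, q' x t - 6 * q x t * r x t * q₁ x t + q₃ x t = 0)
    (pr : ∀ x t, r' x t - 6 * q x t * r x t * r₁ x t + r₃ x t = 0) (k : ℂ)
    {φ : ℝ → ℝ → Fin 2 → ℂ}
    (hφt : ∀ x t, HasDerivAt (fun s => φ x s)
      (laxT k (q x t) (q₁ x t) (q₂ x t) (r x t) (r₁ x t) (r₂ x t) (φ x t)) t)
    (hφ0 : ∀ x, HasDerivAt (fun y => φ y 0) (slCLM (I * k) (q x 0) (r x 0) (φ x 0)) x) (x t : ℝ) :
    HasDerivAt (fun y => φ y t) (slCLM (I * k) (q x t) (r x t) (φ x t)) x := by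
  refine hasDerivAt_of_zero_curvature (X := fun x t => slCLM (I * k) (q x t) (r x t))
    (T := fun x t => laxT k (q x t) (q₁ x t) (q₂ x t) (r x t) (r₁ x t) (r₂ x t))
    (Xt := fun x t => slCLM 0 (q' x t) (r' x t))
    (Tx := fun x t => slCLM
      (2 * I * k * (q₁ x t * r x t + q x t * r₁ x t) + (q₂ x t * r x t - q x t * r₂ x t))
      (4 * k ^ 2 * q₁ x t + (4 * q x t * q₁ x t * r x t + 2 * q x t ^ 2 * r₁ x t)
        - 2 * I * k * q₂ x t - q₃ x t)
      (4 * k ^ 2 * r₁ x t + (2 * q₁ x t * r x t ^ 2 + 4 * q x t * r x t * r₁ x t)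
        + 2 * I * k * r₂ x t - r₃ x t)) ?_ ?_ ?_ ?_ ?_ hφt hφ0 x t
  · exact fun x t => hasDerivAt_slCLM (hasDerivAt_const t _) (hq.derivt x t) (hr.derivt x t)
  · intro x t
    have a0 := hq.deriv₀ x t
    have a1 := hq.deriv₁ x t
    have a2 := hq.deriv₂ x t
    have b0 := hr.deriv₀ x t
    have b1 := hr.deriv₁ x t
    have b2 := hr.deriv₂ x t
    refine hasDerivAt_slCLM ?_ ?_ ?_
    · refine ((((a0.const_mul (2 * I * k)).mul b0).const_add (4 * I * k ^ 3)).add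
        ((a1.mul b0).sub (a0.mul b1))).congr_deriv ?_
      ring
    · refine ((((a0.const_mul (4 * k ^ 2)).add (((a0.pow 2).const_mul 2).mul b0)).sub
        (a1.const_mul (2 * I * k))).sub a2).congr_deriv ?_
      simp only [Nat.cast_ofNat, Nat.add_one_sub_one, pow_one, Pi.pow_apply]
      ring
    · refine ((((b0.const_mul (4 * k ^ 2)).add ((a0.const_mul 2).mul (b0.pow 2))).add
        (b1.const_mul (2 * I * k))).sub b2).congr_deriv ?_
      simp only [Nat.cast_ofNat, Nat.add_one_sub_one, pow_one, Pi.pow_apply]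
      ring
  · have := hq.cont₀
    have := hq.cont₁
    have := hq.cont₂
    have := hr.cont₀
    have := hr.cont₁
    have := hr.cont₂
    unfold laxT slCLM
    fun_prop
  · have := hq.cont₀
    have := hq.cont₁
    have := hq.cont₂
    have := hq.cont₃
    have := hr.cont₀
    have := hr.cont₁
    have := hr.cont₂
    have := hr.cont₃
    unfold slCLM
    fun_prop
  · intro x t
    refine ContinuousLinearMap.ext fun v => funext fun i => ?_
    have h1 := pq x t
    have h2 := pr x t
    fin_cases i
    · simp [laxT]
      linear_combination v 1 * h1 - 4 * v 1 * k ^ 2 * q₁ x t * I_sq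
    · simp [laxT]
      linear_combination v 0 * h2 - 4 * v 0 * k ^ 2 * r₁ x t * I_sq

theorem tendsto_laxT {α : Type*} {l : Filter α} {q q₁ q₂ r r₁ r₂ : α → ℂ}
    {a a₁ a₂ b b₁ b₂ : ℂ} (i0 : Tendsto q l (𝓝 a)) (i1 : Tendsto q₁ l (𝓝 a₁))
    (i2 : Tendsto q₂ l (𝓝 a₂)) (j0 : Tendsto r l (𝓝 b)) (j1 : Tendsto r₁ l (𝓝 b₁))
    (j2 : Tendsto r₂ l (𝓝 b₂)) (k : ℂ) :
    Tendsto (fun p => laxT k (q p) (q₁ p) (q₂ p) (r p) (r₁ p) (r₂ p)) l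
      (𝓝 (laxT k a a₁ a₂ b b₁ b₂)) := by
  have tA := (((i0.const_mul (2 * I * k)).mul j0).const_add (4 * I * k ^ 3)).add
    ((i1.mul j0).sub (i0.mul j1))
  have tB := (((i0.const_mul (4 * k ^ 2)).add (((i0.pow 2).const_mul 2).mul j0)).sub
    (i1.const_mul (2 * I * k))).sub i2
  have tC := (((j0.const_mul (4 * k ^ 2)).add ((i0.const_mul 2).mul (j0.pow 2))).add
    (j1.const_mul (2 * I * k))).sub j2
  unfold laxT
  exact tendsto_slCLM tA tB tC

theorem laxT_const (k a b : ℂ) (v : Fin 2 → ℂ) :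
    laxT k a 0 0 b 0 0 v = (4 * k ^ 2 + 2 * (a * b)) • slCLM (I * k) a b v := by
  ext i
  fin_cases i <;> simp [laxT] <;> ring

end

namespace NMKdVData

/-! ### The Jost solutions of the nonlocal problem -/

/-- The second potential `r(x, t) = σ q(-x, -t)`. -/
def r (P : NMKdVData) (x t : ℝ) : ℂ := P.σ * (P.q (-x) (-t) : ℂ)

/-- The opposite end of the line. -/
def Side.opp : Side → Side
  | .plus => .minus
  | .minus => .plus

/-- The boundary values of `r`. -/
def rbdry (P : NMKdVData) (s : Side) : ℂ := P.σ * (P.bdry s.opp : ℂ)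

/-- The constant `δσ q₀²`, the product of the boundary values of `q` and `r`; the uniformizing
variables `z` and `δσ q₀² / z` have the same `k` and opposite `λ`. -/
def csq (P : NMKdVData) : ℂ := P.δ * P.σ * (P.q₀ : ℂ) ^ 2

variable {P : NMKdVData}

theorem IsSolution.sigma_sq (hP : P.IsSolution) : (P.σ : ℂ) * P.σ = 1 := by
  rcases hP.sigma with h | h <;> simp [h]

theorem IsSolution.delta_sq (hP : P.IsSolution) : (P.δ : ℂ) * P.δ = 1 := by
  rcases hP.delta with h | h <;> simp [h]

theorem IsSolution.qm_ne' (hP : P.IsSolution) : (P.qm : ℂ) ≠ 0 := by exact_mod_cast hP.qm_ne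

theorem q₀_sq : (P.q₀ : ℂ) ^ 2 = (P.qm : ℂ) ^ 2 := by
  rw [q₀]; exact_mod_cast sq_abs P.qm

theorem csq_eq : P.csq = P.δ * P.σ * (P.qm : ℂ) ^ 2 := by rw [csq, q₀_sq]

theorem IsSolution.csq_ne (hP : P.IsSolution) : P.csq ≠ 0 := by
  have h1 := hP.sigma_sq
  have h2 := hP.delta_sq
  have h3 := hP.qm_ne'
  have h4 : (P.σ : ℂ) ≠ 0 := left_ne_zero_of_mul_eq_one h1
  have h5 : (P.δ : ℂ) ≠ 0 := left_ne_zero_of_mul_eq_one h2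
  rw [csq_eq]
  positivity

theorem bdry_mul_rbdry (s : Side) :
    (P.bdry s : ℂ) * P.rbdry s = P.csq := by
  rw [csq_eq]
  cases s <;> simp [bdry, rbdry, Side.opp] <;> ring

theorem rbdry_minus : P.rbdry .minus = P.σ * (P.δ * P.qm) := by simp [rbdry, bdry, Side.opp]

theorem qm_mul_rbdry : (P.qm : ℂ) * P.rbdry .minus = P.csq :=
  bdry_mul_rbdry .minus

theorem IsSolution.delta_sigma_bdry (hP : P.IsSolution) (s : Side) :
    (P.δ * P.σ : ℂ) * P.bdry s = P.rbdry s := by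
  have h2 := hP.delta_sq
  cases s <;> simp [bdry, rbdry, Side.opp]
  · linear_combination P.σ * P.qm * h2
  · ring

theorem lam_eq (z : ℂ) : P.lam z = coreLam P.csq z := rfl

theorem k_eq (z : ℂ) : P.k z = (z + P.csq / z) / 2 := rfl

theorem detE_eq (z : ℂ) : P.detE z = 1 - P.csq / z ^ 2 := rfl

theorem IsSolution.k_hat (hP : P.IsSolution) {z : ℂ} (hz : z ≠ 0) : P.k (P.csq / z) = P.k z := by
  have := hP.csq_ne
  rw [k_eq, k_eq]
  field_simp
  ring

theorem IsSolution.lam_hat (hP : P.IsSolution) {z : ℂ} (hz : z ≠ 0) :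
    P.lam (P.csq / z) = -P.lam z := by
  have := hP.csq_ne
  rw [lam_eq, lam_eq, coreLam, coreLam]
  field_simp
  ring

/-- The frequency: `θ = λ x + ω t`. -/
def freq (P : NMKdVData) (z : ℂ) : ℂ := P.lam z * (4 * P.k z ^ 2 + 2 * P.csq)

theorem theta_eq (x t : ℝ) (z : ℂ) : P.theta x t z = P.lam z * x + P.freq z * t := by
  rw [theta, freq, csq]; ring

theorem theta_neg (x t : ℝ) (z : ℂ) : P.theta (-x) (-t) z = -P.theta x t z := by
  rw [theta_eq, theta_eq]; push_cast; ring

theorem theta_zero (z : ℂ) : P.theta 0 0 z = 0 := by simp [theta_eq]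

theorem IsSolution.theta_hat (hP : P.IsSolution) {z : ℂ} (hz : z ≠ 0) (x t : ℝ) :
    P.theta x t (P.csq / z) = -P.theta x t z := by
  rw [theta_eq, theta_eq, freq, freq, hP.lam_hat hz, hP.k_hat hz]; ring

theorem X_mulVec (x t : ℝ) (z : ℂ) (v : Fin 2 → ℂ) :
    (P.X x t z).mulVec v = slCLM (I * P.k z) (P.q x t) (P.r x t) v := by
  ext i
  fin_cases i <;> simp [X, Q, sigma₃, r, Matrix.vecHead, Matrix.vecTail]
  ring

/-! #### The time evolution -/

/-- The operator `T` of the time evolution for the potentials `q` and `r`. -/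
def lax (P : NMKdVData) (z : ℂ) (x t : ℝ) : (Fin 2 → ℂ) →L[ℂ] (Fin 2 → ℂ) :=
  laxT (P.k z) (P.q x t) ((deriv (fun y => P.q y t) x : ℝ) : ℂ)
    ((iteratedDeriv 2 (fun y => P.q y t) x : ℝ) : ℂ) (P.r x t)
    (-(P.σ * ((deriv (fun y => P.q y (-t)) (-x) : ℝ) : ℂ)))
    (P.σ * ((iteratedDeriv 2 (fun y => P.q y (-t)) (-x) : ℝ) : ℂ))

/-- Simultaneous solutions of the two equations of the Lax pair. -/
structure IsLaxSol (P : NMKdVData) (z : ℂ) (φ : ℝ → ℝ → Fin 2 → ℂ) : Prop where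
  deriv_x : ∀ x t, HasDerivAt (fun y => φ y t) (slCLM (I * P.k z) (P.q x t) (P.r x t) (φ x t)) x
  deriv_t : ∀ x t, HasDerivAt (fun s => φ x s) (P.lax z x t (φ x t)) t

theorem IsSolution.hasJets_q (hP : P.IsSolution) :
    HasJets (fun x t => (P.q x t : ℂ)) (fun x t => ((deriv (fun y => P.q y t) x : ℝ) : ℂ))
      (fun x t => ((iteratedDeriv 2 (fun y => P.q y t) x : ℝ) : ℂ))
      (fun x t => ((iteratedDeriv 3 (fun y => P.q y t) x : ℝ) : ℂ))
      (fun x t => ((deriv (fun s => P.q x s) t : ℝ) : ℂ)) :=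
  exists_hasJets_of_contDiff hP.smooth

theorem IsSolution.hasJets_r (hP : P.IsSolution) :
    HasJets P.r (fun x t => -(P.σ * ((deriv (fun y => P.q y (-t)) (-x) : ℝ) : ℂ)))
      (fun x t => P.σ * ((iteratedDeriv 2 (fun y => P.q y (-t)) (-x) : ℝ) : ℂ))
      (fun x t => -(P.σ * ((iteratedDeriv 3 (fun y => P.q y (-t)) (-x) : ℝ) : ℂ)))
      (fun x t => -(P.σ * ((deriv (fun s => P.q (-x) s) (-t) : ℝ) : ℂ))) :=
  hP.hasJets_q.reflect P.σ

theorem IsSolution.continuous_lax (hP : P.IsSolution) (z : ℂ) (x : ℝ) :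
    Continuous fun t => P.lax z x t := by
  obtain ⟨h0, h1, h2⟩ := hP.hasJets_q.continuous_time x
  obtain ⟨g0, g1, g2⟩ := hP.hasJets_r.continuous_time x
  exact continuous_iff_continuousAt.2 fun t => tendsto_laxT (h0.tendsto t) (h1.tendsto t)
    (h2.tendsto t) (g0.tendsto t) (g1.tendsto t) (g2.tendsto t) _

theorem IsSolution.continuous_X (hP : P.IsSolution) (z : ℂ) (t : ℝ) :
    Continuous fun x => slCLM (I * P.k z) (P.q x t) (P.r x t) := by
  have hx : Continuous fun x : ℝ => (x, t) := continuous_id.prodMk continuous_const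
  have h0 : Continuous fun x => (P.q x t : ℂ) := hP.hasJets_q.cont₀.comp hx
  have g0 : Continuous fun x => P.r x t := hP.hasJets_r.cont₀.comp hx
  unfold slCLM
  fun_prop

/-- Proportionality at one point of the plane implies proportionality everywhere. -/
theorem IsLaxSol.eq_smul (hP : P.IsSolution) {z : ℂ} {φ ψ : ℝ → ℝ → Fin 2 → ℂ}
    (hφ : P.IsLaxSol z φ) (hψ : P.IsLaxSol z ψ) {a : ℂ} (h : φ 0 0 = a • ψ 0 0) (x t : ℝ) :
    φ x t = a • ψ x t := by
  have h1 : ∀ t, φ 0 t - a • ψ 0 t = 0 :=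
    eq_zero_of_hasDerivAt_linear (hP.continuous_lax z 0)
      (fun t => ((hφ.deriv_t 0 t).sub ((hψ.deriv_t 0 t).const_smul a)).congr_deriv
        (by simp only [map_sub, map_smul])) (x₀ := 0) (sub_eq_zero.2 h)
  exact sub_eq_zero.1 <| eq_zero_of_hasDerivAt_linear (hP.continuous_X z t)
    (fun x => ((hφ.deriv_x x t).sub ((hψ.deriv_x x t).const_smul a)).congr_deriv
      (by simp only [Pi.sub_apply, Pi.smul_apply, map_sub, map_smul])) (x₀ := 0) (h1 t) x

theorem tendsto_neg_atEnd (s : Side) : Tendsto (fun x : ℝ => -x) s.atEnd s.opp.atEnd := by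
  cases s
  · exact tendsto_neg_atTop_atBot
  · exact tendsto_neg_atBot_atTop

theorem tendstoLocallyUniformly_reflect {f : ℝ → ℝ → ℝ} {a : ℝ} {s : Side}
    (h : TendstoLocallyUniformly f (fun _ => a) s.opp.atEnd) (κ : ℂ) :
    TendstoLocallyUniformly (fun x t => κ * (f (-x) (-t) : ℂ)) (fun _ => κ * (a : ℂ)) s.atEnd := by
  refine tendstoLocallyUniformly_const_iff.2 fun t => ?_
  have h1 := (tendstoLocallyUniformly_const_iff.1 h (-t)).comp
    ((tendsto_neg_atEnd s).prodMap (continuous_neg.tendsto t))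
  exact ((Complex.continuous_ofReal.tendsto a).comp h1).const_mul κ

theorem tendstoLocallyUniformly_ofReal {f : ℝ → ℝ → ℝ} {a : ℝ} {l : Filter ℝ}
    (h : TendstoLocallyUniformly f (fun _ => a) l) :
    TendstoLocallyUniformly (fun x t => (f x t : ℂ)) (fun _ => (a : ℂ)) l :=
  tendstoLocallyUniformly_const_iff.2 fun t =>
    (Complex.continuous_ofReal.tendsto a).comp (tendstoLocallyUniformly_const_iff.1 h t)

theorem IsSolution.tendsto_lax (hP : P.IsSolution) (z : ℂ) (s : Side) :
    TendstoLocallyUniformly (P.lax z) (fun _ => laxT (P.k z) (P.bdry s) 0 0 (P.rbdry s) 0 0)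
      s.atEnd := by
  have g1 := tendstoLocallyUniformly_reflect (s := s) (hP.lim_x s.opp) (-P.σ)
  have g2 := tendstoLocallyUniformly_reflect (s := s) (hP.lim_xx s.opp) P.σ
  have h1 := tendstoLocallyUniformly_ofReal (hP.lim_x s)
  have h2 := tendstoLocallyUniformly_ofReal (hP.lim_xx s)
  simp only [Complex.ofReal_zero, mul_zero, neg_mul] at g1 g2 h1 h2
  have h0 := tendstoLocallyUniformly_ofReal (hP.lim s)
  have g0 := tendstoLocallyUniformly_reflect (s := s) (hP.lim s.opp) P.σ
  exact tendstoLocallyUniformly_const_iff.2 fun t =>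
    tendsto_laxT (tendstoLocallyUniformly_const_iff.1 h0 t)
      (tendstoLocallyUniformly_const_iff.1 h1 t) (tendstoLocallyUniformly_const_iff.1 h2 t)
      (tendstoLocallyUniformly_const_iff.1 g0 t) (tendstoLocallyUniformly_const_iff.1 g1 t)
      (tendstoLocallyUniformly_const_iff.1 g2 t) _

theorem IsSolution.lax_limit_E (hP : P.IsSolution) {z : ℂ} (hz : z ≠ 0) (s : Side) (j : Fin 2) :
    laxT (P.k z) (P.bdry s) 0 0 (P.rbdry s) 0 0 (fun i => P.E s z i j) =
      (I * P.freq z * sigma₃ j j) • fun i => P.E s z i j := by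
  have h1 := bdry_mul_rbdry (P := P) s
  have h2 := hP.delta_sigma_bdry s
  have h3 : P.lam z + P.k z = z := by rw [lam_eq, k_eq, coreLam]; ring
  have h4 : P.k z = P.lam z + P.csq * z⁻¹ := by rw [lam_eq, k_eq, coreLam]; ring
  have h5 : z * z⁻¹ = 1 := mul_inv_cancel₀ hz
  rw [laxT_const, h1, freq]
  ext i
  fin_cases i <;> fin_cases j <;> simp [E, sigma₃, div_eq_mul_inv]
  · linear_combination (4 * P.k z ^ 2 + 2 * P.csq) * (I * h4 - I * z⁻¹ * h1 -
      I * P.bdry s * z⁻¹ * h2)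
  · linear_combination (4 * P.k z ^ 2 + 2 * P.csq) * P.bdry s *
      (z⁻¹ * I ^ 2 * h3 + I ^ 2 * h5 + I_sq)
  · rw [show (P.δ * P.σ * (I * P.bdry s * z⁻¹) : ℂ) = P.rbdry s * I * z⁻¹ by rw [← h2]; ring]
    linear_combination (4 * P.k z ^ 2 + 2 * P.csq) * P.rbdry s *
      (z⁻¹ * I ^ 2 * h3 + I ^ 2 * h5 + I_sq)
  · linear_combination (4 * P.k z ^ 2 + 2 * P.csq) * (-I * h4 + I * z⁻¹ * h1)

/-- A Jost column that is determined by its defining properties at all times solves both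
equations of the Lax pair. -/
theorem IsSolution.isLaxSol_jost (hP : P.IsSolution) {s : Side} {j : Fin 2} {z : ℂ} (hz : z ≠ 0)
    (h : ∀ t, ∃! φ, P.IsJostColumn s j t z φ) : P.IsLaxSol z fun x t => P.jost s j x t z := by
  have hj : ∀ t, P.IsJostColumn s j t z fun x => P.jost s j x t z := fun t =>
    Classical.epsilon_spec (h t).exists
  choose φ hφ0 hφ using fun x => exists_hasDerivAt_linear (hP.continuous_lax z x) (P.jost s j x 0 z)
  have hx : ∀ x t, HasDerivAt (fun y => φ y t)
      (slCLM (I * P.k z) (P.q x t) (P.r x t) (φ x t)) x := by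
    refine HasJets.hasDerivAt_of_evolution hP.hasJets_q hP.hasJets_r (fun x t => ?_)
      (fun x t => ?_) (P.k z) hφ (fun x => ?_)
    · have := hP.pde x t
      have h2 : ((deriv (fun s => P.q x s) t - 6 * P.σ * P.q (-x) (-t) * P.q x t *
        deriv (fun y => P.q y t) x + iteratedDeriv 3 (fun y => P.q y t) x : ℝ) : ℂ) = 0 := by
        rw [this]; simp
      push_cast at h2
      rw [r]
      linear_combination h2
    · have := hP.pde (-x) (-t)
      rw [neg_neg, neg_neg] at this
      have h2 : ((deriv (fun s => P.q (-x) s) (-t) - 6 * P.σ * P.q x t * P.q (-x) (-t) *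
        deriv (fun y => P.q y (-t)) (-x) + iteratedDeriv 3 (fun y => P.q y (-t)) (-x) : ℝ) : ℂ)
          = 0 := by
        rw [this]; simp
      push_cast at h2
      rw [r]
      linear_combination -P.σ * h2
    · simp only [hφ0, ← X_mulVec]
      exact (hj 0).1 x
  have hlim : ∀ t, P.IsJostColumn s j t z fun x => φ x t := by
    intro t
    refine ⟨fun x => ?_, ?_⟩
    · rw [X_mulVec]
      exact hx x t
    · have h0 := (hj 0).2
      simp only [← hφ0] at h0
      have := tendsto_of_evolution (hP.tendsto_lax z s) (hP.lax_limit_E hz s j) hφ h0 t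
      refine this.congr fun x => ?_
      rw [theta_eq, theta_eq]
      congr 2
      push_cast
      ring
  have heq : ∀ x t, P.jost s j x t z = φ x t := fun x t =>
    congrFun ((h t).unique (hj t) (hlim t)) x
  refine ⟨fun x t => ?_, fun x t => ?_⟩
  · simp only [heq]
    exact hx x t
  · simp only [heq]
    exact hφ x t

/-! #### Reduction of the Jost columns to the first column at `-∞` -/

theorem IsJostColumn.comp0 {s : Side} {j : Fin 2} {t : ℝ} {z : ℂ} {φ : ℝ → Fin 2 → ℂ}
    (h : P.IsJostColumn s j t z φ) (x : ℝ) :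
    HasDerivAt (fun y => φ y 0) (I * P.k z * φ x 0 + P.q x t * φ x 1) x := by
  have := hasDerivAt_pi.1 (h.1 x) 0
  rwa [X_mulVec, slCLM_apply_zero] at this

theorem IsJostColumn.comp1 {s : Side} {j : Fin 2} {t : ℝ} {z : ℂ} {φ : ℝ → Fin 2 → ℂ}
    (h : P.IsJostColumn s j t z φ) (x : ℝ) :
    HasDerivAt (fun y => φ y 1) (P.r x t * φ x 0 - I * P.k z * φ x 1) x := by
  have := hasDerivAt_pi.1 (h.1 x) 1
  rwa [X_mulVec, slCLM_apply_one] at this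

theorem isJostColumn_of_comp {s : Side} {j : Fin 2} {t : ℝ} {z : ℂ} {φ : ℝ → Fin 2 → ℂ}
    (h0 : ∀ x, HasDerivAt (fun y => φ y 0) (I * P.k z * φ x 0 + P.q x t * φ x 1) x)
    (h1 : ∀ x, HasDerivAt (fun y => φ y 1) (P.r x t * φ x 0 - I * P.k z * φ x 1) x)
    (h : Tendsto (fun x => cexp (-(I * P.theta x t z * sigma₃ j j)) • φ x) s.atEnd
      (𝓝 fun i => P.E s z i j)) : P.IsJostColumn s j t z φ := by
  refine ⟨fun x => hasDerivAt_pi.2 fun i => ?_, h⟩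
  rw [X_mulVec]
  fin_cases i
  · exact (h0 x).congr_deriv (slCLM_apply_zero _ _ _ _).symm
  · exact (h1 x).congr_deriv (slCLM_apply_one _ _ _ _).symm

theorem hasDerivAt_cexp_mul (a b : ℂ) (x : ℝ) :
    HasDerivAt (fun y : ℝ => cexp (a * y + b)) (a * cexp (a * x + b)) x := by
  have := (((hasDerivAt_id (x : ℂ)).const_mul a).add_const b).cexp.comp_ofReal
  simpa [mul_comm] using this

/-- Division by the plane wave turns the first Jost column at `-∞` into a solution of the
normalized problem, and conversely. -/
theorem isJostColumn_minus_zero_iff {t : ℝ} {z : ℂ} {m : ℝ → Fin 2 → ℂ}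
    (hP : P.IsSolution) :
    P.IsJostColumn .minus 0 t z (fun x => cexp (I * P.theta x t z) • m x) ↔
      IsCoreSol (fun x => (P.q x t : ℂ)) (fun x => P.r x t) P.qm (P.rbdry .minus) z m := by
  have e0 : ∀ x : ℝ, cexp (I * P.theta x t z) = cexp (I * P.lam z * x + I * (P.freq z * t)) :=
    fun x => by rw [theta_eq]; ring_nf
  have e1 : ∀ x : ℝ, cexp (-(I * P.theta x t z)) =
      cexp (-(I * P.lam z) * x + -(I * (P.freq z * t))) := fun x => by rw [theta_eq]; ring_nf
  have h3 : P.lam z + P.k z = z := by rw [lam_eq, k_eq, coreLam]; ring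
  have h4 : P.k z = P.lam z + P.csq / z := by rw [lam_eq, k_eq, coreLam]; ring
  have hcancel : ∀ x : ℝ, cexp (-(I * P.theta x t z)) * cexp (I * P.theta x t z) = 1 := fun x => by
    rw [← Complex.exp_add, neg_add_cancel, Complex.exp_zero]
  have hE : (fun i => P.E .minus z i 0) = coreE (P.rbdry .minus) z := by
    have := hP.delta_sigma_bdry .minus
    ext i
    fin_cases i <;> simp [E, coreE, ← this]
    ring
  have hlim : (fun x => cexp (-(I * P.theta x t z * sigma₃ 0 0)) • cexp (I * P.theta x t z) • m x)
      = m := by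
    funext x
    rw [show sigma₃ 0 0 = 1 from rfl, mul_one, smul_smul, hcancel, one_smul]
  constructor
  · intro h
    have hm : ∀ i, (fun x => m x i) = fun x => cexp (-(I * P.theta x t z)) *
        (cexp (I * P.theta x t z) • m x) i := fun i => funext fun x => by
      rw [Pi.smul_apply, smul_eq_mul, ← mul_assoc, hcancel, one_mul]
    refine ⟨fun x => ?_, fun x => ?_, ?_⟩
    · rw [hm 0]
      have := (hasDerivAt_cexp_mul (-(I * P.lam z)) (-(I * (P.freq z * t))) x).mul (h.comp0 x)
      simp only [← e1] at this
      refine this.congr_deriv ?_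
      simp only [Pi.smul_apply, smul_eq_mul]
      rw [qm_mul_rbdry]
      linear_combination (I * m x 0 * (P.k z - P.lam z) + P.q x t * m x 1) * hcancel x
        + I * m x 0 * h4
    · rw [hm 1]
      have := (hasDerivAt_cexp_mul (-(I * P.lam z)) (-(I * (P.freq z * t))) x).mul (h.comp1 x)
      simp only [← e1] at this
      refine this.congr_deriv ?_
      simp only [Pi.smul_apply, smul_eq_mul]
      linear_combination (-I * m x 1 * (P.k z + P.lam z) + P.r x t * m x 0) * hcancel x
        - I * m x 1 * h3
    · have := h.2
      rwa [hlim, hE] at this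
  · intro h
    refine isJostColumn_of_comp (fun x => ?_) (fun x => ?_) ?_
    · have := (hasDerivAt_cexp_mul (I * P.lam z) (I * (P.freq z * t)) x).mul (h.deriv0 x)
      simp only [← e0] at this
      refine this.congr_deriv ?_
      simp only [Pi.smul_apply, smul_eq_mul]
      rw [qm_mul_rbdry]
      linear_combination -I * cexp (I * P.theta x t z) * m x 0 * h4
    · have := (hasDerivAt_cexp_mul (I * P.lam z) (I * (P.freq z * t)) x).mul (h.deriv1 x)
      simp only [← e0] at this
      refine this.congr_deriv ?_
      simp only [Pi.smul_apply, smul_eq_mul]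
      linear_combination I * cexp (I * P.theta x t z) * m x 1 * h3
    · rw [hlim, hE]
      exact h.lim

/-- The symmetry `z ↦ δσ q₀² / z` exchanges the two columns at one end of the line. -/
theorem IsJostColumn.hat (hP : P.IsSolution) {s : Side} {j j' : Fin 2} {t : ℝ} {z κ : ℂ}
    (hz : z ≠ 0) {φ : ℝ → Fin 2 → ℂ} (h : P.IsJostColumn s j t z φ)
    (hσ : sigma₃ j' j' = -sigma₃ j j) (hE : ∀ i, P.E s (P.csq / z) i j' = κ * P.E s z i j) :
    P.IsJostColumn s j' t (P.csq / z) fun x => κ • φ x := by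
  refine isJostColumn_of_comp (fun x => ?_) (fun x => ?_) ?_
  · rw [hP.k_hat hz]
    refine ((h.comp0 x).const_mul κ).congr_deriv ?_
    simp only [Pi.smul_apply, smul_eq_mul]
    ring
  · rw [hP.k_hat hz]
    refine ((h.comp1 x).const_mul κ).congr_deriv ?_
    simp only [Pi.smul_apply, smul_eq_mul]
    ring
  · have h1 := h.2.const_smul κ
    have h2 : (κ • fun i => P.E s z i j) = fun i => P.E s (P.csq / z) i j' :=
      funext fun i => (hE i).symm
    rw [h2] at h1
    refine h1.congr fun x => ?_
    rw [hP.theta_hat hz, hσ, smul_comm]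
    congr 3
    ring

/-- The reflection `(x, t) ↦ (-x, -t)`, together with the rotation `v ↦ (v₁, -σ v₀)`, exchanges the
two ends of the line, and the two columns. -/
theorem IsJostColumn.reflect {s : Side} {j j' : Fin 2} {t : ℝ} {z κ : ℂ}
    {φ : ℝ → Fin 2 → ℂ} (h : P.IsJostColumn s j t z φ)
    (hσ : sigma₃ j' j' = -sigma₃ j j) (hE0 : P.E s.opp z 0 j' = κ * P.E s z 1 j)
    (hE1 : P.E s.opp z 1 j' = -(κ * P.σ * P.E s z 0 j)) :
    P.IsJostColumn s.opp j' (-t) z fun x => ![κ * φ (-x) 1, -(κ * P.σ * φ (-x) 0)] := by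
  have hd : ∀ {f : ℝ → ℂ} {f' : ℂ} {x : ℝ}, HasDerivAt f f' (-x) →
      HasDerivAt (fun y => f (-y)) (-f') x := fun {f f' x} hf =>
    (hf.scomp x (hasDerivAt_neg x)).congr_deriv (by simp)
  refine isJostColumn_of_comp (fun x => ?_) (fun x => ?_) ?_
  · refine ((hd (h.comp1 (-x))).const_mul κ).congr_deriv ?_
    simp only [Matrix.cons_val_zero, Matrix.cons_val_one, Matrix.cons_val_fin_one, r, neg_neg]
    ring
  · refine ((hd (h.comp0 (-x))).const_mul (κ * P.σ)).neg.congr_deriv ?_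
    simp only [Matrix.cons_val_zero, Matrix.cons_val_one, Matrix.cons_val_fin_one, r, neg_neg]
    ring
  · have hend : Tendsto (fun x : ℝ => -x) s.opp.atEnd s.atEnd := by
      have := tendsto_neg_atEnd s.opp
      cases s <;> exact this
    have h1 := h.2.comp hend
    have h10 := ((tendsto_pi_nhds.1 h1) 1).const_mul κ
    have h11 := (((tendsto_pi_nhds.1 h1) 0).const_mul (κ * P.σ)).neg
    have he : ∀ x : ℝ, P.theta x (-t) z = -P.theta (-x) t z := fun x => by
      rw [← theta_neg, neg_neg]
    refine tendsto_pi_nhds.2 fun i => ?_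
    fin_cases i
    · simp only [Fin.zero_eta, hE0]
      refine h10.congr fun x => ?_
      simp only [Function.comp_apply, Pi.smul_apply, smul_eq_mul, he, hσ, Matrix.cons_val_zero,
        mul_neg, neg_mul, neg_neg]
      ring
    · simp only [Fin.mk_one, hE1]
      refine h11.congr fun x => ?_
      simp only [Function.comp_apply, Pi.smul_apply, smul_eq_mul, he, hσ, Matrix.cons_val_one,
        Matrix.cons_val_fin_one, mul_neg, neg_mul, neg_neg]
      ring

/-- The first Jost column at `-∞`, with the plane wave divided out. -/
def m (P : NMKdVData) (x t : ℝ) (z : ℂ) : Fin 2 → ℂ :=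
  coreSol (fun x => (P.q x t : ℂ)) (fun x => P.r x t) P.qm (P.rbdry .minus) z x

/-- The part `Im λ(z) ≤ 0` of the plane, where the first column at `-∞` exists. -/
def lowerDom (P : NMKdVData) : Set ℂ := coreDom P.csq

theorem IsSolution.isCorePot (hP : P.IsSolution) (t : ℝ) :
    IsCorePot (fun x => (P.q x t : ℂ)) (fun x => P.r x t) P.qm (P.rbdry .minus) := by
  have hσ : ‖(P.σ : ℂ)‖ = 1 := by rcases hP.sigma with h | h <;> simp [h]
  have hq : ∀ s, ContDiff ℝ 1 fun x => P.q x s := fun s =>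
    (hP.smooth.comp (contDiff_id.prodMk contDiff_const)).of_le (by norm_num)
  have hqc : ContDiff ℝ 1 fun x => (P.q x t : ℂ) := Complex.ofRealCLM.contDiff.comp (hq t)
  have hrc : ContDiff ℝ 1 fun x => P.r x t :=
    contDiff_const.mul (Complex.ofRealCLM.contDiff.comp ((hq (-t)).comp contDiff_neg))
  have extend : ∀ f : ℝ → ℝ, Continuous f → IntegrableOn f (Set.Iio 0) →
      ∀ x, IntegrableOn f (Set.Iic x) := by
    intro f hf hi x
    have h1 : IntegrableOn f (Set.Icc 0 x) := hf.continuousOn.integrableOn_compact isCompact_Icc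
    refine (hi.union h1).mono_set fun y hy => ?_
    rcases lt_or_ge y 0 with h | h
    · exact Or.inl h
    · exact Or.inr ⟨h, hy⟩
  refine ⟨hqc, hrc, ?_, ?_⟩
  · refine extend _ ?_ ?_
    · have := hqc.continuous
      fun_prop
    · refine (hP.integrable_minus t).norm.congr (Eventually.of_forall fun x => ?_)
      have h1 : 0 ≤ 1 + |x| := by positivity
      simp only [norm_mul, Real.norm_of_nonneg h1, bdry]
      rw [← Complex.ofReal_sub, Complex.norm_real]
  · refine extend _ ?_ ?_
    · have := hrc.continuous
      fun_prop
    · have h1 := ((Measure.measurePreserving_neg (volume : Measure ℝ)).integrableOn_comp_preimage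
        (Homeomorph.neg ℝ).measurableEmbedding).2 (hP.integrable_plus (-t)).norm
      simp only [Set.neg_preimage, Set.neg_Ioi, neg_zero] at h1
      refine IntegrableOn.congr_fun (f := fun x : ℝ =>
        ‖(1 + |(-x)|) * (P.q (-x) (-t) - P.bdry .plus)‖) ?_ (fun x _ => ?_) measurableSet_Iio
      · exact h1
      have h2 : 0 ≤ 1 + |x| := by positivity
      simp only [norm_mul, Real.norm_of_nonneg h2, abs_neg]
      rw [r, rbdry, ← mul_sub, norm_mul, hσ, one_mul, ← Complex.ofReal_sub, Complex.norm_real]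
      rfl

theorem IsSolution.hat_hat (hP : P.IsSolution) {z : ℂ} (hz : z ≠ 0) :
    P.csq / (P.csq / z) = z := by
  have := hP.csq_ne
  field_simp

theorem existsUnique_transfer {α β : Type*} {p : α → Prop} {q : β → Prop} (F : α → β) (G : β → α)
    (hF : ∀ a, p a → q (F a)) (hG : ∀ b, q b → p (G b)) (hGF : ∀ a, G (F a) = a)
    (h : ∃! b, q b) : ∃! a, p a := by
  obtain ⟨b, hb, hu⟩ := h
  exact ⟨G b, hG b hb, fun a ha => by rw [← hGF a, hu _ (hF a ha)]⟩

theorem IsSolution.isJostColumn_m (hP : P.IsSolution) (t : ℝ) {z : ℂ} (hz : z ∈ P.lowerDom) :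
    P.IsJostColumn .minus 0 t z fun x => cexp (I * P.theta x t z) • P.m x t z := by
  refine (isJostColumn_minus_zero_iff hP).2 ((hP.isCorePot t).isCoreSol ?_)
  rw [qm_mul_rbdry]
  exact hz

theorem IsSolution.existsUnique_minus_zero (hP : P.IsSolution) (t : ℝ) {z : ℂ}
    (hz : z ∈ P.lowerDom) : ∃! φ, P.IsJostColumn .minus 0 t z φ := by
  refine ⟨_, hP.isJostColumn_m t hz, fun φ hφ => ?_⟩
  set μ : ℝ → Fin 2 → ℂ := fun x => cexp (-(I * P.theta x t z)) • φ x with hμ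
  have h1 : φ = fun x => cexp (I * P.theta x t z) • μ x := by
    funext x
    rw [hμ, smul_smul, ← Complex.exp_add, add_neg_cancel, Complex.exp_zero, one_smul]
  rw [h1] at hφ ⊢
  have hz' : z ∈ coreDom (P.qm * P.rbdry .minus) := by rw [qm_mul_rbdry]; exact hz
  rw [IsCoreSol.unique (hP.isCorePot t) hz' ((isJostColumn_minus_zero_iff hP).1 hφ)
    ((hP.isCorePot t).isCoreSol hz')]
  rfl

theorem jost_eq {s : Side} {j : Fin 2} {t : ℝ} {z : ℂ} (h : ∃! φ, P.IsJostColumn s j t z φ)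
    {φ : ℝ → Fin 2 → ℂ} (hφ : P.IsJostColumn s j t z φ) (x : ℝ) : P.jost s j x t z = φ x :=
  congrFun (h.unique (Classical.epsilon_spec h.exists) hφ) x

theorem sigma₃_one_one : sigma₃ 1 1 = -1 := rfl

theorem sigma₃_zero_zero : sigma₃ 0 0 = 1 := rfl

theorem E_zero_zero (s : Side) (z : ℂ) : P.E s z 0 0 = 1 := rfl

theorem E_zero_one (s : Side) (z : ℂ) : P.E s z 0 1 = I * P.bdry s / z := rfl

theorem IsSolution.E_one_zero (hP : P.IsSolution) (s : Side) (z : ℂ) :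
    P.E s z 1 0 = -(I * P.rbdry s / z) := by
  rw [← hP.delta_sigma_bdry s]; simp [E]; ring

theorem E_one_one (s : Side) (z : ℂ) : P.E s z 1 1 = 1 := rfl

theorem IsSolution.isJostColumn_minus_one (hP : P.IsSolution) {t : ℝ} {z : ℂ} (hz : z ≠ 0)
    {ψ : ℝ → Fin 2 → ℂ} (h : P.IsJostColumn .minus 0 t (P.csq / z) ψ) :
    P.IsJostColumn .minus 1 t z fun x => (I * P.qm / z) • ψ x := by
  have hc := hP.csq_ne
  have := h.hat hP (j' := 1) (κ := I * P.qm / z) (div_ne_zero hc hz) rfl (fun i => ?_)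
  · rwa [hP.hat_hat hz] at this
  · rw [hP.hat_hat hz]
    fin_cases i
    · simp [E_zero_zero, E_zero_one, bdry]
    · simp only [Fin.mk_one, hP.E_one_zero, E_one_one]
      have := qm_mul_rbdry (P := P)
      field_simp
      linear_combination P.csq * I_sq + I ^ 2 * this

theorem IsSolution.existsUnique_minus_one (hP : P.IsSolution) (t : ℝ) {z : ℂ} (hz : z ≠ 0)
    (hz' : P.csq / z ∈ P.lowerDom) : ∃! φ, P.IsJostColumn .minus 1 t z φ := by
  have hc := hP.csq_ne
  have hq := hP.qm_ne'
  refine existsUnique_transfer (fun φ x => (z / (I * P.qm)) • φ x) (fun ψ x => (I * P.qm / z) • ψ x)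
    (fun φ hφ => ?_) (fun ψ hψ => hP.isJostColumn_minus_one hz hψ) (fun φ => ?_)
    (hP.existsUnique_minus_zero t hz')
  · refine hφ.hat hP (j' := 0) hz (by rw [sigma₃_one_one, neg_neg]; rfl) fun i => ?_
    fin_cases i
    · simp only [Fin.zero_eta, E_zero_zero, E_zero_one, bdry]
      have := I_ne_zero
      field_simp
    · simp only [Fin.mk_one, hP.E_one_zero, E_one_one]
      have := qm_mul_rbdry (P := P)
      have := I_ne_zero
      field_simp
      linear_combination -P.csq * I_sq - I ^ 2 * qm_mul_rbdry (P := P)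
  · funext x
    rw [smul_smul]
    have : I * P.qm / z * (z / (I * P.qm)) = 1 := by
      have := I_ne_zero
      field_simp
    rw [this, one_smul]

theorem IsSolution.isJostColumn_plus_one (hP : P.IsSolution) {t : ℝ} {z : ℂ}
    {ψ : ℝ → Fin 2 → ℂ} (h : P.IsJostColumn .minus 0 (-t) z ψ) :
    P.IsJostColumn .plus 1 t z fun x => ![-P.σ * ψ (-x) 1, ψ (-x) 0] := by
  have hs := hP.sigma_sq
  have := h.reflect (j' := 1) (κ := -P.σ) rfl ?_ ?_
  · rw [neg_neg] at this
    simpa [Side.opp, ← mul_assoc, hs] using this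
  · rw [hP.E_one_zero, E_zero_one, rbdry_minus]
    simp only [Side.opp, bdry]
    push_cast
    linear_combination -(I * P.δ * P.qm / z) * hs
  · rw [E_zero_zero, E_one_one]
    linear_combination -hs

theorem IsSolution.existsUnique_plus_one (hP : P.IsSolution) (t : ℝ) {z : ℂ}
    (hz : z ∈ P.lowerDom) : ∃! φ, P.IsJostColumn .plus 1 t z φ := by
  have hs := hP.sigma_sq
  refine existsUnique_transfer (fun φ x => ![φ (-x) 1, -(P.σ * φ (-x) 0)])
    (fun ψ x => ![-P.σ * ψ (-x) 1, ψ (-x) 0]) (fun φ hφ => ?_)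
    (fun ψ hψ => hP.isJostColumn_plus_one hψ) (fun φ => ?_) (hP.existsUnique_minus_zero (-t) hz)
  · have := hφ.reflect (j' := 0) (κ := 1)
      (by rw [sigma₃_one_one, neg_neg]; rfl) ?_ ?_
    · simpa [Side.opp] using this
    · simp [E_zero_zero, E_one_one]
    · simp only [Side.opp]
      rw [hP.E_one_zero, E_zero_one, rbdry_minus]
      simp only [bdry]
      push_cast
      ring
  · funext x i
    fin_cases i
    · simp [← mul_assoc, hs]
    · simp

theorem IsSolution.isJostColumn_plus_zero (hP : P.IsSolution) {t : ℝ} {z : ℂ}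
    {ψ : ℝ → Fin 2 → ℂ} (h : P.IsJostColumn .minus 1 (-t) z ψ) :
    P.IsJostColumn .plus 0 t z fun x => ![ψ (-x) 1, -(P.σ * ψ (-x) 0)] := by
  have := h.reflect (j' := 0) (κ := 1) (by rw [sigma₃_one_one, neg_neg]; rfl) ?_ ?_
  · rw [neg_neg] at this
    simpa [Side.opp] using this
  · simp [E_zero_zero, E_one_one]
  · simp only [Side.opp]
    rw [hP.E_one_zero, E_zero_one, rbdry]
    simp only [bdry, Side.opp]
    ring

theorem IsSolution.existsUnique_plus_zero (hP : P.IsSolution) (t : ℝ) {z : ℂ} (hz : z ≠ 0)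
    (hz' : P.csq / z ∈ P.lowerDom) : ∃! φ, P.IsJostColumn .plus 0 t z φ := by
  have hs := hP.sigma_sq
  refine existsUnique_transfer (fun φ x => ![-P.σ * φ (-x) 1, φ (-x) 0])
    (fun ψ x => ![ψ (-x) 1, -(P.σ * ψ (-x) 0)]) (fun φ hφ => ?_)
    (fun ψ hψ => hP.isJostColumn_plus_zero hψ) (fun φ => ?_)
    (hP.existsUnique_minus_one (-t) hz hz')
  · have := hφ.reflect (j' := 1) (κ := -P.σ) rfl ?_ ?_
    · simpa [Side.opp, ← mul_assoc, hs] using this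
    · simp only [Side.opp]
      rw [hP.E_one_zero, E_zero_one, rbdry]
      simp only [bdry, Side.opp]
      linear_combination -(I * P.qm / z) * hs
    · rw [E_zero_zero, E_one_one]
      linear_combination -hs
  · funext x i
    fin_cases i
    · simp
    · simp [← mul_assoc, hs]

/-! #### The Jost columns and the scattering coefficients in terms of `m` -/

theorem IsSolution.jost_minus_zero (hP : P.IsSolution) (x t : ℝ) {z : ℂ} (hz : z ∈ P.lowerDom) :
    P.jost .minus 0 x t z = cexp (I * P.theta x t z) • P.m x t z :=
  jost_eq (hP.existsUnique_minus_zero t hz) (hP.isJostColumn_m t hz) x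

theorem IsSolution.jost_minus_one (hP : P.IsSolution) (x t : ℝ) {z : ℂ} (hz : z ≠ 0)
    (hz' : P.csq / z ∈ P.lowerDom) :
    P.jost .minus 1 x t z = (I * P.qm / z) • cexp (-(I * P.theta x t z)) • P.m x t (P.csq / z) := by
  rw [jost_eq (hP.existsUnique_minus_one t hz hz')
    (hP.isJostColumn_minus_one hz (hP.isJostColumn_m t hz')) x, hP.theta_hat hz, mul_neg]

theorem IsSolution.jost_plus_one (hP : P.IsSolution) (x t : ℝ) {z : ℂ} (hz : z ∈ P.lowerDom) :
    P.jost .plus 1 x t z = cexp (-(I * P.theta x t z)) •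
      ![-P.σ * P.m (-x) (-t) z 1, P.m (-x) (-t) z 0] := by
  rw [jost_eq (hP.existsUnique_plus_one t hz)
    (hP.isJostColumn_plus_one (hP.isJostColumn_m (-t) hz)) x, theta_neg, mul_neg]
  ext i
  fin_cases i
  · simp
    ring
  · simp

theorem IsSolution.jost_plus_zero (hP : P.IsSolution) (x t : ℝ) {z : ℂ} (hz : z ≠ 0)
    (hz' : P.csq / z ∈ P.lowerDom) :
    P.jost .plus 0 x t z =
      ![P.jost .minus 1 (-x) (-t) z 1, -(P.σ * P.jost .minus 1 (-x) (-t) z 0)] :=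
  jost_eq (hP.existsUnique_plus_zero t hz hz') (hP.isJostColumn_plus_zero
    (Classical.epsilon_spec (hP.existsUnique_minus_one (-t) hz hz').exists)) x

theorem IsSolution.s₂₂_eq (hP : P.IsSolution) {z : ℂ} (hz : z ∈ P.lowerDom) :
    P.s₂₂ z = (P.m 0 0 z 0 ^ 2 + P.σ * P.m 0 0 z 1 ^ 2) / P.detE z := by
  rw [s₂₂, hP.jost_minus_zero 0 0 hz, hP.jost_plus_one 0 0 hz, theta_zero]
  simp [Wr]
  ring

theorem IsSolution.s₁₁_eq (hP : P.IsSolution) {z : ℂ} (hz : z ≠ 0)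
    (hz' : P.csq / z ∈ P.lowerDom) : P.s₁₁ z = P.δ * P.s₂₂ (P.csq / z) := by
  have hs := hP.sigma_sq
  have hd := hP.delta_sq
  have hc := hP.csq_ne
  rw [hP.s₂₂_eq hz', s₁₁, hP.jost_plus_zero 0 0 hz hz', neg_zero,
    hP.jost_minus_one 0 0 hz hz', theta_zero]
  set u := P.m 0 0 (P.csq / z) with hu
  have e1 : Wr ![((I * P.qm / z) • cexp (-(I * 0)) • u) 1,
      -(P.σ * ((I * P.qm / z) • cexp (-(I * 0)) • u) 0)] ((I * P.qm / z) • cexp (-(I * 0)) • u) =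
      (I * P.qm / z) ^ 2 * P.σ * (u 0 ^ 2 + P.σ * u 1 ^ 2) := by
    simp [Wr]
    linear_combination -(I * P.qm / z) ^ 2 * u 1 ^ 2 * hs
  have e2 : P.detE (P.csq / z) = -(z ^ 2 / P.csq) * P.detE z := by
    rw [detE_eq, detE_eq]
    field_simp
    ring
  rw [e1, e2]
  rcases eq_or_ne (P.detE z) 0 with h | h
  · rw [h]; simp
  · have := csq_eq (P := P)
    field_simp
    rw [this]
    linear_combination (P.qm : ℂ) ^ 2 * P.σ * (u 0 ^ 2 + P.σ * u 1 ^ 2) * (I_sq + hd)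

/-! ### The spectral plane -/

theorem IsSolution.csq_real (hP : P.IsSolution) :
    (P.δ * P.σ = 1 ∧ P.csq = ((P.q₀ ^ 2 : ℝ) : ℂ)) ∨
      (P.δ * P.σ = -1 ∧ P.csq = ((-P.q₀ ^ 2 : ℝ) : ℂ)) := by
  have h : P.csq = ((P.δ * P.σ * P.q₀ ^ 2 : ℝ) : ℂ) := by rw [csq]; push_cast; ring
  rcases hP.sigma with hs | hs <;> rcases hP.delta with hd | hd <;> rw [h, hs, hd] <;> norm_num

theorem IsSolution.q₀_pos (hP : P.IsSolution) : 0 < P.q₀ := abs_pos.2 hP.qm_ne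

theorem conj_csq : (starRingEnd ℂ) P.csq = P.csq := by simp [csq]

theorem im_lam {z : ℂ} (hz : z ≠ 0) :
    (P.lam z).im = z.im * (‖z‖ ^ 2 + P.csq.re) / (2 * ‖z‖ ^ 2) := by
  have h1 : P.csq.im = 0 := Complex.conj_eq_iff_im.1 conj_csq
  have h2 : normSq z ≠ 0 := by simpa using hz
  rw [lam_eq, coreLam, ← Complex.normSq_eq_norm_sq]
  simp [Complex.div_im, h1]
  field_simp

theorem IsSolution.mem_Dplus_iff (hP : P.IsSolution) {z : ℂ} :
    z ∈ P.Dplus ↔ 0 < (P.lam z).im := by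
  rcases eq_or_ne z 0 with rfl | hz
  · simp [Dplus, lam]
  have hn : 0 < ‖z‖ := norm_pos_iff.2 hz
  have hq := hP.q₀_pos
  rw [im_lam hz, div_pos_iff_of_pos_right (by positivity)]
  rcases hP.csq_real with ⟨h, hc⟩ | ⟨h, hc⟩
  · have h1 : 0 < ‖z‖ ^ 2 + P.csq.re := by rw [hc, Complex.ofReal_re]; positivity
    have h2 : ¬ P.δ * P.σ = -1 := by rw [h]; norm_num
    rw [mul_pos_iff_of_pos_right h1]
    change (_ ∧ _ ∨ _ ∧ _) ↔ _
    simp only [iff_false_intro h2, false_and, or_false, iff_true_intro h, true_and]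
  · have h2 : ¬ P.δ * P.σ = 1 := by rw [h]; norm_num
    have h3 : z.im * (‖z‖ ^ 2 + P.csq.re) = ((‖z‖ - P.q₀) * z.im) * (‖z‖ + P.q₀) := by
      rw [hc, Complex.ofReal_re]; ring
    rw [h3, mul_pos_iff_of_pos_right (add_pos hn hq)]
    change (_ ∧ _ ∨ _ ∧ _) ↔ _
    simp only [iff_false_intro h2, false_and, false_or, iff_true_intro h, true_and]

theorem IsSolution.mem_Sig_iff (hP : P.IsSolution) {z : ℂ} :
    z ∈ P.Sig ↔ z ≠ 0 ∧ (P.lam z).im = 0 := by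
  rcases eq_or_ne z 0 with rfl | hz
  · simp [Sig, hP.q₀_pos.ne]
  have hq := hP.q₀_pos
  rw [im_lam hz, div_eq_zero_iff, mul_eq_zero]
  have h4 : 2 * ‖z‖ ^ 2 ≠ 0 := by positivity
  rcases hP.csq_real with ⟨h, hc⟩ | ⟨h, hc⟩
  · have h1 : ‖z‖ ^ 2 + P.csq.re ≠ 0 := by rw [hc, Complex.ofReal_re]; positivity
    have h2 : ¬ P.δ * P.σ = -1 := by rw [h]; norm_num
    simp [Sig, h1, h2, h4, hz]
  · have h3 : ‖z‖ ^ 2 + P.csq.re = 0 ↔ ‖z‖ = P.q₀ := by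
      rw [hc, Complex.ofReal_re, ← sub_eq_add_neg, sub_eq_zero,
        sq_eq_sq₀ (norm_nonneg _) hq.le]
    simp [Sig, h4, hz, h3, h]

theorem mem_lowerDom {z : ℂ} (h : (P.lam z).im < 0) :
    z ∈ P.lowerDom := by
  refine ⟨?_, h.le⟩
  rintro rfl
  simp [lam] at h

theorem ne_zero_of_im_lam {z : ℂ} (h : (P.lam z).im ≠ 0) : z ≠ 0 := by
  rintro rfl
  simp [lam] at h

theorem IsSolution.hat_ne (hP : P.IsSolution) {z : ℂ} (hz : z ≠ 0) : P.csq / z ≠ 0 :=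
  div_ne_zero hP.csq_ne hz

theorem IsSolution.hat_mem_lowerDom (hP : P.IsSolution) {z : ℂ} (hz : z ≠ 0)
    (h : 0 ≤ (P.lam z).im) : P.csq / z ∈ P.lowerDom := by
  refine ⟨hP.hat_ne hz, ?_⟩
  rw [← lam_eq, hP.lam_hat hz, Complex.neg_im]
  linarith

/-- Branch points lie on `Im λ = 0`. -/
theorem sq_ne_of_im_lam {z : ℂ} (h : (P.lam z).im ≠ 0) :
    z ^ 2 ≠ P.csq := by
  intro h2
  have h3 : P.lam z = 0 := by
    rw [lam_eq, coreLam, ← h2]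
    field_simp
    ring
  rw [h3] at h
  simp at h

theorem detE_ne {z : ℂ} (hz : z ≠ 0) (h : z ^ 2 ≠ P.csq) : P.detE z ≠ 0 := by
  rw [detE_eq]
  intro h2
  apply h
  field_simp at h2
  linear_combination h2

theorem hasDerivAt_lam {z : ℂ} (hz : z ≠ 0) :
    HasDerivAt P.lam ((1 + P.csq / z ^ 2) / 2) z := by
  have h1 : HasDerivAt (fun z : ℂ => (z - P.csq * z⁻¹) / 2) _ z :=
    ((hasDerivAt_id z).sub ((hasDerivAt_inv hz).const_mul P.csq)).div_const 2
  refine (h1.congr_deriv ?_)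
  ring

theorem analyticAt_lam {z : ℂ} (hz : z ≠ 0) : AnalyticAt ℂ P.lam z := by
  refine (DifferentiableOn.analyticAt (s := {0}ᶜ) (fun w hw => ?_)
    (isOpen_compl_singleton.mem_nhds hz))
  exact (hasDerivAt_lam hw).differentiableAt.differentiableWithinAt

theorem continuousAt_lam {z : ℂ} (hz : z ≠ 0) : ContinuousAt P.lam z :=
  (hasDerivAt_lam hz).continuousAt

theorem deriv_lam_ne {z : ℂ} (hz : z ≠ 0) (h : z ^ 2 ≠ -P.csq) : deriv P.lam z ≠ 0 := by
  rw [(hasDerivAt_lam hz).deriv]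
  intro h2
  apply h
  field_simp at h2
  linear_combination h2

theorem hasDerivAt_hat {z : ℂ} (hz : z ≠ 0) :
    HasDerivAt (fun w => P.csq / w) (-(P.csq / z ^ 2)) z := by
  have h1 : HasDerivAt (fun z : ℂ => P.csq * z⁻¹) _ z := (hasDerivAt_inv hz).const_mul P.csq
  refine (h1.congr_deriv ?_)
  ring

/-! #### Properties of `m` -/

theorem IsSolution.isCoreSol_m (hP : P.IsSolution) (t : ℝ) {z : ℂ} (hz : z ∈ P.lowerDom) :
    IsCoreSol (fun x => (P.q x t : ℂ)) (fun x => P.r x t) P.qm (P.rbdry .minus) z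
      fun x => P.m x t z :=
  (hP.isCorePot t).isCoreSol (by rwa [qm_mul_rbdry])

theorem IsSolution.continuousOn_m (hP : P.IsSolution) (x t : ℝ) :
    ContinuousOn (P.m x t) P.lowerDom := by
  have := (hP.isCorePot t).continuousOn_coreSol x
  rwa [qm_mul_rbdry] at this

theorem IsSolution.differentiableAt_m (hP : P.IsSolution) (x t : ℝ) {z : ℂ}
    (h : (P.lam z).im < 0) : DifferentiableAt ℂ (P.m x t) z :=
  (hP.isCorePot t).differentiableAt_coreSol x (ne_zero_of_im_lam h.ne)
    (by rwa [qm_mul_rbdry])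

theorem IsSolution.m_ne_zero (hP : P.IsSolution) (x t : ℝ) {z : ℂ} (hz : z ∈ P.lowerDom) :
    P.m x t z ≠ 0 := by
  intro h
  have hs := hP.isCoreSol_m t hz
  have hd := fun x => (hP.isJostColumn_m t hz).1 x
  simp only [X_mulVec] at hd
  have h0 := eq_zero_of_hasDerivAt_linear (hP.continuous_X z t) hd (x₀ := x) (by rw [h, smul_zero])
  have h1 : ∀ y, P.m y t z = 0 := fun y =>
    (smul_eq_zero.1 (h0 y)).resolve_left (Complex.exp_ne_zero _)
  have h2 := hs.lim
  simp only [h1] at h2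
  have h3 := congrFun (tendsto_nhds_unique h2 tendsto_const_nhds) 0
  simp [coreE] at h3

theorem lam_neg_conj (z : ℂ) : P.lam (-(starRingEnd ℂ) z) = -(starRingEnd ℂ) (P.lam z) := by
  simp only [lam_eq, coreLam, map_div₀, map_sub, conj_csq, Complex.conj_ofNat]
  ring

theorem im_lam_neg_conj (z : ℂ) : (P.lam (-(starRingEnd ℂ) z)).im = (P.lam z).im := by
  rw [lam_neg_conj, Complex.neg_im, Complex.conj_im, neg_neg]

theorem neg_conj_mem_lowerDom {z : ℂ} (hz : z ∈ P.lowerDom) :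
    -(starRingEnd ℂ) z ∈ P.lowerDom :=
  ⟨by simpa using hz.1, by rw [← lam_eq, im_lam_neg_conj]; exact hz.2⟩

/-- The symmetry that comes from the reality of `q`. -/
theorem IsSolution.m_neg_conj (hP : P.IsSolution) (x t : ℝ) {z : ℂ} (hz : z ∈ P.lowerDom)
    (i : Fin 2) : P.m x t (-(starRingEnd ℂ) z) i = (starRingEnd ℂ) (P.m x t z i) := by
  have hs := hP.isCoreSol_m t hz
  have hr : ∀ x, (starRingEnd ℂ) (P.r x t) = P.r x t := fun x => by simp [r]
  have hb : (starRingEnd ℂ) (P.rbdry .minus) = P.rbdry .minus := by simp [rbdry]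
  have hconj : ∀ {f : ℝ → ℂ} {f' : ℂ} {x : ℝ}, HasDerivAt f f' x →
      HasDerivAt (fun y => (starRingEnd ℂ) (f y)) ((starRingEnd ℂ) f') x := fun {f f' x} hf =>
    (Complex.conjCLE.toContinuousLinearMap.hasFDerivAt.comp_hasDerivAt x hf)
  have h1 : IsCoreSol (fun x => (P.q x t : ℂ)) (fun x => P.r x t) P.qm (P.rbdry .minus)
      (-(starRingEnd ℂ) z) fun x i => (starRingEnd ℂ) (P.m x t z i) := by
    refine ⟨fun x => ?_, fun x => ?_, ?_⟩
    · refine (hconj (hs.deriv0 x)).congr_deriv ?_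
      simp only [map_add, map_mul, map_div₀, Complex.conj_I, Complex.conj_ofReal, hb]
      ring
    · refine (hconj (hs.deriv1 x)).congr_deriv ?_
      simp only [map_sub, map_mul, Complex.conj_I, hr]
      ring
    · refine tendsto_pi_nhds.2 fun i => ?_
      have h2 := (Complex.continuous_conj.tendsto _).comp ((tendsto_pi_nhds.1 hs.lim) i)
      have h3 : coreE (P.rbdry .minus) (-(starRingEnd ℂ) z) i =
          (starRingEnd ℂ) (coreE (P.rbdry .minus) z i) := by
        fin_cases i
        · simp [coreE]
        · simp [coreE, hb, Complex.conj_I]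
          ring
      rw [h3]
      exact h2
  have hz' := neg_conj_mem_lowerDom hz
  have h2 := IsCoreSol.unique (hP.isCorePot t) (by rwa [qm_mul_rbdry]) (hP.isCoreSol_m t hz') h1
  exact congrFun (congrFun h2 x) i

/-- The two columns at `-∞` have Wronskian `det E_-`. -/
theorem IsSolution.wr_m (hP : P.IsSolution) (x t : ℝ) {z : ℂ} (hz : z ∈ P.lowerDom)
    (hz' : P.csq / z ∈ P.lowerDom) :
    Wr (P.m x t z) ((I * P.qm / z) • P.m x t (P.csq / z)) = P.detE z := by
  have hu := hP.isJostColumn_m t hz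
  have hv := hP.isJostColumn_minus_one hz.1 (hP.isJostColumn_m t hz')
  set φ : ℝ → Fin 2 → ℂ := fun x => cexp (I * P.theta x t z) • P.m x t z with hφ
  set ψ : ℝ → Fin 2 → ℂ := fun x => (I * P.qm / z) • cexp (I * P.theta x t (P.csq / z)) •
    P.m x t (P.csq / z) with hψ
  have hd : ∀ y, HasDerivAt (fun y => Wr (φ y) (ψ y)) 0 y := fun y =>
    (((hu.comp0 y).mul (hv.comp1 y)).sub ((hu.comp1 y).mul (hv.comp0 y))).congr_deriv (by ring)
  have hcancel : ∀ y : ℝ, cexp (-(I * P.theta y t z)) * cexp (I * P.theta y t z) = 1 := fun y => by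
    rw [← Complex.exp_add, neg_add_cancel, Complex.exp_zero]
  have hconst : ∀ y, Wr (φ y) (ψ y) = Wr (φ x) (ψ x) := fun y =>
    is_const_of_deriv_eq_zero (fun y => (hd y).differentiableAt) (fun y => (hd y).deriv) y x
  have h0 := tendsto_pi_nhds.1 hu.2
  have h1 := tendsto_pi_nhds.1 hv.2
  have hlim := ((h0 0).mul (h1 1)).sub ((h0 1).mul (h1 0))
  have hlim' : Tendsto (fun y => Wr (φ y) (ψ y)) Side.minus.atEnd (𝓝 (P.detE z)) := by
    have e1 : P.E .minus z 0 0 * P.E .minus z 1 1 - P.E .minus z 1 0 * P.E .minus z 0 1 =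
        P.detE z := by
      rw [E_zero_zero, E_one_one, hP.E_one_zero, E_zero_one, detE_eq, ← qm_mul_rbdry]
      simp only [bdry]
      linear_combination (P.rbdry .minus * P.qm / z ^ 2) * I_sq
    rw [← e1]
    refine hlim.congr fun y => ?_
    simp only [Pi.smul_apply, smul_eq_mul, sigma₃_zero_zero, sigma₃_one_one, mul_one, mul_neg,
      neg_neg, Wr]
    linear_combination (φ y 0 * ψ y 1 - φ y 1 * ψ y 0) * hcancel y
  have : Side.minus.atEnd.NeBot := inferInstanceAs (atBot : Filter ℝ).NeBot
  have h2 := tendsto_nhds_unique (tendsto_const_nhds.congr fun y => (hconst y).symm) hlim'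
  have h3 := hcancel x
  rw [← h2, hφ, hψ]
  simp only [Wr, Pi.smul_apply, smul_eq_mul, hP.theta_hat hz.1, mul_neg]
  linear_combination -(I * P.qm / z) * (P.m x t z 0 * P.m x t (P.csq / z) 1 -
    P.m x t z 1 * P.m x t (P.csq / z) 0) * h3

theorem rbdry_ne (hP : P.IsSolution) : P.rbdry .minus ≠ 0 :=
  right_ne_zero_of_mul (by rw [qm_mul_rbdry]; exact hP.csq_ne)

/-- Behaviour at infinity. -/
theorem IsSolution.tendsto_m_cobounded (hP : P.IsSolution) (x t : ℝ) :
    Tendsto (P.m x t) (Bornology.cobounded ℂ ⊓ 𝓟 P.lowerDom) (𝓝 ![1, 0]) := by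
  have : (Bornology.cobounded ℂ).IsCountablyGenerated := by
    rw [← comap_norm_atTop]; infer_instance
  have hl : Tendsto (fun z : ℂ => ‖z‖) (Bornology.cobounded ℂ ⊓ 𝓟 P.lowerDom) atTop :=
    tendsto_norm_cobounded_atTop.mono_left inf_le_left
  have hdom : ∀ᶠ z in Bornology.cobounded ℂ ⊓ 𝓟 P.lowerDom,
      z ∈ coreDom (P.qm * P.rbdry .minus) := by
    rw [qm_mul_rbdry]
    exact mem_inf_of_right (mem_principal_self _)
  refine tendsto_pi_nhds.2 fun i => ?_
  fin_cases i
  · exact (hP.isCorePot t).tendsto_fst hl hdom x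
  · exact (hP.isCorePot t).tendsto_snd hl hdom x

theorem _root_.IsCorePot.swap {a b : ℝ → ℂ} {a₀ b₀ : ℂ} (h : IsCorePot a b a₀ b₀) :
    IsCorePot b a b₀ a₀ := ⟨h.diff_b, h.diff_a, h.int_b, h.int_a⟩

theorem IsSolution.lam_neg_hat (hP : P.IsSolution) {z : ℂ} (hz : z ≠ 0) :
    coreLam P.csq (-(P.csq / z)) = P.lam z := by
  have h := hP.lam_hat hz
  rw [lam_eq, coreLam] at h
  rw [coreLam, div_neg, ← neg_eq_iff_eq_neg.2 h]
  ring

/-- Exchanging the two components exchanges `q` and `r`, and the points `z` and `-δσ q₀² / z`. This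
transfers the asymptotics at infinity to the origin. -/
theorem IsSolution.m_eq_mirror (hP : P.IsSolution) (x t : ℝ) {z : ℂ} (hz : z ∈ P.lowerDom) :
    coreSol (fun x => P.r x t) (fun x => (P.q x t : ℂ)) (P.rbdry .minus) P.qm (-(P.csq / z)) x =
      ![I / P.rbdry .minus * z * P.m x t z 1, I / P.rbdry .minus * z * P.m x t z 0] := by
  have hz0 := hz.1
  have hc := hP.csq_ne
  have hr := rbdry_ne hP
  have hq := hP.qm_ne'
  have hs := hP.isCoreSol_m t hz
  have hprod : P.rbdry .minus * (P.qm : ℂ) = P.csq := by rw [mul_comm, qm_mul_rbdry]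
  have hdom : -(P.csq / z) ∈ coreDom (P.rbdry .minus * P.qm) := by
    rw [hprod]
    refine ⟨neg_ne_zero.2 (hP.hat_ne hz0), ?_⟩
    rw [hP.lam_neg_hat hz0]
    exact hz.2
  have h1 : IsCoreSol (fun x => P.r x t) (fun x => (P.q x t : ℂ)) (P.rbdry .minus) P.qm
      (-(P.csq / z)) fun x => ![I / P.rbdry .minus * z * P.m x t z 1,
        I / P.rbdry .minus * z * P.m x t z 0] := by
    refine ⟨fun x => ?_, fun x => ?_, ?_⟩
    · refine ((hs.deriv1 x).const_mul (I / P.rbdry .minus * z)).congr_deriv ?_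
      simp only [Matrix.cons_val_zero, Matrix.cons_val_one, Matrix.cons_val_fin_one, hprod]
      field_simp
      ring
    · refine ((hs.deriv0 x).const_mul (I / P.rbdry .minus * z)).congr_deriv ?_
      simp only [Matrix.cons_val_zero, Matrix.cons_val_one, Matrix.cons_val_fin_one, qm_mul_rbdry]
      ring
    · have h2 := hs.lim
      refine tendsto_pi_nhds.2 fun i => ?_
      fin_cases i
      · have h3 := ((tendsto_pi_nhds.1 h2) 1).const_mul (I / P.rbdry .minus * z)
        have e : I / P.rbdry .minus * z * coreE (P.rbdry .minus) z 1 =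
            coreE P.qm (-(P.csq / z)) 0 := by
          simp only [coreE, Matrix.cons_val_zero, Matrix.cons_val_one, Matrix.cons_val_fin_one]
          field_simp
          rw [I_sq, neg_neg]
        rw [e] at h3
        exact h3
      · have h3 := ((tendsto_pi_nhds.1 h2) 0).const_mul (I / P.rbdry .minus * z)
        have e : I / P.rbdry .minus * z * coreE (P.rbdry .minus) z 0 =
            coreE P.qm (-(P.csq / z)) 1 := by
          simp only [coreE, Matrix.cons_val_zero, Matrix.cons_val_one, Matrix.cons_val_fin_one]
          rw [← hprod]
          field_simp
        rw [e] at h3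
        exact h3
  exact congrFun (IsCoreSol.unique (hP.isCorePot t).swap hdom
    ((hP.isCorePot t).swap.isCoreSol hdom) h1) x

/-- Behaviour at the origin. -/
theorem IsSolution.tendsto_m_zero (hP : P.IsSolution) (x t : ℝ) :
    Tendsto (fun z => z • P.m x t z) (𝓝 0 ⊓ 𝓟 P.lowerDom) (𝓝 ![0, -(I * P.rbdry .minus)]) := by
  have hr := rbdry_ne hP
  have hprod : P.rbdry .minus * (P.qm : ℂ) = P.csq := by rw [mul_comm, qm_mul_rbdry]
  have : (Bornology.cobounded ℂ).IsCountablyGenerated := by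
    rw [← comap_norm_atTop]; infer_instance
  have hl : Tendsto (fun z : ℂ => ‖z‖) (Bornology.cobounded ℂ ⊓ 𝓟 (coreDom P.csq)) atTop :=
    tendsto_norm_cobounded_atTop.mono_left inf_le_left
  have hdom : ∀ᶠ z in Bornology.cobounded ℂ ⊓ 𝓟 (coreDom P.csq),
      z ∈ coreDom (P.rbdry .minus * P.qm) := by
    rw [hprod]
    exact mem_inf_of_right (mem_principal_self _)
  have h0 := (hP.isCorePot t).swap.tendsto_fst hl hdom x
  have h1 := (hP.isCorePot t).swap.tendsto_snd hl hdom x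
  have hmap : Tendsto (fun z => -(P.csq / z)) (𝓝 0 ⊓ 𝓟 P.lowerDom)
      (Bornology.cobounded ℂ ⊓ 𝓟 (coreDom P.csq)) := by
    refine tendsto_inf.2 ⟨?_, tendsto_principal.2 ?_⟩
    · have h2 : Tendsto (fun z : ℂ => z⁻¹) (𝓝 0 ⊓ 𝓟 P.lowerDom) (Bornology.cobounded ℂ) :=
        tendsto_inv₀_nhdsNE_zero.mono_left (inf_le_inf_left _ (principal_mono.2 fun z hz => hz.1))
      have h3 := tendsto_mul_left_cobounded (neg_ne_zero.2 hP.csq_ne)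
      refine (h3.comp h2).congr fun z => ?_
      simp [div_eq_mul_inv]
    · refine mem_inf_of_right (mem_principal.2 fun z hz => ?_)
      refine ⟨neg_ne_zero.2 (hP.hat_ne hz.1), ?_⟩
      rw [hP.lam_neg_hat hz.1]
      exact hz.2
  have hev : ∀ᶠ z in 𝓝 0 ⊓ 𝓟 P.lowerDom, z ∈ P.lowerDom :=
    mem_inf_of_right (mem_principal_self _)
  refine tendsto_pi_nhds.2 fun i => ?_
  fin_cases i
  · have h2 := (h1.comp hmap).const_mul (-(I * P.rbdry .minus))
    rw [mul_zero] at h2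
    refine h2.congr' ?_
    filter_upwards [hev] with z hz
    simp only [Function.comp_apply, hP.m_eq_mirror x t hz, Matrix.cons_val_one,
      Matrix.cons_val_fin_one, Pi.smul_apply, smul_eq_mul, Fin.zero_eta]
    field_simp
    linear_combination -(z * P.m x t z 0) * I_sq
  · have h2 := (h0.comp hmap).const_mul (-(I * P.rbdry .minus))
    rw [mul_one] at h2
    refine h2.congr' ?_
    filter_upwards [hev] with z hz
    simp only [Function.comp_apply, hP.m_eq_mirror x t hz, Matrix.cons_val_zero,
      Pi.smul_apply, smul_eq_mul, Fin.mk_one]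
    field_simp
    linear_combination -(z * P.m x t z 1) * I_sq

/-- The potential is recovered from `m` at the origin, along the imaginary axis. -/
theorem IsSolution.tendsto_m_ray (hP : P.IsSolution) (x t : ℝ) :
    Tendsto (fun τ : ℝ => P.qm * P.m x t (P.csq / (I * τ)) 0) atTop (𝓝 (P.q x t)) := by
  have hr := rbdry_ne hP
  have h := (hP.isCorePot t).swap.tendsto_snd_ray x
  refine h.congr' ?_
  filter_upwards [eventually_ge_atTop (1 : ℝ), eventually_ge_atTop ‖P.csq‖] with τ h1 h2
  have hτ : (τ : ℂ) ≠ 0 := by exact_mod_cast (by linarith : τ ≠ 0)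
  have h3 := neg_I_mul_mem_coreDom h1 h2
  have hI := I_ne_zero
  have e : -(P.csq / (P.csq / (I * τ))) = -(I * τ) := by
    rw [hP.hat_hat (mul_ne_zero hI hτ)]
  have hz : P.csq / (I * τ) ∈ P.lowerDom := by
    refine ⟨hP.hat_ne (mul_ne_zero hI hτ), ?_⟩
    rw [← lam_eq, ← hP.lam_neg_hat (hP.hat_ne (mul_ne_zero hI hτ)), e]
    exact h3.2
  have h4 := congrFun (hP.m_eq_mirror x t hz) 1
  rw [e] at h4
  rw [h4]
  simp only [Matrix.cons_val_one, Matrix.cons_val_fin_one]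
  rw [← qm_mul_rbdry]
  field_simp

/-! #### Proportional Jost columns -/

theorem Wr_smul_eq (a b v : Fin 2 → ℂ) : Wr a b • v = Wr v b • a + Wr a v • b := by
  ext i
  fin_cases i <;> simp [Wr] <;> ring

/-- `Φ₊₂` with the plane wave divided out. -/
def mPlus (P : NMKdVData) (x t : ℝ) (z : ℂ) : Fin 2 → ℂ :=
  ![-P.σ * P.m (-x) (-t) z 1, P.m (-x) (-t) z 0]

theorem cexp_smul_eq {a b : ℂ} {v w : Fin 2 → ℂ} (h : cexp (-a) • v = b • w) :
    v = (b * cexp a) • w := by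
  have h1 := congrArg (cexp a • ·) h
  simp only [smul_smul, ← Complex.exp_add, add_neg_cancel, Complex.exp_zero, one_smul] at h1
  rw [h1, mul_comm]

/-- On the continuous spectrum the absence of reflection makes `Φ₊₂` a multiple of `Φ₋₂`. -/
theorem IsReflectionless.mPlus_eq (hR : P.IsReflectionless) (hP : P.IsSolution) (x t : ℝ) {z : ℂ}
    (hz : z ∈ P.Sig₀) :
    P.mPlus x t z = P.s₂₂ z • (I * P.qm / z) • P.m x t (P.csq / z) := by
  obtain ⟨hz0, him⟩ := hP.mem_Sig_iff.1 hz.1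
  have hd : P.detE z ≠ 0 := detE_ne hz0 hz.2
  have hl : z ∈ P.lowerDom := ⟨hz0, him.le⟩
  have hl' : P.csq / z ∈ P.lowerDom := hP.hat_mem_lowerDom hz0 him.ge
  have h12 : P.s₁₂ z = 0 := (div_eq_zero_iff.1 (hR.rhoTilde_eq z hz)).resolve_right (hR.s₂₂_ne z hz)
  have hW : Wr (P.jost .plus 1 0 0 z) (P.jost .minus 1 0 0 z) = 0 :=
    (div_eq_zero_iff.1 h12).resolve_right hd
  have hW2 : Wr (P.jost .minus 0 0 0 z) (P.jost .plus 1 0 0 z) = P.s₂₂ z * P.detE z := by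
    rw [s₂₂, div_mul_cancel₀ _ hd]
  have hW3 : Wr (P.jost .minus 0 0 0 z) (P.jost .minus 1 0 0 z) = P.detE z := by
    rw [← hP.wr_m 0 0 hl hl', hP.jost_minus_zero 0 0 hl, hP.jost_minus_one 0 0 hz0 hl', theta_zero]
    simp
  have h0 : P.jost .plus 1 0 0 z = P.s₂₂ z • P.jost .minus 1 0 0 z := by
    have h1 := Wr_smul_eq (P.jost .minus 0 0 0 z) (P.jost .minus 1 0 0 z) (P.jost .plus 1 0 0 z)
    rw [hW, hW2, hW3, zero_smul, zero_add, mul_comm, mul_smul] at h1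
    exact smul_right_injective _ hd h1
  have h2 := (hP.isLaxSol_jost hz0 fun t => hP.existsUnique_plus_one t hl).eq_smul hP
    (hP.isLaxSol_jost hz0 fun t => hP.existsUnique_minus_one t hz0 hl') h0 x t
  rw [hP.jost_plus_one x t hl, hP.jost_minus_one x t hz0 hl', smul_comm (I * P.qm / z : ℂ),
    smul_comm (P.s₂₂ z)] at h2
  exact smul_right_injective _ (Complex.exp_ne_zero _) h2

/-- At a zero of `s₂₂` in `D₋`, `Φ₊₂` is the multiple `b` of `Φ₋₁`. -/
theorem IsSolution.mPlus_eq_of_s₂₂_eq_zero (hP : P.IsSolution) (x t : ℝ) {z : ℂ}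
    (hz : (P.lam z).im < 0) (h : P.s₂₂ z = 0) :
    P.mPlus x t z = (P.b z * cexp (2 * I * P.theta x t z)) • P.m x t z := by
  have hz0 := ne_zero_of_im_lam hz.ne
  have hl := mem_lowerDom hz
  have hd : P.detE z ≠ 0 := detE_ne hz0 (sq_ne_of_im_lam hz.ne)
  have hW : Wr (P.jost .minus 0 0 0 z) (P.jost .plus 1 0 0 z) = 0 :=
    (div_eq_zero_iff.1 h).resolve_right hd
  have hm : P.jost .minus 0 0 0 z ≠ 0 := by
    rw [hP.jost_minus_zero 0 0 hl]
    exact smul_ne_zero (Complex.exp_ne_zero _) (hP.m_ne_zero 0 0 hl)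
  have h0 : ∃ c : ℂ, P.jost .plus 1 0 0 z = c • P.jost .minus 0 0 0 z := by
    set u := P.jost .minus 0 0 0 z
    set v := P.jost .plus 1 0 0 z
    rw [Wr] at hW
    by_cases h00 : u 0 = 0
    · have h01 : u 1 ≠ 0 := fun h01 => hm (by ext i; fin_cases i <;> assumption)
      refine ⟨v 1 / u 1, ?_⟩
      ext i
      fin_cases i
      · simp only [Fin.zero_eta, Pi.smul_apply, smul_eq_mul]
        field_simp
        linear_combination -hW
      · simp only [Fin.mk_one, Pi.smul_apply, smul_eq_mul]
        field_simp
    · refine ⟨v 0 / u 0, ?_⟩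
      ext i
      fin_cases i
      · simp only [Fin.zero_eta, Pi.smul_apply, smul_eq_mul]
        field_simp
      · simp only [Fin.mk_one, Pi.smul_apply, smul_eq_mul]
        field_simp
        linear_combination hW
  obtain ⟨c, hc⟩ := h0
  have h1 : ∃ c : ℂ, ∀ x t : ℝ, P.jost .plus 1 x t z = c • P.jost .minus 0 x t z :=
    ⟨c, (hP.isLaxSol_jost hz0 fun t => hP.existsUnique_plus_one t hl).eq_smul hP
      (hP.isLaxSol_jost hz0 fun t => hP.existsUnique_minus_zero t hl) hc⟩
  have hD : z ∉ P.Dplus := fun h => absurd (hP.mem_Dplus_iff.1 h) hz.not_gt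
  have h2 := Classical.epsilon_spec h1 x t
  have h3 : P.b z = Classical.epsilon fun c : ℂ =>
      ∀ x t : ℝ, P.jost .plus 1 x t z = c • P.jost .minus 0 x t z := if_neg hD
  rw [← h3, hP.jost_plus_one x t hl, hP.jost_minus_zero x t hl, smul_smul] at h2
  rw [mPlus, cexp_smul_eq h2, mul_assoc, ← Complex.exp_add]
  congr 3
  ring

/-! ### The discrete spectrum -/

theorem IsSolution.im_lam_hat (hP : P.IsSolution) {z : ℂ} (hz : z ≠ 0) :
    (P.lam (P.csq / z)).im = -(P.lam z).im := by
  rw [hP.lam_hat hz, Complex.neg_im]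

/-- The reality of `q` makes the zeros symmetric under `z ↦ -z*`, which accounts for the
points `-z_n*` of the discrete spectrum. -/
theorem IsSolution.s₂₂_neg_conj (hP : P.IsSolution) {z : ℂ} (hz : z ∈ P.lowerDom) :
    P.s₂₂ (-(starRingEnd ℂ) z) = (starRingEnd ℂ) (P.s₂₂ z) := by
  rw [hP.s₂₂_eq hz, hP.s₂₂_eq (neg_conj_mem_lowerDom hz), hP.m_neg_conj 0 0 hz,
    hP.m_neg_conj 0 0 hz]
  simp [detE_eq, conj_csq]

theorem IsSolution.s₁₁_neg_conj (hP : P.IsSolution) {z : ℂ} (hz : 0 < (P.lam z).im) :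
    P.s₁₁ (-(starRingEnd ℂ) z) = (starRingEnd ℂ) (P.s₁₁ z) := by
  have hz0 := ne_zero_of_im_lam hz.ne'
  have hl := hP.hat_mem_lowerDom hz0 hz.le
  have h1 : P.csq / -(starRingEnd ℂ) z = -(starRingEnd ℂ) (P.csq / z) := by
    simp [conj_csq, div_neg]
  rw [hP.s₁₁_eq hz0 hl, hP.s₁₁_eq (by simpa using hz0) (by rw [h1]; exact neg_conj_mem_lowerDom hl),
    h1, hP.s₂₂_neg_conj hl]
  simp

theorem eventually_im_lam_pos {z : ℂ} (hz : 0 < (P.lam z).im) :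
    ∀ᶠ w in 𝓝 z, 0 < (P.lam w).im :=
  (Complex.continuous_im.continuousAt.comp
    (continuousAt_lam (ne_zero_of_im_lam hz.ne'))).eventually (lt_mem_nhds hz)

theorem eventually_im_lam_neg {z : ℂ} (hz : (P.lam z).im < 0) :
    ∀ᶠ w in 𝓝 z, (P.lam w).im < 0 :=
  (Complex.continuous_im.continuousAt.comp
    (continuousAt_lam (ne_zero_of_im_lam hz.ne))).eventually (gt_mem_nhds hz)

theorem IsSolution.differentiableAt_m_apply (hP : P.IsSolution) (x t : ℝ) {z : ℂ}
    (h : (P.lam z).im < 0) (i : Fin 2) : DifferentiableAt ℂ (fun z => P.m x t z i) z :=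
  differentiableAt_pi.1 (hP.differentiableAt_m x t h) i

theorem differentiableAt_detE {z : ℂ} (hz : z ≠ 0) : DifferentiableAt ℂ P.detE z := by
  have h : P.detE = fun z => 1 - P.csq / z ^ 2 := rfl
  rw [h]
  have : z ^ 2 ≠ 0 := pow_ne_zero 2 hz
  fun_prop (disch := assumption)

theorem IsSolution.differentiableAt_s₂₂ (hP : P.IsSolution) {z : ℂ} (h : (P.lam z).im < 0) :
    DifferentiableAt ℂ P.s₂₂ z := by
  have hz := ne_zero_of_im_lam h.ne
  have h0 := hP.differentiableAt_m_apply 0 0 h 0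
  have h1 := hP.differentiableAt_m_apply 0 0 h 1
  have hd := differentiableAt_detE (P := P) hz
  have h2 := detE_ne hz (sq_ne_of_im_lam h.ne)
  have h3 : DifferentiableAt ℂ
      (fun z => (P.m 0 0 z 0 ^ 2 + P.σ * P.m 0 0 z 1 ^ 2) / P.detE z) z := by
    fun_prop (disch := assumption)
  refine h3.congr_of_eventuallyEq ?_
  filter_upwards [eventually_im_lam_neg h] with w hw using hP.s₂₂_eq (mem_lowerDom hw)

theorem IsSolution.deriv_s₁₁_neg_conj (hP : P.IsSolution) {z : ℂ} (hz : 0 < (P.lam z).im) :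
    deriv P.s₁₁ (-(starRingEnd ℂ) z) = -(starRingEnd ℂ) (deriv P.s₁₁ z) := by
  have h1 : P.s₁₁ =ᶠ[𝓝 (-(starRingEnd ℂ) z)]
      ((starRingEnd ℂ) ∘ (fun w => P.s₁₁ (-w)) ∘ (starRingEnd ℂ)) := by
    have hz' : 0 < (P.lam (-(starRingEnd ℂ) z)).im := by rwa [im_lam_neg_conj]
    filter_upwards [eventually_im_lam_pos hz'] with w hw
    simp only [Function.comp_apply]
    rw [hP.s₁₁_neg_conj hw, Complex.conj_conj]
  rw [h1.deriv_eq, deriv_conj_conj]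
  simp only [Function.comp_apply]
  rw [deriv_comp_neg]
  simp

section

variable {N₁ N₂ : ℕ} {z : Fin N₁ → ℂ} {w : Fin N₂ → ℝ}

theorem IsDiscreteSpectrum.eta_spec (hZ : P.IsDiscreteSpectrum z w) (hP : P.IsSolution)
    (k : Idx N₁ N₂) : 0 < (P.lam (eta z w k)).im ∧ P.s₁₁ (eta z w k) = 0 ∧
      deriv P.s₁₁ (eta z w k) ≠ 0 := by
  have h1 : ∀ n, z n ∈ {ζ | ζ ∈ P.Dplus ∧ 0 < ζ.re ∧ P.s₁₁ ζ = 0} := fun n =>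
    hZ.range_z ▸ Set.mem_range_self n
  have h2 : ∀ n, I * (w n : ℂ) ∈ {ζ | ζ ∈ P.Dplus ∧ ζ.re = 0 ∧ P.s₁₁ ζ = 0} := fun n =>
    hZ.range_w ▸ Set.mem_range_self n
  rcases k with (n | n) | n
  · exact ⟨hP.mem_Dplus_iff.1 (h1 n).1, (h1 n).2.2, hZ.simple_z n⟩
  · have h3 := hP.mem_Dplus_iff.1 (h1 n).1
    simp only [eta, Sum.elim_inl, Sum.elim_inr]
    refine ⟨by rwa [im_lam_neg_conj], ?_, ?_⟩
    · rw [hP.s₁₁_neg_conj h3, (h1 n).2.2, map_zero]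
    · rw [hP.deriv_s₁₁_neg_conj h3]
      simpa using hZ.simple_z n
  · exact ⟨hP.mem_Dplus_iff.1 (h2 n).1, (h2 n).2.2, hZ.simple_w n⟩

theorem IsDiscreteSpectrum.exists_eta_eq (hZ : P.IsDiscreteSpectrum z w) (hP : P.IsSolution)
    {ζ : ℂ} (h : 0 < (P.lam ζ).im) (h0 : P.s₁₁ ζ = 0) : ∃ k : Idx N₁ N₂, eta z w k = ζ := by
  have hD := hP.mem_Dplus_iff.2 h
  rcases lt_trichotomy 0 ζ.re with hr | hr | hr
  · obtain ⟨n, hn⟩ : ζ ∈ Set.range z := by rw [hZ.range_z]; exact ⟨hD, hr, h0⟩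
    exact ⟨.inl (.inl n), hn⟩
  · obtain ⟨n, hn⟩ : ζ ∈ Set.range fun n => I * (w n : ℂ) := by
      rw [hZ.range_w]; exact ⟨hD, hr.symm, h0⟩
    exact ⟨.inr n, hn⟩
  · obtain ⟨n, hn⟩ : -(starRingEnd ℂ) ζ ∈ Set.range z := by
      rw [hZ.range_z]
      refine ⟨hP.mem_Dplus_iff.2 (by rwa [im_lam_neg_conj]), by simpa using hr, ?_⟩
      rw [hP.s₁₁_neg_conj h, h0, map_zero]
    refine ⟨.inl (.inr n), ?_⟩
    simp [eta, hn]

theorem IsDiscreteSpectrum.eta_injective (hZ : P.IsDiscreteSpectrum z w) :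
    Function.Injective (eta z w) := by
  have h1 : ∀ n, 0 < (z n).re := fun n =>
    (hZ.range_z ▸ Set.mem_range_self n :
      z n ∈ {ζ | ζ ∈ P.Dplus ∧ 0 < ζ.re ∧ P.s₁₁ ζ = 0}).2.1
  intro a b hab
  have hre := congrArg Complex.re hab
  rcases a with (a | a) | a <;> rcases b with (b | b) | b <;>
    simp only [eta, Sum.elim_inl, Sum.elim_inr, Complex.neg_re, Complex.conj_re, Complex.mul_re,
      Complex.I_re, Complex.I_im, Complex.ofReal_re, Complex.ofReal_im, zero_mul, mul_zero,
      sub_zero] at hab hre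
  · rw [hZ.z_inj hab]
  · linarith [h1 a, h1 b]
  · linarith [h1 a]
  · linarith [h1 a, h1 b]
  · rw [hZ.z_inj ((starRingEnd ℂ).injective (neg_injective hab))]
  · linarith [h1 a]
  · linarith [h1 b]
  · linarith [h1 b]
  · rw [hZ.w_inj (Complex.ofReal_injective (mul_left_cancel₀ I_ne_zero hab))]

theorem etaHat_eq (n : Idx N₁ N₂) : P.etaHat z w n = P.csq / eta z w n := rfl

theorem IsDiscreteSpectrum.im_lam_etaHat (hZ : P.IsDiscreteSpectrum z w) (hP : P.IsSolution)
    (n : Idx N₁ N₂) : (P.lam (P.etaHat z w n)).im < 0 := by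
  have h := (hZ.eta_spec hP n).1
  rw [etaHat_eq, hP.im_lam_hat (ne_zero_of_im_lam h.ne')]
  linarith

theorem IsDiscreteSpectrum.eta_ne (hZ : P.IsDiscreteSpectrum z w) (hP : P.IsSolution)
    (n : Idx N₁ N₂) : eta z w n ≠ 0 := ne_zero_of_im_lam (hZ.eta_spec hP n).1.ne'

theorem IsDiscreteSpectrum.etaHat_injective (hZ : P.IsDiscreteSpectrum z w) (hP : P.IsSolution) :
    Function.Injective (P.etaHat z w) := by
  intro a b hab
  rw [etaHat_eq, etaHat_eq] at hab
  apply hZ.eta_injective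
  rw [← hP.hat_hat (hZ.eta_ne hP a), hab, hP.hat_hat (hZ.eta_ne hP b)]

theorem IsDiscreteSpectrum.s₂₂_etaHat (hZ : P.IsDiscreteSpectrum z w) (hP : P.IsSolution)
    (n : Idx N₁ N₂) : P.s₂₂ (P.etaHat z w n) = 0 ∧ deriv P.s₂₂ (P.etaHat z w n) ≠ 0 := by
  obtain ⟨h1, h2, h3⟩ := hZ.eta_spec hP n
  have h0 := hZ.eta_ne hP n
  have hδ : (P.δ : ℂ) ≠ 0 := left_ne_zero_of_mul_eq_one hP.delta_sq
  constructor
  · rw [hP.s₁₁_eq h0 (hP.hat_mem_lowerDom h0 h1.le)] at h2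
    exact (mul_eq_zero.1 h2).resolve_left hδ
  · intro h4
    apply h3
    have h5 : P.s₁₁ =ᶠ[𝓝 (eta z w n)] fun ζ => P.δ * P.s₂₂ (P.csq / ζ) := by
      filter_upwards [eventually_im_lam_pos h1] with ζ hζ
      have hζ0 := ne_zero_of_im_lam hζ.ne'
      exact hP.s₁₁_eq hζ0 (hP.hat_mem_lowerDom hζ0 hζ.le)
    have h6 := (hP.differentiableAt_s₂₂ (hZ.im_lam_etaHat hP n)).hasDerivAt
    have h7 := ((h6.comp (eta z w n) (hasDerivAt_hat h0)).const_mul (P.δ : ℂ))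
    rw [h5.deriv_eq]
    refine h7.deriv.trans ?_
    rw [h4]
    ring

theorem IsDiscreteSpectrum.exists_etaHat_eq (hZ : P.IsDiscreteSpectrum z w) (hP : P.IsSolution)
    {ζ : ℂ} (h : (P.lam ζ).im < 0) (h0 : P.s₂₂ ζ = 0) : ∃ k : Idx N₁ N₂, P.etaHat z w k = ζ := by
  have hζ := ne_zero_of_im_lam h.ne
  have hh := hP.hat_ne hζ
  have h1 : 0 < (P.lam (P.csq / ζ)).im := by rw [hP.im_lam_hat hζ]; linarith
  obtain ⟨k, hk⟩ := hZ.exists_eta_eq hP h1 (by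
    rw [hP.s₁₁_eq hh (by rw [hP.hat_hat hζ]; exact mem_lowerDom h), hP.hat_hat hζ, h0, mul_zero])
  exact ⟨k, by rw [etaHat_eq, hk, hP.hat_hat hζ]⟩

end

/-! ### The second column of the Riemann-Hilbert problem -/

/-- On `Im λ ≥ 0`: the column `Φ₋₂` with the plane wave divided out. -/
def upperSol (P : NMKdVData) (x t : ℝ) (z : ℂ) : Fin 2 → ℂ :=
  (I * P.qm / z) • P.m x t (P.csq / z)

/-- On `Im λ < 0`: the column `Φ₊₂ / s₂₂` with the plane wave divided out. -/
def lowerSol (P : NMKdVData) (x t : ℝ) (z : ℂ) : Fin 2 → ℂ := (P.s₂₂ z)⁻¹ • P.mPlus x t z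

open scoped Classical in
/-- The sectionally holomorphic second column of the Riemann-Hilbert problem. -/
def rhSol (P : NMKdVData) (x t : ℝ) (z : ℂ) : Fin 2 → ℂ :=
  if 0 ≤ (P.lam z).im then P.upperSol x t z else P.lowerSol x t z

theorem rhSol_of_nonneg (x t : ℝ) {z : ℂ} (h : 0 ≤ (P.lam z).im) :
    P.rhSol x t z = P.upperSol x t z := if_pos h

theorem rhSol_of_neg (x t : ℝ) {z : ℂ} (h : (P.lam z).im < 0) :
    P.rhSol x t z = P.lowerSol x t z := if_neg h.not_ge

theorem tendsto_of_upper_of_lower {E : Type*} {f f₁ f₂ : ℂ → E}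
    {l : Filter ℂ} {L : Filter E} (h1 : ∀ z, 0 ≤ (P.lam z).im → f z = f₁ z)
    (h2 : ∀ z, (P.lam z).im < 0 → f z = f₂ z)
    (t1 : Tendsto f₁ (l ⊓ 𝓟 {z | 0 ≤ (P.lam z).im}) L)
    (t2 : Tendsto f₂ (l ⊓ 𝓟 {z | (P.lam z).im < 0}) L) : Tendsto f l L := by
  have e : l = (l ⊓ 𝓟 {z | 0 ≤ (P.lam z).im}) ⊔ (l ⊓ 𝓟 {z | (P.lam z).im < 0}) := by
    rw [← inf_sup_left, sup_principal]
    have : {z | 0 ≤ (P.lam z).im} ∪ {z | (P.lam z).im < 0} = Set.univ :=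
      Set.eq_univ_of_forall fun z => le_or_gt 0 (P.lam z).im
    rw [this, principal_univ, inf_top_eq]
  rw [e]
  refine Tendsto.sup ?_ ?_
  · refine t1.congr' ?_
    filter_upwards [mem_inf_of_right (mem_principal_self _)] with z hz using (h1 z hz).symm
  · refine t2.congr' ?_
    filter_upwards [mem_inf_of_right (mem_principal_self _)] with z hz using (h2 z hz).symm

theorem IsSolution.tendsto_m_hat (hP : P.IsSolution) (x t : ℝ) {z : ℂ} (hz : z ≠ 0)
    (h : 0 ≤ (P.lam z).im) : Tendsto (fun w => P.m x t (P.csq / w))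
      (𝓝 z ⊓ 𝓟 {w | 0 ≤ (P.lam w).im}) (𝓝 (P.m x t (P.csq / z))) := by
  have h1 := hP.continuousOn_m x t _ (hP.hat_mem_lowerDom hz h)
  refine h1.tendsto.comp (tendsto_inf.2 ⟨?_, tendsto_principal.2 ?_⟩)
  · exact ((hasDerivAt_hat hz).continuousAt.tendsto).mono_left inf_le_left
  · filter_upwards [mem_inf_of_left (eventually_ne_nhds hz),
      mem_inf_of_right (mem_principal_self _)] with w hw hw' using hP.hat_mem_lowerDom hw hw'

theorem IsSolution.tendsto_m (hP : P.IsSolution) (x t : ℝ) {z : ℂ} (hz : z ∈ P.lowerDom) :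
    Tendsto (P.m x t) (𝓝 z ⊓ 𝓟 {w | (P.lam w).im < 0}) (𝓝 (P.m x t z)) :=
  (hP.continuousOn_m x t z hz).tendsto.mono_left
    (inf_le_inf_left _ (principal_mono.2 fun _ hw => mem_lowerDom hw))

theorem tendsto_mPlus {l : Filter ℂ} {x t : ℝ} {g : ℂ → ℂ} {v : Fin 2 → ℂ}
    (h : Tendsto (fun z => g z • P.m (-x) (-t) z) l (𝓝 v)) :
    Tendsto (fun z => g z • P.mPlus x t z) l (𝓝 ![-P.σ * v 1, v 0]) := by
  refine tendsto_pi_nhds.2 fun i => ?_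
  fin_cases i
  · refine (((tendsto_pi_nhds.1 h) 1).const_mul (-(P.σ : ℂ))).congr fun z => ?_
    simp [mPlus]
    ring
  · refine ((tendsto_pi_nhds.1 h) 0).congr fun z => ?_
    simp [mPlus]

/-- The limit of `s₂₂` when `m` has to be rescaled by a factor `g`: `s₂₂` is homogeneous of
degree `2` in `m`, divided by `det E`. -/
theorem tendsto_s₂₂ (hP : P.IsSolution) {l : Filter ℂ} {g : ℂ → ℂ} {u₀ u₁ d : ℂ}
    (h0 : Tendsto (fun z => g z * P.m 0 0 z 0) l (𝓝 u₀))
    (h1 : Tendsto (fun z => g z * P.m 0 0 z 1) l (𝓝 u₁))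
    (hd : Tendsto (fun z => g z ^ 2 * P.detE z) l (𝓝 d)) (hd0 : d ≠ 0)
    (hl : ∀ᶠ z in l, z ∈ P.lowerDom) (hg : ∀ᶠ z in l, g z ≠ 0) :
    Tendsto P.s₂₂ l (𝓝 ((u₀ ^ 2 + P.σ * u₁ ^ 2) / d)) := by
  refine (((h0.pow 2).add ((h1.pow 2).const_mul _)).div hd hd0).congr' ?_
  filter_upwards [hl, hg] with z hz hgz
  rw [hP.s₂₂_eq hz, ← mul_div_mul_left _ (P.detE z) (pow_ne_zero 2 hgz)]
  change ((g z * _) ^ 2 + _ * (g z * _) ^ 2) / (g z ^ 2 * P.detE z) = _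
  congr 1
  ring

theorem lowerDom_of_im_neg (l : Filter ℂ) :
    ∀ᶠ z in l ⊓ 𝓟 {z | (P.lam z).im < 0}, z ∈ P.lowerDom := by
  filter_upwards [mem_inf_of_right (mem_principal_self _)] with z hz using mem_lowerDom hz

theorem inf_im_neg_le (l : Filter ℂ) :
    l ⊓ 𝓟 {z | (P.lam z).im < 0} ≤ l ⊓ 𝓟 P.lowerDom :=
  inf_le_inf_left _ (principal_mono.2 fun _ hw => mem_lowerDom hw)

theorem tendsto_detE_cobounded : Tendsto P.detE (Bornology.cobounded ℂ) (𝓝 1) := by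
  have h := tendsto_inv₀_cobounded (α := ℂ)
  have h2 := ((h.pow 2).const_mul P.csq).const_sub 1
  simp only [ne_eq, OfNat.ofNat_ne_zero, not_false_eq_true, zero_pow, mul_zero, sub_zero] at h2
  refine h2.congr fun z => ?_
  rw [detE_eq, inv_pow, div_eq_mul_inv]

/-- Normalization at infinity. -/
theorem IsSolution.tendsto_rhSol_cobounded (hP : P.IsSolution) (x t : ℝ) :
    Tendsto (P.rhSol x t) (Bornology.cobounded ℂ) (𝓝 ![0, 1]) := by
  have hc := hP.csq_ne
  have hne : ∀ᶠ z in Bornology.cobounded ℂ, z ≠ 0 := Bornology.eventually_ne_cobounded 0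
  refine tendsto_of_upper_of_lower (fun z hz => rhSol_of_nonneg x t hz)
    (fun z hz => rhSol_of_neg x t hz) ?_ ?_
  · have h1 : Tendsto (fun z => P.csq / z) (Bornology.cobounded ℂ ⊓ 𝓟 {z | 0 ≤ (P.lam z).im})
        (𝓝 0 ⊓ 𝓟 P.lowerDom) := by
      refine tendsto_inf.2 ⟨?_, tendsto_principal.2 ?_⟩
      · have h2 := (tendsto_inv₀_cobounded (α := ℂ)).const_mul P.csq
        rw [mul_zero] at h2
        exact (h2.congr fun z => (div_eq_mul_inv _ _).symm).mono_left inf_le_left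
      · filter_upwards [mem_inf_of_left hne, mem_inf_of_right (mem_principal_self _)] with z hz hz'
          using hP.hat_mem_lowerDom hz hz'
    have h2 := ((hP.tendsto_m_zero x t).comp h1).const_smul (I * P.qm / P.csq)
    have e : (I * P.qm / P.csq) • ![0, -(I * P.rbdry .minus)] = ![0, 1] := by
      have h3 := qm_mul_rbdry (P := P)
      ext i
      fin_cases i
      · simp
      · simp
        field_simp
        linear_combination -(P.qm * P.rbdry .minus) * I_sq + h3
    rw [e] at h2
    refine h2.congr' ?_
    filter_upwards [mem_inf_of_left hne] with z hz
    rw [Function.comp_apply, smul_smul, upperSol]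
    congr 1
    field_simp
  · have h1 := fun x t => (hP.tendsto_m_cobounded x t).mono_left (inf_im_neg_le _)
    have h2 := tendsto_s₂₂ hP (g := fun _ => 1) (by simpa using (tendsto_pi_nhds.1 (h1 0 0)) 0)
      (by simpa using (tendsto_pi_nhds.1 (h1 0 0)) 1)
      (by simpa using tendsto_detE_cobounded.mono_left inf_le_left) one_ne_zero
      (lowerDom_of_im_neg _) (Eventually.of_forall fun _ => one_ne_zero)
    have h3 := tendsto_mPlus (g := fun _ => 1) (x := x) (t := t) (by simpa using h1 (-x) (-t))
    simp only [one_smul] at h3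
    have h4 := (h2.inv₀ (by simp)).smul h3
    change Tendsto (fun z => (P.s₂₂ z)⁻¹ • P.mPlus x t z) _ _
    simpa using h4

/-- The simple pole at the origin. -/
theorem IsSolution.tendsto_rhSol_zero (hP : P.IsSolution) (x t : ℝ) :
    Tendsto (fun z => z • P.rhSol x t z) (𝓝[≠] 0) (𝓝 ![I * P.qm, 0]) := by
  have hc := hP.csq_ne
  have hne : ∀ᶠ z : ℂ in 𝓝[≠] 0, z ≠ 0 := self_mem_nhdsWithin
  refine tendsto_of_upper_of_lower (fun z hz => by rw [rhSol_of_nonneg x t hz])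
    (fun z hz => by rw [rhSol_of_neg x t hz]) ?_ ?_
  · have h1 : Tendsto (fun z => P.csq / z) (𝓝[≠] 0 ⊓ 𝓟 {z | 0 ≤ (P.lam z).im})
        (Bornology.cobounded ℂ ⊓ 𝓟 P.lowerDom) := by
      refine tendsto_inf.2 ⟨?_, tendsto_principal.2 ?_⟩
      · have h2 : Tendsto (fun z : ℂ => z⁻¹) (𝓝[≠] 0) (Bornology.cobounded ℂ) :=
          tendsto_inv₀_nhdsNE_zero
        exact (((tendsto_mul_left_cobounded hc).comp h2).congr fun z =>
          (div_eq_mul_inv _ _).symm).mono_left inf_le_left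
      · filter_upwards [mem_inf_of_left hne, mem_inf_of_right (mem_principal_self _)] with z hz hz'
          using hP.hat_mem_lowerDom hz hz'
    have h2 := ((hP.tendsto_m_cobounded x t).comp h1).const_smul (I * P.qm : ℂ)
    have e : (I * P.qm : ℂ) • ![1, 0] = ![I * (P.qm : ℂ), 0] := by
      ext i
      fin_cases i <;> simp
    rw [e] at h2
    refine h2.congr' ?_
    filter_upwards [mem_inf_of_left hne] with z hz
    rw [Function.comp_apply, upperSol, smul_smul]
    congr 1
    field_simp
  · have hle : 𝓝[≠] (0 : ℂ) ⊓ 𝓟 {z | (P.lam z).im < 0} ≤ 𝓝 0 ⊓ 𝓟 P.lowerDom :=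
      (inf_im_neg_le _).trans (inf_le_inf_right _ nhdsWithin_le_nhds)
    have h1 := fun x t => (hP.tendsto_m_zero x t).mono_left hle
    have hd : Tendsto (fun z => z ^ 2 * P.detE z) (𝓝[≠] (0 : ℂ) ⊓ 𝓟 {z | (P.lam z).im < 0})
        (𝓝 (-P.csq)) := by
      have h2 : Tendsto (fun z : ℂ => z ^ 2 - P.csq) (𝓝 0) (𝓝 (-P.csq)) := by
        have : Continuous fun z : ℂ => z ^ 2 - P.csq := by fun_prop
        simpa using this.tendsto 0
      refine (h2.mono_left (inf_le_left.trans nhdsWithin_le_nhds)).congr' ?_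
      filter_upwards [mem_inf_of_left hne] with z hz
      rw [detE_eq]
      field_simp
    have h2 := tendsto_s₂₂ hP (g := fun z => z) ((tendsto_pi_nhds.1 (h1 0 0)) 0)
      ((tendsto_pi_nhds.1 (h1 0 0)) 1) hd (neg_ne_zero.2 hc)
      (lowerDom_of_im_neg _) (mem_inf_of_left hne)
    have h3 := tendsto_mPlus (g := fun z => z) (x := x) (t := t) (h1 (-x) (-t))
    have hδ : (P.δ : ℂ) ≠ 0 := left_ne_zero_of_mul_eq_one hP.delta_sq
    have e1 : (((![0, -(I * P.rbdry .minus)] : Fin 2 → ℂ) 0) ^ 2 +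
        P.σ * ((![0, -(I * P.rbdry .minus)] : Fin 2 → ℂ) 1) ^ 2) / -P.csq = P.δ := by
      simp only [Matrix.cons_val_zero, Matrix.cons_val_one, Matrix.cons_val_fin_one]
      rw [div_eq_iff (neg_ne_zero.2 hc), ← qm_mul_rbdry, rbdry_minus]
      have hs := hP.sigma_sq
      linear_combination (P.σ * (P.σ * P.δ * P.qm) ^ 2) * I_sq - P.σ * (P.δ * P.qm) ^ 2 * hs
    rw [e1] at h2
    have h4 := (h2.inv₀ hδ).smul h3
    have e2 : (P.δ : ℂ)⁻¹ • ![-P.σ * (![0, -(I * P.rbdry .minus)] : Fin 2 → ℂ) 1,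
        (![0, -(I * P.rbdry .minus)] : Fin 2 → ℂ) 0] = ![I * P.qm, 0] := by
      have hs := hP.sigma_sq
      ext i
      fin_cases i
      · simp [rbdry_minus]
        field_simp
        linear_combination (P.qm : ℂ) * hs
      · simp
    rw [e2] at h4
    refine h4.congr fun z => ?_
    rw [lowerSol, smul_comm]

/-! ### Regularity of the second column -/

theorem IsSolution.tendsto_upperSol (hP : P.IsSolution) (x t : ℝ) {z : ℂ} (hz : z ≠ 0)
    (h : 0 ≤ (P.lam z).im) :
    Tendsto (P.upperSol x t) (𝓝 z ⊓ 𝓟 {w | 0 ≤ (P.lam w).im}) (𝓝 (P.upperSol x t z)) := by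
  have h1 : ContinuousAt (fun w : ℂ => I * P.qm / w) z := by fun_prop (disch := assumption)
  exact (h1.tendsto.mono_left inf_le_left).smul (hP.tendsto_m_hat x t hz h)

theorem IsSolution.tendsto_mPlus_nhds (hP : P.IsSolution) (x t : ℝ) {z : ℂ}
    (hz : z ∈ P.lowerDom) :
    Tendsto (P.mPlus x t) (𝓝 z ⊓ 𝓟 {w | (P.lam w).im < 0}) (𝓝 (P.mPlus x t z)) := by
  have h := tendsto_mPlus (g := fun _ => 1) (x := x) (t := t)
    (by simpa using hP.tendsto_m (-x) (-t) hz)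
  simp only [one_smul] at h
  exact h

theorem IsReflectionless.continuousAt_rhSol (hR : P.IsReflectionless) (hP : P.IsSolution)
    (x t : ℝ) {z : ℂ} (hz : z ∈ P.Sig₀) : ContinuousAt (P.rhSol x t) z := by
  obtain ⟨hz0, him⟩ := hP.mem_Sig_iff.1 hz.1
  have hd : P.detE z ≠ 0 := detE_ne hz0 hz.2
  have hl : z ∈ P.lowerDom := ⟨hz0, him.le⟩
  rw [ContinuousAt, rhSol_of_nonneg x t him.ge]
  refine tendsto_of_upper_of_lower (fun z hz => rhSol_of_nonneg x t hz)
    (fun z hz => rhSol_of_neg x t hz) (hP.tendsto_upperSol x t hz0 him.ge) ?_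
  have h1 := tendsto_pi_nhds.1 (hP.tendsto_m 0 0 hl)
  have h2 := tendsto_s₂₂ hP (g := fun _ => 1) (by simpa using h1 0) (by simpa using h1 1)
    (by simpa using (differentiableAt_detE hz0).continuousAt.tendsto.mono_left inf_le_left) hd
    (lowerDom_of_im_neg _) (Eventually.of_forall fun _ => one_ne_zero)
  rw [← hP.s₂₂_eq hl] at h2
  have h3 := (h2.inv₀ (hR.s₂₂_ne z hz)).smul (hP.tendsto_mPlus_nhds x t hl)
  rw [hR.mPlus_eq hP x t hz, inv_smul_smul₀ (hR.s₂₂_ne z hz)] at h3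
  exact h3

theorem IsSolution.differentiableAt_rhSol_of_pos (hP : P.IsSolution) (x t : ℝ) {z : ℂ}
    (h : 0 < (P.lam z).im) (i : Fin 2) : DifferentiableAt ℂ (fun z => P.rhSol x t z i) z := by
  have hz := ne_zero_of_im_lam h.ne'
  have h1 : DifferentiableAt ℂ (fun w => P.m x t (P.csq / w) i) z :=
    (hP.differentiableAt_m_apply x t (by rw [hP.im_lam_hat hz]; linarith) i).comp z
      (hasDerivAt_hat hz).differentiableAt
  have h2 : DifferentiableAt ℂ (fun w : ℂ => I * P.qm / w * P.m x t (P.csq / w) i) z := by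
    fun_prop (disch := assumption)
  refine h2.congr_of_eventuallyEq ?_
  filter_upwards [eventually_im_lam_pos h] with w hw
  rw [rhSol_of_nonneg x t hw.le]
  rfl

theorem IsSolution.differentiableAt_mPlus_apply (hP : P.IsSolution) (x t : ℝ) {z : ℂ}
    (h : (P.lam z).im < 0) (i : Fin 2) :
    DifferentiableAt ℂ (fun z => P.mPlus x t z i) z := by
  have h0 := hP.differentiableAt_m_apply (-x) (-t) h 0
  have h1 := hP.differentiableAt_m_apply (-x) (-t) h 1
  fin_cases i
  · exact h1.const_mul _
  · exact h0

theorem IsSolution.differentiableAt_rhSol_of_neg (hP : P.IsSolution) (x t : ℝ) {z : ℂ}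
    (h : (P.lam z).im < 0) (hs : P.s₂₂ z ≠ 0) (i : Fin 2) :
    DifferentiableAt ℂ (fun z => P.rhSol x t z i) z := by
  have h2 : DifferentiableAt ℂ (fun z => (P.s₂₂ z)⁻¹ * P.mPlus x t z i) z :=
    ((hP.differentiableAt_s₂₂ h).inv hs).mul (hP.differentiableAt_mPlus_apply x t h i)
  refine h2.congr_of_eventuallyEq ?_
  filter_upwards [eventually_im_lam_neg h] with w hw
  rw [rhSol_of_neg x t hw]
  rfl

section

variable {N₁ N₂ : ℕ} {z : Fin N₁ → ℂ} {w : Fin N₂ → ℝ}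

theorem IsDiscreteSpectrum.differentiableAt_rhSol_of_im_ne (hZ : P.IsDiscreteSpectrum z w)
    (hP : P.IsSolution) (x t : ℝ) {ζ : ℂ} (h : (P.lam ζ).im ≠ 0)
    (hη : ζ ∉ Set.range (P.etaHat z w)) (i : Fin 2) :
    DifferentiableAt ℂ (fun z => P.rhSol x t z i) ζ := by
  rcases h.lt_or_gt with h | h
  · exact hP.differentiableAt_rhSol_of_neg x t h (fun h0 => hη (hZ.exists_etaHat_eq hP h h0)) i
  · exact hP.differentiableAt_rhSol_of_pos x t h i

theorem IsDiscreteSpectrum.continuousAt_rhSol_apply (hZ : P.IsDiscreteSpectrum z w)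
    (hP : P.IsSolution) (hR : P.IsReflectionless) (x t : ℝ) {ζ : ℂ} (h0 : ζ ≠ 0)
    (hc : ζ ^ 2 ≠ P.csq) (hη : ζ ∉ Set.range (P.etaHat z w)) (i : Fin 2) :
    ContinuousAt (fun z => P.rhSol x t z i) ζ := by
  by_cases h : (P.lam ζ).im = 0
  · exact continuousAt_pi.1 (hR.continuousAt_rhSol hP x t ⟨hP.mem_Sig_iff.2 ⟨h0, h⟩, hc⟩) i
  · exact (hZ.differentiableAt_rhSol_of_im_ne hP x t h hη i).continuousAt

/-- Without reflection the column is holomorphic across the continuous spectrum, away from the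
branch points and the critical points of `λ`. -/
theorem IsDiscreteSpectrum.differentiableAt_rhSol (hZ : P.IsDiscreteSpectrum z w)
    (hP : P.IsSolution) (hR : P.IsReflectionless) (x t : ℝ) {ζ : ℂ} (h0 : ζ ≠ 0)
    (hc : ζ ^ 2 ≠ P.csq) (hc' : (P.lam ζ).im = 0 → ζ ^ 2 ≠ -P.csq)
    (hη : ζ ∉ Set.range (P.etaHat z w)) (i : Fin 2) :
    DifferentiableAt ℂ (fun z => P.rhSol x t z i) ζ := by
  by_cases h : (P.lam ζ).im = 0
  · have hη' : ∀ᶠ ξ in 𝓝 ζ, ξ ∉ Set.range (P.etaHat z w) :=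
      (Set.finite_range _).isClosed.isOpen_compl.mem_nhds hη
    refine differentiableAt_of_continuousAt_of_im_ne_zero (analyticAt_lam h0)
      (deriv_lam_ne h0 (hc' h)) ?_ ?_
    · have hsq : ∀ᶠ ξ in 𝓝 ζ, ξ ^ 2 ≠ P.csq := (continuous_pow 2).continuousAt.eventually_ne hc
      filter_upwards [eventually_ne_nhds h0, hsq, hη'] with ξ h1 h2 h3
        using hZ.continuousAt_rhSol_apply hP hR x t h1 h2 h3 i
    · filter_upwards [hη'] with ξ h1 h2 using hZ.differentiableAt_rhSol_of_im_ne hP x t h2 h1 i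
  · exact hZ.differentiableAt_rhSol_of_im_ne hP x t h hη i

/-- The residue at a discrete eigenvalue. -/
theorem IsDiscreteSpectrum.tendsto_rhSol_etaHat (hZ : P.IsDiscreteSpectrum z w)
    (hP : P.IsSolution) (x t : ℝ) (n : Idx N₁ N₂) :
    Tendsto (fun ζ => (ζ - P.etaHat z w n) • P.rhSol x t ζ) (𝓝[≠] P.etaHat z w n)
      (𝓝 (P.alpha z w x t n • P.m x t (P.etaHat z w n))) := by
  set η := P.etaHat z w n with hη
  have him : (P.lam η).im < 0 := hZ.im_lam_etaHat hP n
  obtain ⟨hs, hs'⟩ : P.s₂₂ η = 0 ∧ deriv P.s₂₂ η ≠ 0 := hZ.s₂₂_etaHat hP n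
  have h1 := (hP.differentiableAt_s₂₂ him).hasDerivAt.tendsto_slope.inv₀ hs'
  have h2 : Tendsto (P.mPlus x t) (𝓝[≠] η) (𝓝 (P.mPlus x t η)) :=
    Tendsto.mono_left (tendsto_pi_nhds.2 fun i =>
      (hP.differentiableAt_mPlus_apply x t him i).continuousAt.tendsto) nhdsWithin_le_nhds
  have h3 := h1.smul h2
  have hD : η ∉ P.Dplus := fun h => absurd (hP.mem_Dplus_iff.1 h) him.not_gt
  have hA : P.A η = P.b η / deriv P.s₂₂ η := if_neg hD
  rw [hP.mPlus_eq_of_s₂₂_eq_zero x t him hs, smul_smul] at h3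
  have e : (deriv P.s₂₂ η)⁻¹ * (P.b η * cexp (2 * I * P.theta x t η)) = P.alpha z w x t n := by
    rw [alpha, ← hη, hA]
    ring
  rw [e] at h3
  refine h3.congr' ?_
  filter_upwards [nhdsWithin_le_nhds (eventually_im_lam_neg him)] with ζ hζ
  rw [rhSol_of_neg x t hζ, lowerSol, smul_smul, slope_def_field, hs, sub_zero, inv_div,
    div_eq_mul_inv]

end

/-! ### The branch points -/

/-- The linear combination `m₁ + c m₂` at `x = t = 0`. For `c² = -σ` the two combinations `± c`
factorize `s₂₂`. -/
def mFactor (P : NMKdVData) (c z : ℂ) : ℂ := P.m 0 0 z 0 + c * P.m 0 0 z 1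

theorem IsSolution.s₂₂_eq_mFactor (hP : P.IsSolution) {c : ℂ} (hc : c ^ 2 = -P.σ) {z : ℂ}
    (hz : z ∈ P.lowerDom) : P.s₂₂ z = P.mFactor c z * P.mFactor (-c) z / P.detE z := by
  rw [hP.s₂₂_eq hz, mFactor, mFactor]
  congr 1
  linear_combination (P.m 0 0 z 1) ^ 2 * hc

theorem IsSolution.exists_sq_eq (hP : P.IsSolution) : ∃ c : ℂ, c ^ 2 = -P.σ ∧ c ≠ 0 := by
  rcases hP.sigma with h | h
  · exact ⟨I, by simp [h], I_ne_zero⟩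
  · exact ⟨1, by simp [h], one_ne_zero⟩

theorem IsSolution.tendsto_mFactor (hP : P.IsSolution) (c : ℂ) {z : ℂ} (hz : z ∈ P.lowerDom) :
    Tendsto (P.mFactor c) (𝓝 z ⊓ 𝓟 {w | (P.lam w).im < 0}) (𝓝 (P.mFactor c z)) := by
  have h1 := tendsto_pi_nhds.1 (hP.tendsto_m 0 0 hz)
  exact (h1 0).add ((h1 1).const_mul c)

theorem IsSolution.mFactor_ne_or (hP : P.IsSolution) {c : ℂ} (hc : c ≠ 0) {z : ℂ}
    (hz : z ∈ P.lowerDom) : P.mFactor c z ≠ 0 ∨ P.mFactor (-c) z ≠ 0 := by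
  by_contra! h
  obtain ⟨h1, h2⟩ := h
  rw [mFactor] at h1 h2
  apply hP.m_ne_zero 0 0 hz
  have h3 : P.m 0 0 z 0 = 0 := by linear_combination (h1 + h2) / 2
  have h4 : c * P.m 0 0 z 1 = 0 := by linear_combination h1 - h3
  ext i
  fin_cases i
  · exact h3
  · exact (mul_eq_zero.1 h4).resolve_left hc

/-- The factor `m₁ + c m₂` formed with the column `Φ₋₂`. -/
def mFactorHat (P : NMKdVData) (c z : ℂ) : ℂ := I * P.qm / z * P.mFactor c (P.csq / z)

/-- On the continuous spectrum the absence of reflection makes the two factors inverse to each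
other up to the explicit function `det E`. -/
theorem IsReflectionless.mFactor_mul_mFactorHat (hR : P.IsReflectionless) (hP : P.IsSolution)
    {c : ℂ} (hc : c ^ 2 = -P.σ) {z : ℂ} (hz : z ∈ P.Sig₀) :
    P.mFactor c z * P.mFactorHat (-c) z = -c * P.detE z := by
  obtain ⟨hz0, him⟩ := hP.mem_Sig_iff.1 hz.1
  have hl : z ∈ P.lowerDom := ⟨hz0, him.le⟩
  have hs := hR.s₂₂_ne z hz
  have h1 := hR.mPlus_eq hP 0 0 hz
  rw [← hP.wr_m 0 0 hl (hP.hat_mem_lowerDom hz0 him.ge)]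
  have h2 := congrFun h1 0
  have h3 := congrFun h1 1
  simp only [mPlus, neg_zero, Matrix.cons_val_zero, Matrix.cons_val_one, Matrix.cons_val_fin_one,
    Pi.smul_apply, smul_eq_mul] at h2 h3
  apply mul_left_cancel₀ hs
  simp only [mFactor, mFactorHat, Wr, Pi.smul_apply, smul_eq_mul]
  linear_combination -P.m 0 0 z 0 * h2 - P.σ * P.m 0 0 z 1 * h3 -
    P.s₂₂ z * P.m 0 0 z 1 * (I * P.qm / z * P.m 0 0 (P.csq / z) 1) * hc

theorem frequently_im_lam_pos {z : ℂ} (hz : z ≠ 0) (h : z ^ 2 ≠ -P.csq)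
    (him : (P.lam z).im = 0) : ∃ᶠ w in 𝓝 z, 0 < (P.lam w).im := by
  have h1 : map P.lam (𝓝 z) = 𝓝 (P.lam z) := by
    have h2 := (analyticAt_lam (P := P) hz).contDiffAt (n := 1) |>.hasStrictDerivAt one_ne_zero
    exact h2.map_nhds_eq (deriv_lam_ne hz h)
  have h3 : ∃ᶠ w in 𝓝 (P.lam z), 0 < w.im := by
    have h4 : P.lam z ∈ closure {w : ℂ | 0 < w.im} := by
      rw [Complex.closure_setOfPred_lt_im]
      exact him.ge
    exact mem_closure_iff_frequently.1 h4
  rw [← h1] at h3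
  exact h3

theorem sq_ne_neg (hP : P.IsSolution) {z : ℂ} (hz : z ^ 2 = P.csq) : z ^ 2 ≠ -P.csq := by
  intro h
  apply hP.csq_ne
  linear_combination (h - hz) / 2

theorem ne_zero_of_sq_eq (hP : P.IsSolution) {z : ℂ} (hz : z ^ 2 = P.csq) : z ≠ 0 := by
  rintro rfl
  apply hP.csq_ne
  rw [← hz]
  ring

theorem hat_eq_self (hP : P.IsSolution) {z : ℂ} (hz : z ^ 2 = P.csq) : P.csq / z = z := by
  rw [← hz, pow_two, mul_div_cancel_right₀ _ (ne_zero_of_sq_eq hP hz)]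

theorem im_lam_eq_zero {z : ℂ} (hz : z ^ 2 = P.csq) : (P.lam z).im = 0 := by
  by_contra h
  exact sq_ne_of_im_lam h hz

open scoped Classical in
/-- A zero of `m₁ + c m₂` at a branch point is simple: without reflection this function continues
across the continuous spectrum as `-c det E` divided by the factor of `Φ₋₂`. -/
theorem IsReflectionless.exists_tendsto_div_mFactor (hR : P.IsReflectionless) (hP : P.IsSolution)
    {c : ℂ} (hc : c ^ 2 = -P.σ) (hc0 : c ≠ 0) {z : ℂ} (hz : z ^ 2 = P.csq)
    (h0 : P.mFactor c z = 0) :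
    ∃ L, Tendsto (fun w => (w - z) / P.mFactor c w) (𝓝 z ⊓ 𝓟 {w | (P.lam w).im < 0}) (𝓝 L) := by
  have hz0 := ne_zero_of_sq_eq hP hz
  have him := im_lam_eq_zero hz
  have hl : z ∈ P.lowerDom := ⟨hz0, him.le⟩
  have hdz : P.detE z = 0 := by
    rw [detE_eq, hz, div_self hP.csq_ne, sub_self]
  have hb0 : P.mFactorHat (-c) z ≠ 0 := by
    rw [mFactorHat, hat_eq_self hP hz]
    exact mul_ne_zero (div_ne_zero (mul_ne_zero I_ne_zero hP.qm_ne') hz0)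
      ((hP.mFactor_ne_or hc0 hl).resolve_left (not_not.2 h0))
  have hbt : ∀ w, w ≠ 0 → 0 ≤ (P.lam w).im → Tendsto (P.mFactorHat (-c))
      (𝓝 w ⊓ 𝓟 {w | 0 ≤ (P.lam w).im}) (𝓝 (P.mFactorHat (-c) w)) := by
    intro w hw hw'
    have h1 : ContinuousAt (fun w : ℂ => I * P.qm / w) w := by fun_prop (disch := assumption)
    have h2 := tendsto_pi_nhds.1 (hP.tendsto_m_hat 0 0 hw hw')
    exact (h1.tendsto.mono_left inf_le_left).mul ((h2 0).add ((h2 1).const_mul (-c)))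
  have hbne : ∀ᶠ w in 𝓝 z, 0 ≤ (P.lam w).im → P.mFactorHat (-c) w ≠ 0 :=
    eventually_inf_principal.1 ((hbt z hz0 him.ge).eventually_ne hb0)
  set F : ℂ → ℂ := fun w => if 0 ≤ (P.lam w).im then -c * P.detE w / P.mFactorHat (-c) w
    else P.mFactor c w with hF
  have hFz : F z = 0 := by
    simp only [hF]
    rw [if_pos him.ge, hdz]
    simp
  have hFu : ∀ w, 0 ≤ (P.lam w).im → F w = -c * P.detE w / P.mFactorHat (-c) w :=
    fun w hw => if_pos hw
  have hFl : ∀ w, (P.lam w).im < 0 → F w = P.mFactor c w := fun w hw => if_neg hw.not_ge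
  have hFd : ∀ᶠ w in 𝓝 z, (P.lam w).im ≠ 0 → DifferentiableAt ℂ F w := by
    filter_upwards [eventually_ne_nhds hz0, hbne] with w hw hbw hlw
    rcases hlw.lt_or_gt with hlw | hlw
    · have h1 : DifferentiableAt ℂ (P.mFactor c) w :=
        (hP.differentiableAt_m_apply 0 0 hlw 0).add
          ((hP.differentiableAt_m_apply 0 0 hlw 1).const_mul c)
      refine h1.congr_of_eventuallyEq ?_
      filter_upwards [eventually_im_lam_neg hlw] with v hv using hFl v hv
    · have hlw' : (P.lam (P.csq / w)).im < 0 := by rw [hP.im_lam_hat hw]; linarith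
      have h1 : DifferentiableAt ℂ (P.mFactor (-c)) (P.csq / w) :=
        (hP.differentiableAt_m_apply 0 0 hlw' 0).add
          ((hP.differentiableAt_m_apply 0 0 hlw' 1).const_mul (-c))
      have h2 : DifferentiableAt ℂ (fun w => P.mFactor (-c) (P.csq / w)) w :=
        h1.comp w (hasDerivAt_hat hw).differentiableAt
      have h3 : DifferentiableAt ℂ (P.mFactorHat (-c)) w := by
        have h4 : DifferentiableAt ℂ
            (fun w : ℂ => I * P.qm / w * P.mFactor (-c) (P.csq / w)) w := by
          fun_prop (disch := assumption)
        exact h4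
      have h4 : DifferentiableAt ℂ (fun w => -c * P.detE w / P.mFactorHat (-c) w) w :=
        ((differentiableAt_detE hw).const_mul (-c)).div h3 (hbw hlw.le)
      refine h4.congr_of_eventuallyEq ?_
      filter_upwards [eventually_im_lam_pos hlw] with v hv using hFu v hv.le
  have hsq : ∀ᶠ w in 𝓝 z, w ^ 2 = P.csq → w = z := by
    have h1 : z ≠ -z := fun h => hz0 (self_eq_neg.1 h)
    filter_upwards [eventually_ne_nhds h1] with w hw h2
    rcases sq_eq_sq_iff_eq_or_eq_neg.1 (h2.trans hz.symm) with h3 | h3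
    · exact h3
    · exact absurd h3 hw
  have hFc : ∀ᶠ w in 𝓝 z, ContinuousAt F w := by
    filter_upwards [eventually_ne_nhds hz0, hbne, hFd, hsq] with w hw hbw hdw hsw
    by_cases hlw : (P.lam w).im = 0
    · have hbw' := hbw hlw.ge
      rw [ContinuousAt, hFu w hlw.ge]
      refine tendsto_of_upper_of_lower hFu hFl ?_ ?_
      · exact (((differentiableAt_detE hw).continuousAt.tendsto.mono_left inf_le_left).const_mul
          (-c)).div (hbt w hw hlw.ge) hbw'
      · have e : -c * P.detE w / P.mFactorHat (-c) w = P.mFactor c w := by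
          by_cases hw2 : w ^ 2 = P.csq
          · rw [hsw hw2, h0, hdz]
            simp
          · rw [div_eq_iff hbw',
              hR.mFactor_mul_mFactorHat hP hc ⟨hP.mem_Sig_iff.2 ⟨hw, hlw⟩, hw2⟩]
        rw [e]
        exact hP.tendsto_mFactor c ⟨hw, hlw.le⟩
    · exact (hdw hlw).continuousAt
  have hFD : DifferentiableAt ℂ F z :=
    differentiableAt_of_continuousAt_of_im_ne_zero (analyticAt_lam hz0)
      (deriv_lam_ne hz0 (sq_ne_neg hP hz)) hFc hFd
  have hslope := hFD.hasDerivAt.tendsto_slope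
  have hdE : HasDerivAt P.detE (2 * P.csq / z ^ 3) z := by
    have h1 : HasDerivAt (fun w : ℂ => 1 - P.csq * (w ^ 2)⁻¹) _ z :=
      (((hasDerivAt_pow 2 z).inv (pow_ne_zero 2 hz0)).const_mul P.csq).const_sub 1
    refine h1.congr_deriv ?_
    field_simp
    ring
  have hne : deriv F z ≠ 0 := by
    -- The derivative is computed along the upper side, where `F` is explicit.
    have hle : 𝓝[{w | 0 < (P.lam w).im}] z ≤ 𝓝[≠] z := by
      refine nhdsWithin_mono z fun w hw => ?_
      rintro rfl
      exact hw.ne' him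
    have hle' : 𝓝[{w | 0 < (P.lam w).im}] z ≤ 𝓝 z ⊓ 𝓟 {w | 0 ≤ (P.lam w).im} :=
      inf_le_inf_left _ (principal_mono.2 fun w (hw : 0 < (P.lam w).im) => hw.le)
    have : (𝓝[{w | 0 < (P.lam w).im}] z).NeBot :=
      frequently_iff_neBot.1 (frequently_im_lam_pos hz0 (sq_ne_neg hP hz) him)
    have h1 := ((hdE.tendsto_slope.mono_left hle).const_mul (-c)).div
      ((hbt z hz0 him.ge).mono_left hle') hb0
    have h2 := tendsto_nhds_unique (hslope.mono_left hle) (h1.congr' ?_)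
    · rw [h2]
      exact div_ne_zero (mul_ne_zero (neg_ne_zero.2 hc0)
        (div_ne_zero (mul_ne_zero two_ne_zero hP.csq_ne) (pow_ne_zero 3 hz0))) hb0
    · filter_upwards [self_mem_nhdsWithin] with w hw
      change -c * slope P.detE z w / P.mFactorHat (-c) w = _
      rw [slope_def_field, slope_def_field, hFz, hdz, hFu w (le_of_lt hw)]
      ring
  refine ⟨(deriv F z)⁻¹, ((hslope.inv₀ hne).mono_left (inf_le_inf_left _
    (principal_mono.2 fun w hw => ?_))).congr' ?_⟩
  · rintro rfl
    exact hw.ne him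
  · filter_upwards [mem_inf_of_right (mem_principal_self _)] with w hw
    rw [slope_def_field, hFz, sub_zero, inv_div, hFl w hw]

theorem IsReflectionless.tendsto_mul_inv_s₂₂ (hR : P.IsReflectionless) (hP : P.IsSolution) {z : ℂ}
    (hz : z ^ 2 = P.csq) : Tendsto (fun w => (w - z) * (P.s₂₂ w)⁻¹)
      (𝓝 z ⊓ 𝓟 {w | (P.lam w).im < 0}) (𝓝 0) := by
  have hz0 := ne_zero_of_sq_eq hP hz
  have hl : z ∈ P.lowerDom := ⟨hz0, (im_lam_eq_zero hz).le⟩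
  have hdz : P.detE z = 0 := by
    rw [detE_eq, hz, div_self hP.csq_ne, sub_self]
  obtain ⟨c, hc, hc0, hne⟩ : ∃ c : ℂ, c ^ 2 = -P.σ ∧ c ≠ 0 ∧ P.mFactor (-c) z ≠ 0 := by
    obtain ⟨c, hc, hc0⟩ := hP.exists_sq_eq
    rcases hP.mFactor_ne_or hc0 hl with h | h
    · exact ⟨-c, by rw [neg_sq, hc], neg_ne_zero.2 hc0, by rwa [neg_neg]⟩
    · exact ⟨c, hc, hc0, h⟩
  obtain ⟨L, hL⟩ : ∃ L, Tendsto (fun w => (w - z) / P.mFactor c w)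
      (𝓝 z ⊓ 𝓟 {w | (P.lam w).im < 0}) (𝓝 L) := by
    by_cases h : P.mFactor c z = 0
    · exact hR.exists_tendsto_div_mFactor hP hc hc0 hz h
    · have h1 : Continuous fun w : ℂ => w - z := by fun_prop
      exact ⟨_, ((h1.tendsto z).mono_left inf_le_left).div (hP.tendsto_mFactor c hl) h⟩
  have hd := (differentiableAt_detE (P := P) hz0).continuousAt.tendsto.mono_left
    (inf_le_left (b := 𝓟 {w | (P.lam w).im < 0}))
  have h2 := (hL.mul hd).div (hP.tendsto_mFactor (-c) hl) hne
  rw [hdz, mul_zero, zero_div] at h2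
  refine h2.congr' ?_
  filter_upwards [lowerDom_of_im_neg _] with w hw
  rw [hP.s₂₂_eq_mFactor hc hw]
  change (w - z) / P.mFactor c w * P.detE w / P.mFactor (-c) w = _
  simp only [div_eq_mul_inv, mul_inv_rev, inv_inv]
  ring

/-- The column has no poles at the branch points. -/
theorem IsReflectionless.tendsto_rhSol_branch (hR : P.IsReflectionless) (hP : P.IsSolution)
    (x t : ℝ) {z : ℂ} (hz : z ^ 2 = P.csq) :
    Tendsto (fun w => (w - z) • P.rhSol x t w) (𝓝 z) (𝓝 0) := by
  have hz0 := ne_zero_of_sq_eq hP hz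
  have him := im_lam_eq_zero hz
  have hl : z ∈ P.lowerDom := ⟨hz0, him.le⟩
  refine tendsto_of_upper_of_lower (fun z hz => by rw [rhSol_of_nonneg x t hz])
    (fun z hz => by rw [rhSol_of_neg x t hz]) ?_ ?_
  · have h1 : Continuous fun w : ℂ => w - z := by fun_prop
    have h2 := ((h1.tendsto z).mono_left inf_le_left).smul (hP.tendsto_upperSol x t hz0 him.ge)
    rwa [sub_self, zero_smul] at h2
  · have h2 := (hR.tendsto_mul_inv_s₂₂ hP hz).smul (hP.tendsto_mPlus_nhds x t hl)
    rw [zero_smul] at h2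
    refine h2.congr fun w => ?_
    rw [lowerSol, smul_smul]

/-! ### The polar expansion and the solution formula -/

section

variable {N₁ N₂ : ℕ} {z : Fin N₁ → ℂ} {w : Fin N₂ → ℝ}

/-- The polar expansion of the second column, by Liouville's theorem: the poles are the
origin and the discrete eigenvalues in `D₋`, and the value at infinity is the second unit vector. -/
theorem IsDiscreteSpectrum.m_hat_eq (hZ : P.IsDiscreteSpectrum z w) (hP : P.IsSolution)
    (hR : P.IsReflectionless) (x t : ℝ) {ζ : ℂ} (hζ : 0 < (P.lam ζ).im) (i : Fin 2) :
    I * P.qm / ζ * P.m x t (P.csq / ζ) i = (![0, 1] : Fin 2 → ℂ) i +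
      (![I * P.qm, 0] : Fin 2 → ℂ) i / ζ +
      ∑ n, P.alpha z w x t n * P.m x t (P.etaHat z w n) i / (ζ - P.etaHat z w n) := by
  set S : Set ℂ := {0} ∪ {s | s ^ 2 = P.csq} ∪ {s | (P.lam s).im = 0 ∧ s ^ 2 = -P.csq} ∪
    Set.range (P.etaHat z w) with hS
  have hsq : ∀ d : ℂ, {s : ℂ | s ^ 2 = d}.Finite := fun d => by
    obtain ⟨e, he⟩ := IsAlgClosed.exists_pow_nat_eq d two_pos
    refine (Set.toFinite {e, -e}).subset fun s hs => ?_
    exact sq_eq_sq_iff_eq_or_eq_neg.1 (Eq.trans hs he.symm)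
  have hSf : S.Finite := (((Set.finite_singleton 0).union (hsq _)).union
    ((hsq (-P.csq)).subset fun s hs => hs.2)).union (Set.finite_range _)
  have hmem : ∀ s, s ∉ S → s ≠ 0 ∧ s ^ 2 ≠ P.csq ∧ ((P.lam s).im = 0 → s ^ 2 ≠ -P.csq) ∧
      s ∉ Set.range (P.etaHat z w) := fun s hs => by
    simp only [hS, Set.mem_union, Set.mem_singleton_iff, Set.mem_ofPred_eq, not_or, not_and] at hs
    exact ⟨hs.1.1.1, hs.1.1.2, hs.1.2, hs.2⟩
  have hζS : ζ ∉ S := by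
    simp only [hS, Set.mem_union, Set.mem_singleton_iff, Set.mem_ofPred_eq, not_or, not_and]
    refine ⟨⟨⟨ne_zero_of_im_lam hζ.ne', sq_ne_of_im_lam hζ.ne'⟩, fun h => absurd h hζ.ne'⟩, ?_⟩
    rintro ⟨n, rfl⟩
    exact hζ.not_gt (hZ.im_lam_etaHat hP n)
  have hηne : ∀ n, P.etaHat z w n ≠ 0 := fun n => ne_zero_of_im_lam (hZ.im_lam_etaHat hP n).ne
  have key := eq_add_sum_poles (ι := Option (Idx N₁ N₂)) (f := fun ζ => P.rhSol x t ζ i)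
    (p := fun n => n.elim 0 (P.etaHat z w))
    (a := fun n => n.elim ((![I * P.qm, 0] : Fin 2 → ℂ) i)
      fun n => P.alpha z w x t n * P.m x t (P.etaHat z w n) i)
    (S := S) (c := (![0, 1] : Fin 2 → ℂ) i) ?_ hSf ?_ ?_ ?_ ?_ ?_ hζS
  · rw [Fintype.sum_option] at key
    simp only [Option.elim, sub_zero] at key
    rw [rhSol_of_nonneg x t hζ.le, ← add_assoc] at key
    exact key
  · rintro (_ | a) (_ | b) hab
    · rfl
    · exact absurd hab.symm (hηne b)
    · exact absurd hab (hηne a)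
    · exact congrArg some (hZ.etaHat_injective hP hab)
  · intro s hs
    obtain ⟨h1, h2, h3, h4⟩ := hmem s hs
    exact hZ.differentiableAt_rhSol hP hR x t h1 h2 h3 h4 i
  · rintro (_ | n)
    · exact Or.inl (Or.inl (Or.inl rfl))
    · exact Or.inr ⟨n, rfl⟩
  · rintro (_ | n)
    · simpa using (tendsto_pi_nhds.1 (hP.tendsto_rhSol_zero x t)) i
    · simpa using (tendsto_pi_nhds.1 (hZ.tendsto_rhSol_etaHat hP x t n)) i
  · intro s hs hsp
    have h0 : s ≠ 0 := fun h => hsp ⟨none, h.symm⟩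
    have hη : s ∉ Set.range (P.etaHat z w) := fun ⟨n, hn⟩ => hsp ⟨some n, hn⟩
    by_cases hc : s ^ 2 = P.csq
    · have h1 := (tendsto_pi_nhds.1 (hR.tendsto_rhSol_branch hP x t hc)) i
      simpa using h1.mono_left nhdsWithin_le_nhds
    · have h1 := hZ.continuousAt_rhSol_apply hP hR x t h0 hc hη i
      have h2 : ContinuousAt (fun ξ : ℂ => (ξ - s) * P.rhSol x t ξ i) s := by fun_prop
      have h3 := h2.tendsto.mono_left (nhdsWithin_le_nhds (s := {s}ᶜ))
      simpa using h3
  · rw [← Metric.cobounded_eq_cocompact]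
    exact (tendsto_pi_nhds.1 (hP.tendsto_rhSol_cobounded x t)) i

/-- The polar expansion at the points `η_k` is a linear system with matrix `H` for the values of `m`
at the points `η̂_n`. -/
theorem IsDiscreteSpectrum.H_mulVec (hZ : P.IsDiscreteSpectrum z w) (hP : P.IsSolution)
    (hR : P.IsReflectionless) (x t : ℝ) (i : Fin 2) :
    (P.H z w x t).mulVec (fun n => P.m x t (P.etaHat z w n) i) = fun k =>
      -((![0, 1] : Fin 2 → ℂ) i + (![I * P.qm, 0] : Fin 2 → ℂ) i / eta z w k) := by
  ext k
  have h := hZ.m_hat_eq hP hR x t (hZ.eta_spec hP k).1 i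
  rw [← etaHat_eq] at h
  simp only [Matrix.mulVec, dotProduct, H, Matrix.of_apply, CHat, sub_mul, ite_mul, zero_mul,
    Finset.sum_sub_distrib, Finset.sum_ite_eq, Finset.mem_univ, if_true, h]
  have e : ∀ n, P.A (P.etaHat z w n) * cexp (2 * I * P.theta x t (P.etaHat z w n)) /
      (eta z w k - P.etaHat z w n) * P.m x t (P.etaHat z w n) i =
      P.alpha z w x t n * P.m x t (P.etaHat z w n) i / (eta z w k - P.etaHat z w n) := fun n => by
    rw [alpha]
    ring
  simp only [e]
  ring

theorem eventually_im_lam_I_mul_pos : ∀ᶠ τ : ℝ in atTop, 0 < (P.lam (I * τ)).im := by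
  filter_upwards [eventually_gt_atTop (1 : ℝ), eventually_gt_atTop (-P.csq.re)] with τ h1 h2
  have h0 : I * (τ : ℂ) ≠ 0 :=
    mul_ne_zero I_ne_zero (by exact_mod_cast (by linarith : τ ≠ 0))
  rw [im_lam h0]
  have h4 : ‖I * (τ : ℂ)‖ = τ := by
    rw [norm_mul, norm_I, one_mul, Complex.norm_real, Real.norm_of_nonneg (by linarith)]
  have h5 : 0 < τ ^ 2 + P.csq.re := by nlinarith
  rw [h4]
  have h6 : (I * (τ : ℂ)).im = τ := by simp
  rw [h6]
  positivity

/-- The potential in terms of the residues, from the polar expansion along the imaginary axis. -/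
theorem IsDiscreteSpectrum.q_eq (hZ : P.IsDiscreteSpectrum z w) (hP : P.IsSolution)
    (hR : P.IsReflectionless) (x t : ℝ) :
    (P.q x t : ℂ) =
      P.qm - I * ∑ n, P.alpha z w x t n * P.m x t (P.etaHat z w n) 0 := by
  have h1 := (hP.tendsto_m_ray x t).const_mul I
  have hinv : Tendsto (fun τ : ℝ => (I * (τ : ℂ))⁻¹) atTop (𝓝 0) := by
    refine tendsto_zero_iff_norm_tendsto_zero.2 (tendsto_inv_atTop_zero.congr' ?_)
    filter_upwards [eventually_gt_atTop (0 : ℝ)] with τ hτ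
    rw [norm_inv, norm_mul, norm_I, one_mul, Complex.norm_real, Real.norm_of_nonneg hτ.le]
  have h2 : ∀ n, Tendsto (fun τ : ℝ => P.alpha z w x t n * P.m x t (P.etaHat z w n) 0 *
      (1 - P.etaHat z w n * (I * (τ : ℂ))⁻¹)⁻¹) atTop
      (𝓝 (P.alpha z w x t n * P.m x t (P.etaHat z w n) 0)) := fun n => by
    have h3 := ((hinv.const_mul (P.etaHat z w n)).const_sub 1).inv₀ (by simp)
    simpa using h3.const_mul (P.alpha z w x t n * P.m x t (P.etaHat z w n) 0)
  have h3 := (tendsto_finsetSum Finset.univ fun n _ => h2 n).const_add (I * (P.qm : ℂ))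
  have h4 := tendsto_nhds_unique h1 (h3.congr' ?_)
  · linear_combination -I * h4 + ((P.q x t : ℂ) - P.qm) * I_sq
  · filter_upwards [eventually_im_lam_I_mul_pos (P := P), eventually_gt_atTop (0 : ℝ)] with τ hτ hτ'
    have h5 := hZ.m_hat_eq hP hR x t hτ 0
    have h0 : I * (τ : ℂ) ≠ 0 := ne_zero_of_im_lam hτ.ne'
    have e : ∀ n, P.alpha z w x t n * P.m x t (P.etaHat z w n) 0 *
        (1 - P.etaHat z w n * (I * (τ : ℂ))⁻¹)⁻¹ = I * τ * (P.alpha z w x t n *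
          P.m x t (P.etaHat z w n) 0 / (I * τ - P.etaHat z w n)) := fun n => by
      have h6 : 1 - P.etaHat z w n * (I * (τ : ℂ))⁻¹ =
          (I * τ - P.etaHat z w n) / (I * τ) := by
        rw [sub_div, div_self h0, div_eq_mul_inv]
      rw [h6, inv_div]
      ring
    simp only [e, ← Finset.mul_sum]
    simp only [Matrix.cons_val_zero, zero_add] at h5
    have h7 : I * (P.qm * P.m x t (P.csq / (I * τ)) 0) =
        I * τ * (I * P.qm / (I * τ) * P.m x t (P.csq / (I * τ)) 0) := by
      generalize I * (τ : ℂ) = ζ at h0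
      field_simp
    rw [h7, h5, mul_add, mul_div_cancel₀ _ h0]

end

end NMKdVData

end

theorem mainTheorem3 (P : NMKdVData) (hP : P.IsSolution) (hR : P.IsReflectionless)
    {N₁ N₂ : ℕ} (z : Fin N₁ → ℂ) (w : Fin N₂ → ℝ) (hZ : P.IsDiscreteSpectrum z w) (x t : ℝ) :
    (P.H z w x t).det ≠ 0 ∧
      (P.q x t : ℂ) = P.qm + (P.bordered z w x t).det / (P.H z w x t).det * Complex.I := by
  have hu := hZ.H_mulVec hP hR x t 0
  have hv := hZ.H_mulVec hP hR x t 1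
  simp only [Matrix.cons_val_zero, Matrix.cons_val_one, Matrix.cons_val_fin_one, zero_add, zero_div,
    add_zero] at hu hv
  have hdet : (P.H z w x t).det ≠ 0 := by
    refine det_ne_zero_of_solvable (α := P.alpha z w x t) (c := P.csq) (hZ.eta_ne hP)
      (mul_ne_zero I_ne_zero hP.qm_ne') (fun k n h => ?_) hZ.eta_injective (fun k n => ?_) hu hv
    · -- Otherwise `η_k` would be the reflected point of `η_n`.
      have h1 : NMKdVData.eta z w k = P.etaHat z w n := by
        rw [NMKdVData.etaHat_eq, eq_div_iff (hZ.eta_ne hP n), h]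
      have h2 := (hZ.eta_spec hP k).1
      rw [h1] at h2
      exact h2.not_gt (hZ.im_lam_etaHat hP n)
    · rfl
  refine ⟨hdet, ?_⟩
  rw [hZ.q_eq hP hR x t, NMKdVData.bordered,
    det_fromBlocks_replicate_zero hdet (β := P.beta z w) hu,
    mul_div_cancel_left₀ _ hdet]
  ring
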